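/- **Setting.** Let $X\subset\mathbb R^d$ be a finite nonempty set of $n$ points and $k\ge 1$. A clustering $A$ of $X$ is a partition of $X$ into $k'$ nonempty clusters $A_1,\dots,A_{k'}$, $1\le k'\le k$; let $n_r=|A_r|$, let $m(A_r)$ be the mean of $A_r$, and $m(A)=\{m(A_r)\}_r$. For centroids $C$ paired with a clustering $A$ let $\phi(C,A)=\sum_r\sum_{x\in A_r}\|x-c_r\|^2$, and let $\phi^{opt}=\min_A\phi(m(A),A)$, the minimum being over all clusterings with at most $k$ clusters. We write $C\in v^{-1}(A)$ if the clusters of $A$ can be matched injectively with centroids of $C$ so that each $x\in X$ is strictly closer to the centroid of its own cluster than to all other centroids of $C$; $C$ is a boundary point of $v^{-1}(A)$ if this holds with $\le$ in place of $<$ and equality is attained for at least one $x$. The closure $Cl(v^{-1}(A))$ is $v^{-1}(A)$ together with its boundary points. $A$ is stationary if $m(A)\in Cl(v^{-1}(A))$; $\{A^*\}_{[k]}$ is the set of all stationary clusterings with at most $k$ clusters, and $m(A^*)$, $A^*\in\{A^*\}_{[k]}$, are the stationary points. For $k$ centroids $C$, some of whose Voronoi clusters may be empty (degenerate centroids), $\phi(C)$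 is the cost of $C$ with respect to its own Voronoi clustering. If $C$ has exactly as many nondegenerate centroids as $A^*$ has clusters, put $\Delta(C,m(A^*))=\min_\pi\sum_r n^*_r\|c_{\pi(r)}-m(A^*_r)\|^2$ over the bijections $\pi$ from the clusters of $A^*$ to the nondegenerate centroids of $C$; otherwise $\Delta(C,m(A^*))$ is undefined. With $\phi^*=\phi(m(A^*),A^*)$, a stationary point $m(A^*)$ is $(b_0,\alpha)$-stable, $0\le\alpha<1$, if for every $C$ with Voronoi clusters $A_r$ (ties broken in any way) for which $\Delta(C,m(A^*))$ is defined, every minimizing $\pi$, and every $b'\in[0,b_0]$ with $\Delta(C,m(A^*))\le b'\phi^*$, there is $b\in[0,\alpha b']$ with $\max_r|A_{\pi(r)}\triangle A^*_r|/n^*_r\le b/(5b+4(1+\phi(C)/\phi^*))$ (a quotient with denominator $0$ being read as $0$). **Algorithm.** Let $C^0$ be any $k$ initial centroids and $m\ge1$. At iteration $t\ge 1$ draw $m$ points of $X$ independently and uniformly with replacement, independently of the past. Let $A^t$ be the Voronoi clustering of $X$ by $C^{t-1}$ (ties broken by an arbitrary fixed rule depending on the centroids and the point), with clusters $A^t_r$,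 and assign each sampled point to a centroid accordingly. Let $\hat c_r^t$ be the mean of the sampled points assigned to centroid $r$, and $\hat c_r^t=c_r^{t-1}$ if there are none. Set $c_r^t=(1-\eta^t)c_r^{t-1}+\eta^t\hat c_r^t$ with $\eta^t=\frac{c'}{t+t_o}$, $c',t_o>0$. Let $F_t$ be the $\sigma$-algebra generated by $C^0,\dots,C^t$, $\phi^t=\phi(C^t)$, and let $p_r^t(m)$ be the probability, given $C^{t-1}$, that some sampled point is assigned to centroid $r$ at iteration $t$. Put $$p^+_{\min}(m)=\min_{r:\,p_r^t(m)>0}p_r^t(m),\qquad p^*_{\min}=\min_{A^{**}\in\{A^*\}_{[k]}}\min_r\frac{n_r^{**}}{n},\qquad \rho(m)=1-(1-p^*_{\min})^m .$$ **Assumptions.** (A0) $m(A^*)\in v^{-1}(A^*)$ for all $A^*\in\{A^*\}_{[k]}$. Let $r_{\min}>0$ be such that all stationary points are $(r_{\min},0)$-stable. (A1) Almost surely, for all $t\ge 1$, for every $A^*\in\{A^*\}_{[k]}$ with means $c_r^*$ and cluster sizes $n_r^*$, and every labelling of its clusters by distinct indices $r\in[k]$, the three quantities $$E\Big[\sum_r\sum_{x\in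 A_r^{t+1}}\|x-\hat c_r^{t+1}\|^2+\phi^t\,\Big|\,F_t\Big],\quad \sum_r n_r^*\big\langle c_r^{t-1}-c_r^*,\ \hat c_r^t-E[\hat c_r^t|F_{t-1}]\big\rangle,\quad \sum_r n_r^*\|\hat c_r^t-c_r^*\|^2$$ are at most $B$. **Theorem.** Assume (A0). There is a constant $K_0>0$ depending only on $X,k,r_{\min},B$ such that the following holds for every $m\ge 1$, every tie-breaking rule, every $C^0$ and every $\delta\in(0,1)$. Suppose that $c',t_o>0$, that (A1) holds with the bound $B$, that for all $t\ge 1$ and all realizations of the samples $$c'>\frac{1}{2p^+_{\min}(m)\Big(1-\sqrt{1-\frac{r_{\min}\phi^{opt}}{2\phi^t}}\Big)}$$ (where a square root of a negative number is read as $0$, and $1/0$ as $+\infty$; so the condition fails if $\phi^{opt}=0$), and that $$t_o\ \ge\ K_0\Big[\frac{(c')^2}{\rho(m)^2(2c'-1)}\ln\frac1\delta\Big]^{\frac{2}{2c'-1}} .$$ Then the event $G=\{\exists T,\ \exists A^{**}\in\{A^*\}_{[k]}:\ A^t=A^{**}\ \forall t\ge T\}$ satisfies $\Pr(G)\ge1-\delta$.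 Moreover there are events $G_o(A^{**})$, $A^{**}\in\{A^*\}_{[k]}$, such that $G_o(A^{**})\subseteq\{\exists T:\ A^t=A^{**}\ \forall t\ge T\}$, such that $$\Pr\Big\{\bigcup_{A^{**}\in\{A^*\}_{[k]}}G_o(A^{**})\Big\}\ge 1-\delta,$$ and such that for every $A^{**}\in\{A^*\}_{[k]}$ with $\Pr(G_o(A^{**}))>0$ there is a constant $K$ with $$\big|E\{\phi^t-\phi(m(A^{**}))\mid G_o(A^{**})\}\big|\le \frac{K}{t}\qquad\text{for all } t\ge1 .$$ -/

import Mathlib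

open scoped Classical

namespace KMeans

open MeasureTheory ProbabilityTheory

/-- The ambient Euclidean space. -/
abbrev Pt (d : ℕ) := EuclideanSpace ℝ (Fin d)

noncomputable section

/-! ### Clusterings, centroids and costs

A `k'`-clustering of the finite dataset `X` is a partition of `X` into `k'` nonempty clusters,
that is, a `Finpartition X` with `k'` parts. -/

/-- The mean `m(Y)` of a finite point set. -/
def mean {d : ℕ} (Y : Finset (Pt d)) : Pt d := (Y.card : ℝ)⁻¹ • ∑ x ∈ Y, x

/-- The centroids `m(A)` induced by a clustering `A`, indexed by the clusters of `A`. -/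
def means {d : ℕ} {X : Finset (Pt d)} (A : Finpartition X) : A.parts → Pt d :=
  fun P => mean P.1

/-- The cost `φ(C, A) = ∑ r, ∑ x ∈ A r, ‖x - C r‖ ^ 2`. -/
def costWith {d : ℕ} {ι : Type*} [Fintype ι] (C : ι → Pt d) (A : ι → Finset (Pt d)) : ℝ :=
  ∑ r, ∑ x ∈ A r, ‖x - C r‖ ^ 2

/-- The cost `φ(m(A))` of a clustering `A` with respect to its own means. -/
def clusteringCost {d : ℕ} {X : Finset (Pt d)} (A : Finpartition X) : ℝ :=
  costWith (means A) (fun P : A.parts => P.1)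

/-- `φ^opt`: the least cost of a clustering of `X` into at most `k` clusters. -/
def optCost {d : ℕ} (X : Finset (Pt d)) (k : ℕ) : ℝ :=
  sInf {v : ℝ | ∃ A : Finpartition X, A.parts.card ≤ k ∧ v = clusteringCost A}

/-! ### Stationary clusterings -/

/-- `C ∈ v⁻¹(A)`: the clusters of `A` can be matched injectively with centroids of `C` so that
every point is strictly closer to the centroid of its own cluster than to all other centroids. -/
def InCell {d : ℕ} {ι : Type*} {X : Finset (Pt d)} (C : ι → Pt d) (A : Finpartition X) : Prop :=
  ∃ π : A.parts ↪ ι, ∀ P : A.parts, ∀ x ∈ P.1, ∀ s, s ≠ π P → ‖x - C (π P)‖ < ‖x - C s‖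

/-- `C` is a boundary point of `v⁻¹(A)`: the same with weak inequalities, equality being attained
for at least one data point. -/
def IsBoundaryPoint {d : ℕ} {ι : Type*} {X : Finset (Pt d)} (C : ι → Pt d)
    (A : Finpartition X) : Prop :=
  ∃ π : A.parts ↪ ι,
    (∀ P : A.parts, ∀ x ∈ P.1, ∀ s, s ≠ π P → ‖x - C (π P)‖ ≤ ‖x - C s‖) ∧
    ∃ P : A.parts, ∃ x ∈ P.1, ∃ s, s ≠ π P ∧ ‖x - C (π P)‖ = ‖x - C s‖

/-- `A` is a stationary clustering with at most `k` clusters: `m(A) ∈ Cl(v⁻¹(A))`, the closure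
being `v⁻¹(A)` together with its boundary points. -/
def IsStationary {d : ℕ} {X : Finset (Pt d)} (k : ℕ) (A : Finpartition X) : Prop :=
  A.parts.card ≤ k ∧ (InCell (means A) A ∨ IsBoundaryPoint (means A) A)

/-- No stationary point (with at most `k` clusters) is a boundary point. -/
def NoBoundaryStationary {d : ℕ} (X : Finset (Pt d)) (k : ℕ) : Prop :=
  ∀ A : Finpartition X, IsStationary k A → InCell (means A) A

/-- `p*_min`: the least relative cluster size over all stationary clusterings. -/
def pStarMin {d : ℕ} (X : Finset (Pt d)) (k : ℕ) : ℝ :=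
  sInf {q : ℝ | ∃ A : Finpartition X, IsStationary k A ∧
    ∃ P ∈ A.parts, q = (P.card : ℝ) / (X.card : ℝ)}

/-- `ρ(m) = 1 - (1 - p*_min) ^ m`. -/
def rho {d : ℕ} (X : Finset (Pt d)) (k m : ℕ) : ℝ := 1 - (1 - pStarMin X k) ^ m

/-! ### Voronoi clusterings of `k` centroids -/

/-- `a` assigns every point of `X` to a closest centroid of `C` (ties broken in any way). -/
def IsVoronoi {d k : ℕ} (X : Finset (Pt d)) (C : Fin k → Pt d) (a : Pt d → Fin k) : Prop :=
  ∀ x ∈ X, ∀ s, ‖x - C (a x)‖ ≤ ‖x - C s‖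

/-- The `r`-th (possibly empty) cluster of an assignment. -/
def cell {d k : ℕ} (X : Finset (Pt d)) (a : Pt d → Fin k) (r : Fin k) : Finset (Pt d) :=
  X.filter (fun x => a x = r)

/-- The clustering of `X` formed by the nonempty clusters of an assignment. -/
def clusteringOf {d k : ℕ} (X : Finset (Pt d)) (a : Pt d → Fin k) : Finpartition X :=
  Finpartition.ofErase (Finset.univ.image (cell X a))
    (by
      rw [Finset.supIndep_iff_pairwiseDisjoint]
      intro P hP Q hQ hPQ
      simp only [Finset.coe_image, Finset.coe_univ, Set.image_univ, Set.mem_range] at hP hQ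
      obtain ⟨r, rfl⟩ := hP
      obtain ⟨s, rfl⟩ := hQ
      have hrs : r ≠ s := fun h => hPQ (by rw [h])
      simp only [Function.onFun, id]
      rw [Finset.disjoint_left]
      intro x hx hx'
      simp only [cell, Finset.mem_filter] at hx hx'
      exact hrs (hx.2.symm.trans hx'.2))
    (by
      ext x
      simp [Finset.mem_sup, cell])

/-- The nondegenerate centroids: those with a nonempty cluster. -/
abbrev Active {d k : ℕ} (X : Finset (Pt d)) (a : Pt d → Fin k) : Type :=
  {r : Fin k // (cell X a r).Nonempty}

/-- The sum `∑ r, n_r ‖C (π r) - m(A_r)‖ ^ 2` for a matching `π` of the clusters of `A` with the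
nondegenerate centroids of `C`. -/
def matchingCost {d k : ℕ} {X : Finset (Pt d)} (C : Fin k → Pt d) (a : Pt d → Fin k)
    (A : Finpartition X) (π : A.parts ≃ Active X a) : ℝ :=
  ∑ P : A.parts, (P.1.card : ℝ) * ‖C (π P).1 - means A P‖ ^ 2

/-- `π` attains the centroidal distance `Δ(C, m(A))`, i.e. it minimizes `matchingCost`.  Such a `π`
exists exactly when `C` has as many nondegenerate centroids as `A` has clusters, which is when
`Δ(C, m(A))` is defined. -/
def AttainsDist {d k : ℕ} {X : Finset (Pt d)} (C : Fin k → Pt d) (a : Pt d → Fin k)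
    (A : Finpartition X) (π : A.parts ≃ Active X a) : Prop :=
  ∀ π' : A.parts ≃ Active X a, matchingCost C a A π ≤ matchingCost C a A π'

/-- `m(A)` is a `(b₀, α)`-stable stationary point of batch `k`-means. -/
def IsStable {d : ℕ} {X : Finset (Pt d)} (k : ℕ) (A : Finpartition X) (b₀ α : ℝ) : Prop :=
  IsStationary k A ∧ 0 ≤ α ∧ α < 1 ∧
    ∀ (C : Fin k → Pt d) (a : Pt d → Fin k), IsVoronoi X C a →
      ∀ π : A.parts ≃ Active X a, AttainsDist C a A π →
        ∀ b' : ℝ, 0 ≤ b' → b' ≤ b₀ → matchingCost C a A π ≤ b' * clusteringCost A →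
          ∃ b : ℝ, 0 ≤ b ∧ b ≤ α * b' ∧ ∀ P : A.parts,
            ((symmDiff (cell X a (π P).1) P.1).card : ℝ) / (P.1.card : ℝ) ≤
              b / (5 * b + 4 * (1 + costWith C (cell X a) / clusteringCost A))

/-! ### Stochastic `k`-means

`near C x` is the index `I(x)` of the centroid of `C` to which the algorithm assigns `x`. -/

/-- The indices of the sampled points in the mini-batch `S` which are assigned to centroid `r`. -/
def hits {d k m : ℕ} {X : Finset (Pt d)} (near : (Fin k → Pt d) → Pt d → Fin k)
    (C : Fin k → Pt d) (S : Fin m → X) (r : Fin k) : Finset (Fin m) :=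
  Finset.univ.filter (fun i => near C (S i).1 = r)

/-- `ĉ_r`: the mean of the sampled points assigned to centroid `r`, and the current centroid if
there are none (so that such a centroid does not move). -/
def batchMean {d k m : ℕ} {X : Finset (Pt d)} (near : (Fin k → Pt d) → Pt d → Fin k)
    (C : Fin k → Pt d) (S : Fin m → X) (r : Fin k) : Pt d :=
  if (hits near C S r).Nonempty then
    ((hits near C S r).card : ℝ)⁻¹ • ∑ i ∈ hits near C S r, (S i).1
  else C r

/-- One iteration with learning rate `η` and mini-batch `S`. -/
def step {d k m : ℕ} {X : Finset (Pt d)} (near : (Fin k → Pt d) → Pt d → Fin k)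
    (η : ℝ) (C : Fin k → Pt d) (S : Fin m → X) : Fin k → Pt d :=
  fun r => (1 - η) • C r + η • batchMean near C S r

/-- The centroids `C^t`.  The mini-batch of iteration `t + 1` is `ω t`, and the learning rate of
iteration `t` is `c' / (t + t_o)`. -/
def centroids {d k m : ℕ} {X : Finset (Pt d)} (near : (Fin k → Pt d) → Pt d → Fin k)
    (c' t_o : ℝ) (C₀ : Fin k → Pt d) (ω : ℕ → Fin m → X) : ℕ → Fin k → Pt d
  | 0 => C₀
  | t + 1 => step near (c' / (((t + 1 : ℕ) : ℝ) + t_o)) (centroids near c' t_o C₀ ω t) (ω t)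

/-- The uniform law of a mini-batch: `m` independent uniform draws from `X` with replacement. -/
def batchLaw {d : ℕ} (X : Finset (Pt d)) [Nonempty X] (m : ℕ) : Measure (Fin m → X) :=
  (PMF.uniformOfFintype (Fin m → X)).toMeasure

/-- The law of the sequence of independent mini-batches. -/
def sampleLaw {d : ℕ} (X : Finset (Pt d)) [Nonempty X] (m : ℕ) : Measure (ℕ → Fin m → X) :=
  Measure.infinitePi (fun _ : ℕ => batchLaw X m)

/-- `p_r^t(m)` as a function of the centroids `C = C^{t-1}`: the probability that centroid `r` is
updated, i.e. that some point of the mini-batch is assigned to it. -/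
def updateProb {d k : ℕ} (X : Finset (Pt d)) [Nonempty X] (m : ℕ)
    (near : (Fin k → Pt d) → Pt d → Fin k) (C : Fin k → Pt d) (r : Fin k) : ℝ :=
  (batchLaw X m).real {S | (hits near C S r).Nonempty}

/-- `p⁺_min(m)`: the least positive update probability, as a function of `C = C^{t-1}`. -/
def pMinPlus {d k : ℕ} (X : Finset (Pt d)) [Nonempty X] (m : ℕ)
    (near : (Fin k → Pt d) → Pt d → Fin k) (C : Fin k → Pt d) : ℝ :=
  sInf {p : ℝ | 0 < p ∧ ∃ r, p = updateProb X m near C r}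

/-- The cost `φ(C)`, with respect to the clustering `v(C)`. -/
def cost {d k : ℕ} (X : Finset (Pt d)) (near : (Fin k → Pt d) → Pt d → Fin k)
    (C : Fin k → Pt d) : ℝ :=
  costWith C (cell X (near C))

/-- The natural filtration: `F_t` is generated by `C^0, …, C^t`. -/
abbrev natFiltration {d k m : ℕ} {X : Finset (Pt d)} (near : (Fin k → Pt d) → Pt d → Fin k)
    (c' t_o : ℝ) (C₀ : Fin k → Pt d) (t : ℕ) : MeasurableSpace (ℕ → Fin m → X) :=
  ⨆ s : Fin (t + 1), MeasurableSpace.comap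
    (fun ω : ℕ → Fin m → X => centroids near c' t_o C₀ ω s) inferInstance

/-- Almost surely and at all times, `B` bounds the three quantities below.  In
the last two, the clusters of a stationary clustering are labelled by distinct indices in `[k]`.
Here `centroids … ω t` is `C^t`, and `batchMean near (centroids … ω t) (ω t) r` is `ĉ_r^{t+1}`. -/
structure BoundedMoments {d k : ℕ} (X : Finset (Pt d)) [Nonempty X] (m : ℕ)
    (near : (Fin k → Pt d) → Pt d → Fin k) (c' t_o : ℝ) (C₀ : Fin k → Pt d) (B : ℝ) : Prop where
  secondMoment : ∀ t : ℕ, 1 ≤ t → ∀ᵐ ω ∂(sampleLaw X m),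
    ((sampleLaw X m)[fun ω' : ℕ → Fin m → X =>
        (∑ r, ∑ x ∈ cell X (near (centroids near c' t_o C₀ ω' t)) r,
          ‖x - batchMean near (centroids near c' t_o C₀ ω' t) (ω' t) r‖ ^ 2)
        + cost X near (centroids near c' t_o C₀ ω' t)
      | natFiltration near c' t_o C₀ t]) ω ≤ B
  noise : ∀ A : Finpartition X, IsStationary k A → ∀ π : A.parts ↪ Fin k,
    ∀ t : ℕ, ∀ᵐ ω ∂(sampleLaw X m),
      ∑ P : A.parts, (P.1.card : ℝ) *
        inner ℝ (centroids near c' t_o C₀ ω t (π P) - means A P)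
          (batchMean near (centroids near c' t_o C₀ ω t) (ω t) (π P)
            - ((sampleLaw X m)[fun ω' : ℕ → Fin m → X =>
                batchMean near (centroids near c' t_o C₀ ω' t) (ω' t) (π P)
              | natFiltration near c' t_o C₀ t]) ω) ≤ B
  deviation : ∀ A : Finpartition X, IsStationary k A → ∀ π : A.parts ↪ Fin k,
    ∀ t : ℕ, ∀ᵐ ω ∂(sampleLaw X m),
      ∑ P : A.parts, (P.1.card : ℝ) *
        ‖batchMean near (centroids near c' t_o C₀ ω t) (ω t) (π P) - means A P‖ ^ 2 ≤ B

/-- The event that the clusterings `A^{t+1} = v(C^t)` are eventually all equal to `A`. -/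
def eventuallyAt {d k : ℕ} {X : Finset (Pt d)} (m : ℕ) (near : (Fin k → Pt d) → Pt d → Fin k)
    (c' t_o : ℝ) (C₀ : Fin k → Pt d) (A : Finpartition X) : Set (ℕ → Fin m → X) :=
  {ω | ∃ T : ℕ, ∀ t ≥ T, clusteringOf X (near (centroids near c' t_o C₀ ω t)) = A}

end

end KMeans

namespace KMeans

open MeasureTheory ProbabilityTheory

noncomputable section

set_option linter.unusedSectionVars false

/-! ### Markov chains driven by uniform samples from a finite set -/

/-! The pair (time, centroids) is a Markov chain driven by uniform draws from a finite set of
mini-batches. The theorem follows from a stronger fact: almost surely its clustering is eventually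
constant and stationary (`unsettledProb_zero_eq_zero`).

The cost splits as `level + spread`. The level is the cost of the clusters at their own means; it
takes finitely many values, separated by some `γ`. The spread is the weighted squared distance of
the centroids from those means. One iteration lowers the expected cost by at least a constant times
rate times spread, up to an error of order rate squared (`avg_costWith_step_le`). The rates have
divergent sum and summable squares. Hence the cost plus the noise still to come is a
supermartingale, and the chain cannot stay where the spread is bounded below. Where the spread is
small, the clustering is stationary.

The difficulty is that the clustering may keep changing near stationary points. By (A0), a change at
an unchanged level comes from a degenerate centroid capturing a point that is not the mean of its
new cluster (`exists_switch`). Sampling this point a fixed number `j` of times drags the centroid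
towards it and expels the points on the other side of the mean, so that the level drops
(`exists_path_level_lt`). The cost is then about `γ` or more above the level, which gives a downward
drift of the order of the rate. An exponential supermartingale with exponent scaled by 1/rate turns
this drift into a descent whose probability is bounded below uniformly in time
(`unsettledProb_le_of_level_lt`).

Let `H` be the supremum of the probability of not settling, over late times and bounded centroids.
If this probability is at most `(1 - q) * H` at costs up to `c`, then the same holds up to `c + γ /
8` with a smaller positive `q` (`costBound_step`). Starting below cost zero and climbing past the
largest cost gives `H ≤ (1 - q) * H`, so `H = 0`.

For the rate, `G_o(A)` is the event that `A` persists from one large time `T` on. The condition on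
`c'` gives `2 * c' * p ≥ 1 + g` for all update probabilities `p` of nonempty clusters, with a fixed
`g > 0`. The expected excess cost, restricted to persistence so far, then contracts by `1 - (1 + g)
/ (t + 1 + t_o)` with noise of order `1 / t ^ 2`, hence is `O(1 / t)` (`stayIntegral_succ_le`,
`exists_le_div_of_recursion`). -/

/-- The uniform average of a function on a finite type. -/
def avg {S : Type*} [Fintype S] (f : S → ℝ) : ℝ := (Fintype.card S : ℝ)⁻¹ * ∑ s, f s

/-! ### Averages over one mini-batch. -/

section Average

variable {S : Type*} [Fintype S]

theorem avg_mono {f g : S → ℝ} (h : ∀ s, f s ≤ g s) : avg f ≤ avg g :=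
  mul_le_mul_of_nonneg_left (Finset.sum_le_sum fun s _ => h s) (by positivity)

theorem avg_add (f g : S → ℝ) : avg (fun s => f s + g s) = avg f + avg g := by
  simp [avg, Finset.sum_add_distrib, mul_add]

theorem avg_const_mul (c : ℝ) (f : S → ℝ) : avg (fun s => c * f s) = c * avg f := by
  simp only [avg, ← Finset.mul_sum]; ring

theorem avg_sum {ι : Type*} (t : Finset ι) (f : ι → S → ℝ) :
    avg (fun s => ∑ i ∈ t, f i s) = ∑ i ∈ t, avg (f i) := by
  simp only [avg, ← Finset.mul_sum]
  rw [Finset.sum_comm]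

variable [Nonempty S]

theorem avg_const (c : ℝ) : avg (fun _ : S => c) = c := by
  simp [avg]

theorem avg_le_of_forall_le {f : S → ℝ} {c : ℝ} (h : ∀ s, f s ≤ c) : avg f ≤ c :=
  (avg_mono h).trans_eq (avg_const c)

/-- One value of the function is at most its average. -/
theorem exists_le_avg (f : S → ℝ) : ∃ s, f s ≤ avg f := by
  by_contra! h
  have hlt : ∑ _s : S, avg f < ∑ s, f s :=
    Finset.sum_lt_sum_of_nonempty Finset.univ_nonempty fun s _ => h s
  have hc : (0 : ℝ) < Fintype.card S := by exact_mod_cast Fintype.card_pos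
  simp only [Finset.sum_const, Finset.card_univ, nsmul_eq_mul] at hlt
  have : (Fintype.card S : ℝ) * avg f = ∑ s, f s := by simp [avg, hc.ne']
  linarith

/-- If a function bounded by `c` takes a value at most `b`, then its average is below `c`. -/
theorem avg_le_of_le_of_apply_le {f : S → ℝ} {b c : ℝ} (h : ∀ s, f s ≤ c) (s₀ : S)
    (h₀ : f s₀ ≤ b) :
    avg f ≤ (1 - (Fintype.card S : ℝ)⁻¹) * c + (Fintype.card S : ℝ)⁻¹ * b := by
  have hc : (0 : ℝ) < Fintype.card S := by exact_mod_cast Fintype.card_pos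
  have h1 : avg f ≤ avg (fun s => c + if s = s₀ then b - c else 0) := by
    refine avg_mono fun s => ?_
    split_ifs with hs
    · subst hs; linarith
    · simpa using h s
  refine h1.trans_eq ?_
  rw [avg_add, avg_const]
  simp [avg]
  ring

end Average

/-- The trajectory started at `x` of the chain with update map `F` driven by the samples `ω`. -/
def path {S σ : Type*} (F : σ → S → σ) (x : σ) (ω : ℕ → S) : ℕ → σ
  | 0 => x
  | n + 1 => F (path F x ω n) (ω n)

/-- The samples after the first one. -/
def tail {S : Type*} (ω : ℕ → S) : ℕ → S := fun i => ω (i + 1)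

/-! ### First-step analysis, comparison and exit of driven chains. -/

section Chain

variable {S σ : Type*}

/-- `path` is defined by its last step; first-step analysis needs the decomposition at the first. -/
theorem path_succ (F : σ → S → σ) (x : σ) (ω : ℕ → S) (n : ℕ) :
    path F x ω (n + 1) = path F (F x (ω 0)) (tail ω) n := by
  induction n with
  | zero => rfl
  | succ n ih => rw [path, ih]; rfl

/-- The sequence of samples with first sample `s` and tail `ω`. -/
def consSample (p : S × (ℕ → S)) : ℕ → S
  | 0 => p.1
  | i + 1 => p.2 i

variable [MeasurableSpace S]

theorem measurable_tail : Measurable (tail : (ℕ → S) → ℕ → S) :=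
  measurable_pi_iff.2 fun i => measurable_pi_apply (i + 1)

theorem measurable_consSample : Measurable (consSample : S × (ℕ → S) → ℕ → S) :=
  measurable_pi_iff.2 fun i => by
    cases i with
    | zero => exact measurable_fst
    | succ i => exact (measurable_pi_apply i).comp measurable_snd

variable [Fintype S] [Nonempty S]

/-- The law of a sequence of independent uniform samples. -/
def uniformLaw (S : Type*) [Fintype S] [Nonempty S] [MeasurableSpace S] : Measure (ℕ → S) :=
  Measure.infinitePi (fun _ : ℕ => (PMF.uniformOfFintype S).toMeasure)

instance : IsProbabilityMeasure (uniformLaw S) := by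
  unfold uniformLaw; infer_instance

theorem uniformLaw_eq_map_consSample :
    (((PMF.uniformOfFintype S).toMeasure).prod (uniformLaw S)).map consSample = uniformLaw S := by
  set ν := (PMF.uniformOfFintype S).toMeasure with hν
  refine Measure.eq_infinitePi (fun _ : ℕ => ν) fun s t ht => ?_
  -- Padding with `Set.univ` turns the box over `s` into one over an initial segment, where the
  -- first coordinate splits off.
  set t' : ℕ → Set S := fun i => if i ∈ s then t i else Set.univ with ht'
  have htm : ∀ i, MeasurableSet (t' i) := fun i => by
    simp only [ht']; split_ifs <;> simp [ht]
  obtain ⟨N, hN⟩ : ∃ N, s ⊆ Finset.range (N + 1) := by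
    refine ⟨s.sup id, fun i hi => ?_⟩
    have : i ≤ s.sup id := Finset.le_sup (f := id) hi
    simpa using Nat.lt_succ_of_le this
  have hpi : Set.pi (s : Set ℕ) t = Set.pi (Finset.range (N + 1) : Set ℕ) t' := by
    ext ω
    simp only [Set.mem_pi, Finset.mem_coe, ht']
    constructor
    · intro h i _
      split_ifs with his
      · exact h i his
      · trivial
    · intro h i hi
      simpa [hi] using h i (hN hi)
  have hprod : ∏ i ∈ s, ν (t i) = ∏ i ∈ Finset.range (N + 1), ν (t' i) := by
    rw [← Finset.prod_subset hN]
    · exact Finset.prod_congr rfl fun i hi => by simp [ht', hi]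
    · intro i _ hi
      simp [ht', hi]
  have hpre : consSample ⁻¹' (Set.pi (Finset.range (N + 1) : Set ℕ) t') =
      t' 0 ×ˢ Set.pi (Finset.range N : Set ℕ) (fun i => t' (i + 1)) := by
    ext p
    simp only [Set.mem_preimage, Set.mem_pi, Finset.coe_range, Set.mem_Iio, Set.mem_prod]
    constructor
    · intro h
      exact ⟨h 0 (by omega), fun i hi => h (i + 1) (by omega)⟩
    · rintro ⟨h0, h1⟩ i hi
      cases i with
      | zero => exact h0
      | succ i => exact h1 i (by omega)
  rw [Measure.map_apply measurable_consSample
    (MeasurableSet.pi s.countable_toSet fun i _ => ht i), hpi, hpre, Measure.prod_prod, hprod,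
    Finset.prod_range_succ', uniformLaw, Measure.infinitePi_pi _ fun i _ => htm (i + 1), mul_comm]

variable [MeasurableSingletonClass S]

/-- Conditioning on the first sample. -/
theorem uniformLaw_real_eq_avg {E : Set (ℕ → S)} {E' : S → Set (ℕ → S)} (hE : MeasurableSet E)
    (h : ∀ ω, ω ∈ E ↔ tail ω ∈ E' (ω 0)) :
    (uniformLaw S).real E = avg fun s => (uniformLaw S).real (E' s) := by
  have hpre : ∀ s, Prod.mk s ⁻¹' (consSample ⁻¹' E) = E' s := fun s => by
    ext ω
    exact h (consSample (s, ω))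
  rw [Measure.real, ← uniformLaw_eq_map_consSample,
    Measure.map_apply measurable_consSample hE, uniformLaw_eq_map_consSample,
    Measure.prod_apply (measurable_consSample hE)]
  simp only [hpre]
  rw [lintegral_fintype, ENNReal.toReal_sum]
  · simp only [avg, Finset.mul_sum, ENNReal.toReal_mul, Measure.real]
    refine Finset.sum_congr rfl fun s _ => ?_
    rw [PMF.toMeasure_apply_singleton _ _ (measurableSet_singleton s)]
    simp [mul_comm]
  · intro s _
    exact ENNReal.mul_ne_top (measure_ne_top _ _) (measure_ne_top _ _)

variable (F : σ → S → σ)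

/-- No measurability of `D` is needed: the state at time `n` depends on finitely many samples from a
finite set. -/
theorem measurableSet_path (D : Set σ) (n : ℕ) (x : σ) :
    MeasurableSet {ω | path F x ω n ∈ D} := by
  induction n generalizing x with
  | zero => exact MeasurableSet.const (x ∈ D)
  | succ n ih =>
    have : {ω | path F x ω (n + 1) ∈ D} =
        ⋃ s : S, {ω : ℕ → S | ω 0 = s} ∩ tail ⁻¹' {ω | path F (F x s) ω n ∈ D} := by
      ext ω
      simp [path_succ]
    rw [this]
    refine MeasurableSet.iUnion fun s => MeasurableSet.inter ?_ (measurable_tail (ih _))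
    have h0 : Measurable fun ω : ℕ → S => ω 0 := measurable_pi_apply 0
    exact h0 (measurableSet_singleton s)

/-- The event that the trajectory stays in `D` during the first `N` times. -/
def stays (D : Set σ) (x : σ) (N : ℕ) : Set (ℕ → S) := {ω | ∀ n < N, path F x ω n ∈ D}

theorem measurableSet_stays (D : Set σ) (x : σ) (N : ℕ) : MeasurableSet (stays F D x N) := by
  have : stays F D x N = ⋂ n : ℕ, ⋂ _ : n < N, {ω | path F x ω n ∈ D} := by
    ext ω; simp [stays]
  rw [this]
  exact MeasurableSet.iInter fun n => MeasurableSet.iInter fun _ => measurableSet_path F D n x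

theorem antitone_stays (D : Set σ) (x : σ) : Antitone (stays F D x) :=
  fun _ _ hMN _ hω n hn => hω n (hn.trans_le hMN)

theorem iInter_stays (D : Set σ) (x : σ) :
    ⋂ N, stays F D x N = {ω | ∀ n, path F x ω n ∈ D} := by
  ext ω
  simp only [Set.mem_iInter, stays, Set.mem_ofPred_eq]
  exact ⟨fun h n => h (n + 1) n (Nat.lt_succ_self n), fun h _ n _ => h n⟩

theorem mem_stays_succ {D : Set σ} {x : σ} (hx : x ∈ D) (N : ℕ) (ω : ℕ → S) :
    ω ∈ stays F D x (N + 1) ↔ tail ω ∈ stays F D (F x (ω 0)) N := by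
  constructor
  · intro h n hn
    rw [← path_succ]
    exact h (n + 1) (by omega)
  · intro h n hn
    cases n with
    | zero => exact hx
    | succ n => rw [path_succ]; exact h n (by omega)

/-- Comparison principle: the probability of a shift-invariant event is bounded on `D` by every
nonnegative function which is superharmonic on `D` and bounds it where the chain leaves `D`,
provided that the chain almost surely leaves `D` on the event. -/
theorem comparison {Ev : σ → Set (ℕ → S)} (hEv : ∀ x, MeasurableSet (Ev x))
    (hshift : ∀ x ω, ω ∈ Ev x ↔ tail ω ∈ Ev (F x (ω 0))) (D : Set σ) (f : σ → ℝ)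
    (hf0 : ∀ x ∈ D, 0 ≤ f x) (hf : ∀ x ∈ D, avg (fun s => f (F x s)) ≤ f x)
    (hout : ∀ x ∈ D, ∀ s, F x s ∉ D → (uniformLaw S).real (Ev (F x s)) ≤ f (F x s))
    (hnull : ∀ x ∈ D, (uniformLaw S) (Ev x ∩ {ω | ∀ n, path F x ω n ∈ D}) = 0) {x : σ}
    (hx : x ∈ D) : (uniformLaw S).real (Ev x) ≤ f x := by
  set p : ℕ → σ → ℝ := fun N x => (uniformLaw S).real (Ev x ∩ stays F D x N) with hp
  -- `p N` pays for the event that no exit has occurred before time `N`; exits before that are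
  -- covered by `hout`. By `hnull` the correction tends to zero.
  have key : ∀ N, ∀ x ∈ D, (uniformLaw S).real (Ev x) ≤ f x + p N x := by
    intro N
    induction N with
    | zero =>
      intro x hx
      have : Ev x ∩ stays F D x 0 = Ev x := by
        ext ω; simp [stays]
      simp only [hp, this]
      linarith [hf0 x hx]
    | succ N ih =>
      intro x hx
      have hpx : p (N + 1) x = avg fun s => p N (F x s) :=
        uniformLaw_real_eq_avg ((hEv x).inter (measurableSet_stays F D x _)) fun ω => by
          rw [Set.mem_inter_iff, hshift, mem_stays_succ F hx, Set.mem_inter_iff]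
      rw [hpx, uniformLaw_real_eq_avg (E' := fun s => Ev (F x s)) (hEv x) (hshift x)]
      calc avg (fun s => (uniformLaw S).real (Ev (F x s)))
          ≤ avg (fun s => f (F x s) + p N (F x s)) := avg_mono fun s => by
            by_cases hs : F x s ∈ D
            · exact ih _ hs
            · have := hout x hx s hs
              have h0 : 0 ≤ p N (F x s) := measureReal_nonneg
              linarith
        _ ≤ f x + avg fun s => p N (F x s) := by
            rw [avg_add]; linarith [hf x hx]
  have hlim : Filter.Tendsto (fun N => p N x) Filter.atTop (nhds 0) := by
    have h1 := tendsto_measure_iInter_atTop (μ := uniformLaw S)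
      (s := fun N => Ev x ∩ stays F D x N)
      (fun N => ((hEv x).inter (measurableSet_stays F D x N)).nullMeasurableSet)
      (fun M N h => Set.inter_subset_inter_right _ (antitone_stays F D x h))
      ⟨0, measure_ne_top _ _⟩
    rw [← Set.inter_iInter, iInter_stays, hnull x hx] at h1
    exact (ENNReal.tendsto_toReal ENNReal.zero_ne_top).comp h1
  refine ge_of_tendsto (by simpa using hlim.const_add (f x)) (Filter.Eventually.of_forall fun N => ?_)
  exact key N x hx

/-- A chain almost surely leaves a set on which a nonnegative function decreases on average by
amounts `e (clock x)` with divergent sum. -/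
theorem measure_stays_forever_eq_zero (clock : σ → ℕ) (hclock : ∀ x s, clock (F x s) = clock x + 1)
    (D : Set σ) (V : σ → ℝ) (hV : ∀ x, 0 ≤ V x) (e : ℕ → ℝ) (he : ∀ n, 0 ≤ e n)
    (hsum : ¬ Summable e) (hdec : ∀ x ∈ D, avg (fun s => V (F x s)) ≤ V x - e (clock x)) (x : σ) :
    (uniformLaw S) {ω | ∀ n, path F x ω n ∈ D} = 0 := by
  set p : ℕ → σ → ℝ := fun N x => (uniformLaw S).real (stays F D x N) with hp
  -- `V` pays `e` for every step spent in `D`, so survival probability times accumulated payment is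
  -- at most the initial value. A positive limiting probability would make `e` summable.
  have key : ∀ N x, p N x * ∑ i ∈ Finset.range N, e (clock x + i) ≤ V x := by
    intro N
    induction N with
    | zero => intro x; simpa using hV x
    | succ N ih =>
      intro x
      by_cases hx : x ∈ D
      · have hpx : p (N + 1) x = avg fun s => p N (F x s) :=
          uniformLaw_real_eq_avg (measurableSet_stays F D x _) (mem_stays_succ F hx N)
        have hs : ∑ i ∈ Finset.range (N + 1), e (clock x + i) =
            (∑ i ∈ Finset.range N, e (clock x + 1 + i)) + e (clock x) := by
          rw [Finset.sum_range_succ', add_zero]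
          simp only [add_assoc, add_comm 1]
        rw [hpx, hs, mul_comm, ← avg_const_mul]
        calc avg (fun s => ((∑ i ∈ Finset.range N, e (clock x + 1 + i)) + e (clock x))
              * p N (F x s))
            ≤ avg (fun s => V (F x s) + e (clock x)) := avg_mono fun s => by
              have h1 := ih (F x s)
              rw [hclock] at h1
              have h2 : p N (F x s) ≤ 1 := measureReal_le_one
              have h3 := mul_le_mul_of_nonneg_left h2 (he (clock x))
              linarith
          _ ≤ V x := by
              rw [avg_add, avg_const]; linarith [hdec x hx]
      · have : stays F D x (N + 1) = ∅ := by
          ext ω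
          simp only [stays, Set.mem_ofPred_eq, Set.mem_empty_iff_false, iff_false]
          exact fun h => hx (h 0 (by omega))
        simp only [hp, this, measureReal_empty, zero_mul]
        exact hV x
  by_contra hne
  set q := (uniformLaw S).real {ω | ∀ n, path F x ω n ∈ D} with hq
  have hq0 : 0 < q := ENNReal.toReal_pos hne (measure_ne_top _ _)
  have hqp : ∀ N, q ≤ p N x := fun N =>
    measureReal_mono (fun ω hω n _ => hω n)
  refine hsum ((summable_nat_add_iff (clock x)).1 ?_)
  refine summable_of_sum_range_le (c := V x / q) (fun n => he _) fun N => ?_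
  rw [le_div_iff₀ hq0, mul_comm]
  refine le_trans (mul_le_mul_of_nonneg_right (hqp N) (Finset.sum_nonneg fun i _ => he _)) ?_
  simpa only [add_comm] using key N x

end Chain

/-! ### Assignments, their levels and spreads -/

section Geometry

variable {d k : ℕ} {X : Finset (Pt d)}

theorem sum_sub_mean (Y : Finset (Pt d)) : ∑ x ∈ Y, (x - mean Y) = 0 := by
  rcases Y.eq_empty_or_nonempty with rfl | h
  · simp
  · have : (Y.card : ℝ) ≠ 0 := by exact_mod_cast h.card_pos.ne'
    rw [Finset.sum_sub_distrib, Finset.sum_const, mean, ← Nat.cast_smul_eq_nsmul ℝ, smul_smul,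
      mul_inv_cancel₀ this, one_smul, sub_self]

theorem mean_singleton (x : Pt d) : mean {x} = x := by simp [mean]

/-- Expanding around the mean, the cross term vanishes by `sum_sub_mean`. This is the source of the
splitting of the cost into level and spread. -/
theorem sum_norm_sub_sq (Y : Finset (Pt d)) (c : Pt d) :
    ∑ x ∈ Y, ‖x - c‖ ^ 2 = ∑ x ∈ Y, ‖x - mean Y‖ ^ 2 + (Y.card : ℝ) * ‖c - mean Y‖ ^ 2 := by
  have h : ∀ x : Pt d, ‖x - c‖ ^ 2 =
      ‖x - mean Y‖ ^ 2 - 2 * inner ℝ (x - mean Y) (c - mean Y) + ‖c - mean Y‖ ^ 2 := fun x => by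
    rw [← norm_sub_sq_real]; congr 2; abel
  simp only [h]
  rw [Finset.sum_add_distrib, Finset.sum_sub_distrib, ← Finset.mul_sum, ← sum_inner,
    sum_sub_mean, inner_zero_left, Finset.sum_const, nsmul_eq_mul]
  ring

/-- The weighted squared distance of the centroids `C` from the means of the clusters of `a`. -/
def spread (X : Finset (Pt d)) (a : Pt d → Fin k) (C : Fin k → Pt d) : ℝ :=
  ∑ r, ((cell X a r).card : ℝ) * ‖C r - mean (cell X a r)‖ ^ 2

/-- The cost of the clusters of `a` with respect to their own means. -/
def level (X : Finset (Pt d)) (a : Pt d → Fin k) : ℝ :=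
  costWith (fun r => mean (cell X a r)) (cell X a)

theorem costWith_eq_level_add_spread (a : Pt d → Fin k) (C : Fin k → Pt d) :
    costWith C (cell X a) = level X a + spread X a C := by
  simp only [costWith, level, spread, ← Finset.sum_add_distrib]
  exact Finset.sum_congr rfl fun r _ => sum_norm_sub_sq _ _

theorem mem_cell {a : Pt d → Fin k} {r : Fin k} {x : Pt d} : x ∈ cell X a r ↔ x ∈ X ∧ a x = r := by
  simp [cell]

theorem cell_subset (a : Pt d → Fin k) (r : Fin k) : cell X a r ⊆ X := Finset.filter_subset _ _

theorem mem_cell_self (a : Pt d → Fin k) {x : Pt d} (hx : x ∈ X) : x ∈ cell X a (a x) :=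
  mem_cell.2 ⟨hx, rfl⟩

theorem costWith_cell (a : Pt d → Fin k) (C : Fin k → Pt d) :
    costWith C (cell X a) = ∑ x ∈ X, ‖x - C (a x)‖ ^ 2 := by
  rw [costWith, ← Finset.sum_fiberwise_of_maps_to (g := a) (t := Finset.univ) (by simp)]
  refine Finset.sum_congr rfl fun r _ => Finset.sum_congr rfl fun x hx => ?_
  rw [(mem_cell.1 hx).2]

theorem spread_nonneg (a : Pt d → Fin k) (C : Fin k → Pt d) : 0 ≤ spread X a C :=
  Finset.sum_nonneg fun _ _ => by positivity

theorem level_nonneg (a : Pt d → Fin k) : 0 ≤ level X a := by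
  rw [level, costWith]; positivity

theorem IsVoronoi.costWith_le {C : Fin k → Pt d} {b : Pt d → Fin k} (hb : IsVoronoi X C b)
    (a : Pt d → Fin k) : costWith C (cell X b) ≤ costWith C (cell X a) := by
  rw [costWith_cell, costWith_cell]
  exact Finset.sum_le_sum fun x hx => by gcongr; exact hb x hx (a x)

/-- A nonempty cluster has weight at least 1 in the spread. Degenerate centroids have weight 0 and
are not controlled. -/
theorem norm_sub_mean_le_of_spread_le {a : Pt d → Fin k} {C : Fin k → Pt d} {e : ℝ} (he : 0 ≤ e)
    (h : spread X a C ≤ e ^ 2) {r : Fin k} (hr : (cell X a r).Nonempty) :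
    ‖C r - mean (cell X a r)‖ ≤ e := by
  have h1 : ((cell X a r).card : ℝ) * ‖C r - mean (cell X a r)‖ ^ 2 ≤ spread X a C :=
    Finset.single_le_sum
      (f := fun r => ((cell X a r).card : ℝ) * ‖C r - mean (cell X a r)‖ ^ 2)
      (fun _ _ => by positivity) (Finset.mem_univ r)
  have h2 : (1 : ℝ) ≤ (cell X a r).card := by exact_mod_cast hr.card_pos
  refine abs_le_of_sq_le_sq' ?_ he |>.2
  nlinarith [sq_nonneg ‖C r - mean (cell X a r)‖]

theorem parts_clusteringOf (a : Pt d → Fin k) :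
    (clusteringOf X a).parts = X.image fun x => cell X a (a x) := by
  ext P
  simp only [clusteringOf, Finpartition.ofErase_parts, Finset.mem_erase, Finset.mem_image,
    Finset.mem_univ, true_and]
  constructor
  · rintro ⟨hne, r, rfl⟩
    obtain ⟨x, hx⟩ := Finset.nonempty_iff_ne_empty.2 hne
    exact ⟨x, (mem_cell.1 hx).1, by rw [(mem_cell.1 hx).2]⟩
  · rintro ⟨x, hx, rfl⟩
    exact ⟨Finset.nonempty_iff_ne_empty.1 ⟨x, mem_cell_self a hx⟩, a x, rfl⟩

theorem clusteringOf_congr {a b : Pt d → Fin k}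
    (h : ∀ x ∈ X, cell X a (a x) = cell X b (b x)) : clusteringOf X a = clusteringOf X b := by
  refine Finpartition.ext ?_
  rw [parts_clusteringOf, parts_clusteringOf]
  exact Finset.image_congr fun x hx => h x hx

theorem cell_mem_parts {a : Pt d → Fin k} {r : Fin k} (hr : (cell X a r).Nonempty) :
    cell X a r ∈ (clusteringOf X a).parts := by
  obtain ⟨x, hx⟩ := hr
  rw [parts_clusteringOf]
  exact Finset.mem_image.2 ⟨x, (mem_cell.1 hx).1, by rw [(mem_cell.1 hx).2]⟩

theorem exists_cell_of_mem_parts {a : Pt d → Fin k} {P : Finset (Pt d)}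
    (hP : P ∈ (clusteringOf X a).parts) : ∃ r, P = cell X a r ∧ (cell X a r).Nonempty := by
  rw [parts_clusteringOf] at hP
  obtain ⟨x, hx, rfl⟩ := Finset.mem_image.1 hP
  exact ⟨a x, rfl, x, mem_cell_self a hx⟩

theorem cell_injOn {a : Pt d → Fin k} {r s : Fin k} (hr : (cell X a r).Nonempty)
    (h : cell X a r = cell X a s) : r = s := by
  obtain ⟨x, hx⟩ := hr
  have hx' := h ▸ hx
  rw [← (mem_cell.1 hx).2, (mem_cell.1 hx').2]

theorem card_parts_clusteringOf_le (a : Pt d → Fin k) : (clusteringOf X a).parts.card ≤ k := by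
  have : (clusteringOf X a).parts ⊆ Finset.univ.image (cell X a) := fun P hP => by
    obtain ⟨r, rfl, _⟩ := exists_cell_of_mem_parts hP
    exact Finset.mem_image_of_mem _ (Finset.mem_univ r)
  exact (Finset.card_le_card this).trans (Finset.card_image_le.trans (by simp))

/-- Labels and empty clusters do not matter for the level. Since `X` has finitely many partitions,
there are finitely many levels. -/
theorem level_eq_clusteringCost (a : Pt d → Fin k) :
    level X a = clusteringCost (clusteringOf X a) := by
  have hparts : (clusteringOf X a).parts =
      (Finset.univ.filter fun r => (cell X a r).Nonempty).image (cell X a) := by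
    ext P
    simp only [Finset.mem_image, Finset.mem_filter, Finset.mem_univ, true_and]
    constructor
    · intro hP
      obtain ⟨r, rfl, hr⟩ := exists_cell_of_mem_parts hP
      exact ⟨r, hr, rfl⟩
    · rintro ⟨r, hr, rfl⟩
      exact cell_mem_parts hr
  have h1 : clusteringCost (clusteringOf X a) =
      ∑ P ∈ (clusteringOf X a).parts, ∑ x ∈ P, ‖x - mean P‖ ^ 2 :=
    Finset.sum_coe_sort (clusteringOf X a).parts fun P => ∑ x ∈ P, ‖x - mean P‖ ^ 2
  rw [h1, hparts, Finset.sum_image, level, costWith, Finset.sum_filter]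
  · refine Finset.sum_congr rfl fun r _ => ?_
    split_ifs with h
    · rfl
    · rw [Finset.not_nonempty_iff_eq_empty.1 h]; simp
  · intro r hr s _ h
    exact cell_injOn (by simpa using hr) h

/-! ### Stationary clusterings -/

/-- If every point is at least as close to the mean of its cluster as to the other means, then the
clustering is stationary. -/
theorem isStationary_clusteringOf {a : Pt d → Fin k}
    (h : ∀ x ∈ X, ∀ s, (cell X a s).Nonempty →
      ‖x - mean (cell X a (a x))‖ ≤ ‖x - mean (cell X a s)‖) :
    IsStationary k (clusteringOf X a) := by
  refine ⟨card_parts_clusteringOf_le a, ?_⟩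
  have hw : ∀ P : (clusteringOf X a).parts, ∀ x ∈ P.1, ∀ Q : (clusteringOf X a).parts,
      ‖x - means _ P‖ ≤ ‖x - means _ Q‖ := by
    rintro ⟨P, hP⟩ x hx ⟨Q, hQ⟩
    obtain ⟨r, rfl, _⟩ := exists_cell_of_mem_parts hP
    obtain ⟨s, rfl, hs⟩ := exists_cell_of_mem_parts hQ
    obtain ⟨hxX, hxr⟩ := mem_cell.1 hx
    have := h x hxX s hs
    rwa [hxr] at this
  by_cases hstrict : ∀ P : (clusteringOf X a).parts, ∀ x ∈ P.1, ∀ Q : (clusteringOf X a).parts,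
      Q ≠ P → ‖x - means _ P‖ < ‖x - means _ Q‖
  · exact Or.inl ⟨Function.Embedding.refl _, hstrict⟩
  · push Not at hstrict
    obtain ⟨P, x, hx, Q, hQ, hle⟩ := hstrict
    exact Or.inr ⟨Function.Embedding.refl _, fun P x hx Q _ => hw P x hx Q, P, x, hx, Q, hQ,
      le_antisymm (hw P x hx Q) hle⟩

theorem sum_norm_sub_mean_sq_le (Y : Finset (Pt d)) (c : Pt d) :
    ∑ x ∈ Y, ‖x - mean Y‖ ^ 2 ≤ ∑ x ∈ Y, ‖x - c‖ ^ 2 := by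
  rw [sum_norm_sub_sq Y c]
  have : (0 : ℝ) ≤ (Y.card : ℝ) * ‖c - mean Y‖ ^ 2 := by positivity
  linarith

/-- When the means of `A` lie in the open cell of `A`, the matching is the identity. -/
theorem InCell.norm_sub_mean_lt {A : Finpartition X} (h : InCell (means A) A) {P Q : Finset (Pt d)}
    (hP : P ∈ A.parts) (hQ : Q ∈ A.parts) (hPQ : Q ≠ P) {x : Pt d} (hx : x ∈ P) :
    ‖x - mean P‖ < ‖x - mean Q‖ := by
  obtain ⟨π, hπ⟩ := h
  -- If `P` were matched with another cluster, that cluster's mean would be strictly closer to every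
  -- point of `P`, although `mean P` minimizes the sum of squared distances.
  have hid : π ⟨P, hP⟩ = ⟨P, hP⟩ := by
    by_contra hne
    have hlt : ∑ y ∈ P, ‖y - mean (π ⟨P, hP⟩).1‖ ^ 2 < ∑ y ∈ P, ‖y - mean P‖ ^ 2 :=
      Finset.sum_lt_sum_of_nonempty ⟨x, hx⟩ fun y hy => by
        have := hπ ⟨P, hP⟩ y hy ⟨P, hP⟩ (Ne.symm hne)
        simp only [means] at this
        gcongr
    exact absurd (sum_norm_sub_mean_sq_le P (mean (π ⟨P, hP⟩).1)) (not_le.2 hlt)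
  have := hπ ⟨P, hP⟩ x hx ⟨Q, hQ⟩ (by rw [hid]; simpa using hPQ)
  rwa [hid] at this

theorem norm_sub_mean_lt_of_isStationary (hA0 : NoBoundaryStationary X k) {a : Pt d → Fin k}
    (ha : IsStationary k (clusteringOf X a)) {x : Pt d} (hx : x ∈ X) {s : Fin k}
    (hs : (cell X a s).Nonempty) (hne : a x ≠ s) :
    ‖x - mean (cell X a (a x))‖ < ‖x - mean (cell X a s)‖ :=
  (hA0 _ ha).norm_sub_mean_lt (cell_mem_parts ⟨x, mem_cell_self a hx⟩) (cell_mem_parts hs)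
    (fun h => hne (cell_injOn hs h).symm) (mem_cell_self a hx)

/-! ### Uniform gaps -/

theorem exists_gap {ι : Type*} [Finite ι] (f : ι → ℝ) : ∃ γ > 0, ∀ i, 0 < f i → γ ≤ f i := by
  have hfin : (Set.range f ∩ Set.Ioi 0).Finite := (Set.finite_range f).inter_of_left _
  rcases (Set.range f ∩ Set.Ioi 0).eq_empty_or_nonempty with h | h
  · refine ⟨1, one_pos, fun i hi => ?_⟩
    have : f i ∈ Set.range f ∩ Set.Ioi 0 := ⟨⟨i, rfl⟩, hi⟩
    simp [h] at this
  · obtain ⟨γ, hγ, hmin⟩ := hfin.exists_minimalFor id _ h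
    refine ⟨γ, hγ.2, fun i hi => ?_⟩
    by_contra hlt
    exact hlt (hmin ⟨⟨i, rfl⟩, hi⟩ (le_of_not_ge hlt))

/-- A lower bound for the positive values of various quantities attached to the subsets and the
assignments of `X`. -/
structure IsGap (X : Finset (Pt d)) (k : ℕ) (γ : ℝ) : Prop where
  pos : 0 < γ
  dist : ∀ x ∈ X, ∀ P ⊆ X, ∀ Q ⊆ X, ‖x - mean P‖ < ‖x - mean Q‖ →
    ‖x - mean P‖ + γ ≤ ‖x - mean Q‖
  mean : ∀ P ⊆ X, ∀ Q ⊆ X, mean P ≠ mean Q → γ ≤ ‖mean P - mean Q‖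
  inner : ∀ x ∈ X, ∀ y ∈ X, ∀ P ⊆ X, inner ℝ (y - KMeans.mean P) (x - KMeans.mean P) < 0 →
    inner ℝ (y - KMeans.mean P) (x - KMeans.mean P) ≤ -γ
  level : ∀ a b : Pt d → Fin k, level X a < level X b → level X a + γ ≤ level X b

/-- Each quantity ranges over a finite family. Assignments are functions on the whole space, so
levels are indexed by partitions of `X` instead. -/
theorem exists_isGap (X : Finset (Pt d)) (k : ℕ) : ∃ γ, IsGap X k γ := by
  obtain ⟨γ₁, h₁, H₁⟩ := exists_gap fun i : X × X.powerset × X.powerset =>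
    ‖i.1.1 - mean i.2.2.1‖ - ‖i.1.1 - mean i.2.1.1‖
  obtain ⟨γ₂, h₂, H₂⟩ := exists_gap fun i : X.powerset × X.powerset =>
    ‖mean i.1.1 - mean i.2.1‖
  obtain ⟨γ₃, h₃, H₃⟩ := exists_gap fun i : X × X × X.powerset =>
    - inner ℝ (i.2.1.1 - mean i.2.2.1) (i.1.1 - mean i.2.2.1)
  obtain ⟨γ₄, h₄, H₄⟩ := exists_gap fun i : Finpartition X × Finpartition X =>
    clusteringCost i.2 - clusteringCost i.1
  refine ⟨min (min γ₁ γ₂) (min γ₃ γ₄), by positivity, ?_, ?_, ?_, ?_⟩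
  · intro x hx P hP Q hQ h
    have := H₁ ⟨⟨x, hx⟩, ⟨P, Finset.mem_powerset.2 hP⟩, ⟨Q, Finset.mem_powerset.2 hQ⟩⟩
      (sub_pos.2 h)
    have h' : min (min γ₁ γ₂) (min γ₃ γ₄) ≤ γ₁ := (min_le_left _ _).trans (min_le_left _ _)
    simp only at this
    linarith
  · intro P hP Q hQ h
    have := H₂ ⟨⟨P, Finset.mem_powerset.2 hP⟩, ⟨Q, Finset.mem_powerset.2 hQ⟩⟩
      (norm_pos_iff.2 (sub_ne_zero.2 h))
    exact ((min_le_left _ _).trans (min_le_right _ _)).trans this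
  · intro x hx y hy P hP h
    have := H₃ ⟨⟨x, hx⟩, ⟨y, hy⟩, ⟨P, Finset.mem_powerset.2 hP⟩⟩ (by simpa using h)
    have h' : min (min γ₁ γ₂) (min γ₃ γ₄) ≤ γ₃ := (min_le_right _ _).trans (min_le_left _ _)
    simp only at this
    linarith
  · intro a b h
    rw [level_eq_clusteringCost, level_eq_clusteringCost] at *
    have := H₄ ⟨clusteringOf X a, clusteringOf X b⟩ (sub_pos.2 h)
    have h' : min (min γ₁ γ₂) (min γ₃ γ₄) ≤ γ₄ := (min_le_right _ _).trans (min_le_right _ _)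
    simp only at this
    linarith

variable {γ e : ℝ}

/-- Centroids near the means of their Voronoi clusters give a stationary clustering. -/
theorem isStationary_of_spread_le (hγ : IsGap X k γ) (he : 0 ≤ e) (heγ : 2 * e < γ)
    {a : Pt d → Fin k} {C : Fin k → Pt d} (ha : IsVoronoi X C a) (h : spread X a C ≤ e ^ 2) :
    IsStationary k (clusteringOf X a) := by
  refine isStationary_clusteringOf fun x hx s hs => ?_
  by_contra! hlt
  have h1 := hγ.dist x hx _ (cell_subset a s) _ (cell_subset a (a x)) hlt
  have h2 := norm_sub_mean_le_of_spread_le he h ⟨x, mem_cell_self a hx⟩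
  have h3 := norm_sub_mean_le_of_spread_le he h hs
  have h4 := ha x hx s
  have h5 := norm_sub_le_norm_sub_add_norm_sub x (C (a x)) (mean (cell X a (a x)))
  have h6 := norm_sub_le_norm_sub_add_norm_sub x (mean (cell X a s)) (C s)
  rw [norm_sub_rev (mean (cell X a s))] at h6
  linarith

/-- If a Voronoi clustering changes between two nearby positions close to two stationary points,
then some point moves to a centroid which was degenerate before, and is not the mean of its new
cluster. -/
theorem exists_switch (hA0 : NoBoundaryStationary X k) (hγ : IsGap X k γ) (he : 0 < e)
    (heγ : 10 * e ≤ γ) {a b : Pt d → Fin k} {C C' : Fin k → Pt d} (ha : IsVoronoi X C a)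
    (hb : IsVoronoi X C' b) (hda : spread X a C ≤ e ^ 2) (hdb : spread X b C' ≤ (2 * e) ^ 2)
    (hCC : ∀ r, ‖C' r - C r‖ ≤ e) (hne : clusteringOf X b ≠ clusteringOf X a) :
    ∃ x ∈ X, ¬ (cell X a (b x)).Nonempty ∧ x ≠ mean (cell X b (b x)) := by
  have hsa := isStationary_of_spread_le hγ he.le (by linarith) ha hda
  have hsb := isStationary_of_spread_le hγ (by linarith) (by linarith) hb hdb
  by_contra hall'
  have hall : ∀ x ∈ X, ¬ (cell X a (b x)).Nonempty → x = mean (cell X b (b x)) :=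
    fun x hx hs => by_contra fun h => hall' ⟨x, hx, hs, h⟩
  -- centroids active in both have the same means
  have f1 : ∀ s, (cell X a s).Nonempty → (cell X b s).Nonempty →
      mean (cell X b s) = mean (cell X a s) := by
    intro s h1 h2
    by_contra hmean
    have h3 := hγ.mean _ (cell_subset b s) _ (cell_subset a s) hmean
    have h4 := norm_sub_mean_le_of_spread_le he.le hda h1
    have h5 := norm_sub_mean_le_of_spread_le (by linarith) hdb h2
    have h6 := norm_sub_le_norm_sub_add_norm_sub (mean (cell X b s)) (C' s) (mean (cell X a s))
    have h7 := norm_sub_le_norm_sub_add_norm_sub (C' s) (C s) (mean (cell X a s))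
    rw [norm_sub_rev (mean (cell X b s)) (C' s)] at h6
    linarith [hCC s]
  -- A point whose new centroid was already active has not moved: (A0) and the gap give its old mean
  -- a margin of `γ`, more than the displacements can use up.
  have f2 : ∀ x ∈ X, (cell X a (b x)).Nonempty → a x = b x := by
    intro x hx hs
    by_contra hne'
    have h1 := hγ.dist x hx _ (cell_subset a _) _ (cell_subset a _)
      (norm_sub_mean_lt_of_isStationary hA0 hsa hx hs hne')
    have h2 := norm_sub_mean_le_of_spread_le he.le hda ⟨x, mem_cell_self a hx⟩
    have h3 := norm_sub_mean_le_of_spread_le he.le hda hs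
    have h4 := hb x hx (a x)
    have h5 := norm_sub_le_norm_sub_add_norm_sub x (mean (cell X a (a x))) (C (a x))
    have h6 := norm_sub_le_norm_sub_add_norm_sub x (C (a x)) (C' (a x))
    have h7 := norm_sub_le_norm_sub_add_norm_sub x (C' (b x)) (C (b x))
    have h8 := norm_sub_le_norm_sub_add_norm_sub x (C (b x)) (mean (cell X a (b x)))
    rw [norm_sub_rev (mean (cell X a (a x)))] at h5
    rw [norm_sub_rev (C (a x))] at h6
    linarith [hCC (a x), hCC (b x)]
  -- Assuming the contrary, a captured point is the mean of its new cluster. The capturing centroid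
  -- was thus already near it, its old centroid was at least as near, and the gap makes the old mean
  -- equal to the point.
  have f3 : ∀ x ∈ X, ¬ (cell X a (b x)).Nonempty → mean (cell X a (a x)) = x := by
    intro x hx hs
    by_contra hne'
    have hxm := hall x hx hs
    have h1 : γ ≤ ‖mean (cell X a (a x)) - x‖ := by
      have := hγ.mean _ (cell_subset a (a x)) {x} (by simpa using hx)
      rw [mean_singleton] at this
      exact this hne'
    have h2 := norm_sub_mean_le_of_spread_le he.le hda ⟨x, mem_cell_self a hx⟩
    have h3 := norm_sub_mean_le_of_spread_le (by linarith) hdb ⟨x, mem_cell_self b hx⟩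
    rw [← hxm] at h3
    have h4 := ha x hx (b x)
    have h5 := norm_sub_le_norm_sub_add_norm_sub x (C' (b x)) (C (b x))
    have h6 := norm_sub_le_norm_sub_add_norm_sub (mean (cell X a (a x))) (C (a x)) x
    rw [norm_sub_rev (mean (cell X a (a x))) (C (a x))] at h6
    rw [norm_sub_rev x (C (a x))] at h4
    rw [norm_sub_rev x (C' (b x))] at h5
    linarith [hCC (b x)]
  -- Captured points are singleton clusters both after and before the capture, so the switch only
  -- relabels and leaves the partition unchanged.
  have f4 : ∀ x ∈ X, ¬ (cell X a (b x)).Nonempty → cell X b (b x) = {x} := by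
    intro x hx hs
    refine Finset.eq_singleton_iff_unique_mem.2 ⟨mem_cell_self b hx, fun y hy => ?_⟩
    obtain ⟨hyX, hyb⟩ := mem_cell.1 hy
    rw [hall x hx hs, ← hyb]
    exact hall y hyX (by rwa [hyb])
  have f5 : ∀ x ∈ X, ¬ (cell X a (b x)).Nonempty → cell X a (a x) = {x} := by
    intro x hx hs
    refine Finset.eq_singleton_iff_unique_mem.2 ⟨mem_cell_self a hx, fun y hy => ?_⟩
    obtain ⟨hyX, hya⟩ := mem_cell.1 hy
    by_cases hy' : (cell X a (b y)).Nonempty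
    · have h1 := f2 y hyX hy'
      have h2 : b y = a x := by rw [← h1, hya]
      have hbx : (cell X b (a x)).Nonempty := ⟨y, mem_cell.2 ⟨hyX, h2⟩⟩
      have h3 := f1 (a x) ⟨x, mem_cell_self a hx⟩ hbx
      rw [f3 x hx hs] at h3
      have h4 : b x ≠ a x := fun h => hs (by rw [h]; exact ⟨x, mem_cell_self a hx⟩)
      have h5 := norm_sub_mean_lt_of_isStationary hA0 hsb hx hbx h4
      rw [h3, sub_self, norm_zero] at h5
      exact absurd h5 (not_lt.2 (norm_nonneg _))
    · have h1 := f3 y hyX hy'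
      rw [hya, f3 x hx hs] at h1
      exact h1.symm
  refine hne (clusteringOf_congr fun x hx => ?_)
  by_cases hs : (cell X a (b x)).Nonempty
  · have hax := f2 x hx hs
    rw [hax]
    ext y
    constructor
    · intro hy
      obtain ⟨hyX, hyb⟩ := mem_cell.1 hy
      exact mem_cell.2 ⟨hyX, by rw [← hyb]; exact f2 y hyX (by rwa [hyb])⟩
    · intro hy
      obtain ⟨hyX, hya⟩ := mem_cell.1 hy
      by_cases hy' : (cell X a (b y)).Nonempty
      · exact mem_cell.2 ⟨hyX, by rw [← hya]; exact (f2 y hyX hy').symm⟩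
      · have h1 := f5 y hyX hy'
        rw [hya] at h1
        have h2 : x ∈ cell X a (b x) := by rw [← hax]; exact mem_cell_self a hx
        rw [h1, Finset.mem_singleton] at h2
        exact absurd (h2 ▸ hs) hy'
  · rw [f4 x hx hs, f5 x hx hs]

end Geometry

/-! ### One iteration -/

section Step

variable {d k m : ℕ} {X : Finset (Pt d)} {near : (Fin k → Pt d) → Pt d → Fin k}
  {C : Fin k → Pt d} {R η : ℝ}

theorem step_sub (S : Fin m → X) (r : Fin k) :
    step near η C S r - C r = η • (batchMean near C S r - C r) := by
  simp only [step]; module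

/-- Balls are convex, so once the rate is at most 1 the centroids never leave a ball containing them
and the data. -/
theorem norm_batchMean_le (hX : ∀ x ∈ X, ‖x‖ ≤ R) (hC : ∀ r, ‖C r‖ ≤ R) (S : Fin m → X)
    (r : Fin k) : ‖batchMean near C S r‖ ≤ R := by
  rw [batchMean]
  split_ifs with h
  · have hc : (0 : ℝ) < (hits near C S r).card := by exact_mod_cast h.card_pos
    rw [norm_smul, norm_inv, Real.norm_natCast, inv_mul_le_iff₀ hc]
    refine (norm_sum_le _ _).trans ((Finset.sum_le_sum fun i _ => hX _ (S i).2).trans_eq ?_)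
    simp
  · exact hC r

theorem norm_batchMean_sub_le (hX : ∀ x ∈ X, ‖x‖ ≤ R) (hC : ∀ r, ‖C r‖ ≤ R) (S : Fin m → X)
    (r : Fin k) : ‖batchMean near C S r - C r‖ ≤ 2 * R :=
  (norm_sub_le _ _).trans (by linarith [norm_batchMean_le (near := near) hX hC S r, hC r])

theorem norm_step_le (hX : ∀ x ∈ X, ‖x‖ ≤ R) (hC : ∀ r, ‖C r‖ ≤ R) (h0 : 0 ≤ η) (h1 : η ≤ 1)
    (S : Fin m → X) (r : Fin k) : ‖step near η C S r‖ ≤ R := by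
  have h2 := norm_batchMean_le (near := near) hX hC S r
  refine (norm_add_le _ _).trans ?_
  rw [norm_smul, norm_smul, Real.norm_of_nonneg h0, Real.norm_of_nonneg (sub_nonneg.2 h1)]
  nlinarith [hC r]

theorem norm_step_sub_le (hX : ∀ x ∈ X, ‖x‖ ≤ R) (hC : ∀ r, ‖C r‖ ≤ R) (h0 : 0 ≤ η)
    (S : Fin m → X) (r : Fin k) : ‖step near η C S r - C r‖ ≤ 2 * R * η := by
  rw [step_sub, norm_smul, Real.norm_of_nonneg h0]
  nlinarith [norm_batchMean_sub_le (near := near) hX hC S r]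

/-- The cost of an assignment depends on the centroids in a Lipschitz way. -/
theorem abs_costWith_sub_le (hX : ∀ x ∈ X, ‖x‖ ≤ R) (hC : ∀ r, ‖C r‖ ≤ R) {C' : Fin k → Pt d}
    (hC' : ∀ r, ‖C' r‖ ≤ R) {δ : ℝ} (hδ : ∀ r, ‖C' r - C r‖ ≤ δ) (a : Pt d → Fin k) :
    |costWith C' (cell X a) - costWith C (cell X a)| ≤ 4 * X.card * R * δ := by
  rw [costWith_cell, costWith_cell, ← Finset.sum_sub_distrib]
  refine (Finset.abs_sum_le_sum_abs _ _).trans ?_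
  calc ∑ x ∈ X, |‖x - C' (a x)‖ ^ 2 - ‖x - C (a x)‖ ^ 2|
      ≤ ∑ _x ∈ X, 4 * R * δ := by
        refine Finset.sum_le_sum fun x hx => ?_
        have h1 : |‖x - C' (a x)‖ - ‖x - C (a x)‖| ≤ δ := by
          refine (abs_norm_sub_norm_le _ _).trans ?_
          rw [sub_sub_sub_cancel_left, norm_sub_rev]
          exact hδ _
        have h2 : ‖x - C' (a x)‖ ≤ 2 * R := (norm_sub_le _ _).trans (by
          linarith [hX x hx, hC' (a x)])
        have h3 : ‖x - C (a x)‖ ≤ 2 * R := (norm_sub_le _ _).trans (by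
          linarith [hX x hx, hC (a x)])
        have h4 : 0 ≤ ‖x - C' (a x)‖ + ‖x - C (a x)‖ := by positivity
        rw [sq_sub_sq, abs_mul, abs_of_nonneg h4]
        calc _ ≤ (4 * R) * δ := mul_le_mul (by linarith) h1 (abs_nonneg _) (by linarith)
          _ = _ := rfl
    _ = 4 * X.card * R * δ := by rw [Finset.sum_const, nsmul_eq_mul]; ring

/-- The probability that centroid `r` is updated. -/
def hitProb (X : Finset (Pt d)) (m : ℕ) (near : (Fin k → Pt d) → Pt d → Fin k)
    (C : Fin k → Pt d) (r : Fin k) : ℝ :=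
  avg fun S : Fin m → X => if (hits near C S r).Nonempty then (1 : ℝ) else 0

theorem sum_cell_eq (a : Pt d → Fin k) (r : Fin k) (g : Pt d → ℝ) :
    ∑ x ∈ cell X a r, g x = ∑ x ∈ (Finset.univ : Finset X).filter (fun x => a x.1 = r), g x.1 := by
  rw [cell, Finset.sum_filter, Finset.sum_filter,
    ← Finset.sum_coe_sort X fun x => if a x = r then g x else 0]

/-- The average of a function over the sampled points of centroid `r` is, on average, its average
over the cluster of `r`, times the probability of an update. -/
theorem avg_batch_average (C : Fin k → Pt d) (r : Fin k) (g : Pt d → ℝ) :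
    avg (fun S : Fin m → X => ((hits near C S r).card : ℝ)⁻¹ * ∑ i ∈ hits near C S r, g (S i).1) =
      hitProb X m near C r *
        (((cell X (near C) r).card : ℝ)⁻¹ * ∑ x ∈ cell X (near C) r, g x) := by
  set Y : Finset X := Finset.univ.filter fun x => near C x.1 = r with hY
  set w : X → (Fin m → X) → ℝ := fun x S => ((hits near C S r).card : ℝ)⁻¹ *
    ((hits near C S r).filter fun i => S i = x).card with hw
  have hmaps : ∀ S : Fin m → X, ∀ i ∈ hits near C S r, S i ∈ Y := fun S i hi => by
    simpa [hY, hits] using hi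
  have h1 : ∀ (S : Fin m → X) (g : Pt d → ℝ),
      ((hits near C S r).card : ℝ)⁻¹ * ∑ i ∈ hits near C S r, g (S i).1 =
        ∑ x ∈ Y, g x.1 * w x S := fun S g => by
    rw [← Finset.sum_fiberwise_of_maps_to (hmaps S), Finset.mul_sum]
    refine Finset.sum_congr rfl fun x _ => ?_
    rw [Finset.sum_congr rfl fun i hi => by rw [(Finset.mem_filter.1 hi).2], Finset.sum_const,
      nsmul_eq_mul]
    simp only [hw]; ring
  -- Swapping two points of the same cluster preserves the law of the mini-batch and all hits, so
  -- all points of the cluster carry the same expected weight.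
  have h2 : ∀ x ∈ Y, ∀ y ∈ Y, avg (w x) = avg (w y) := by
    intro x hx y hy
    simp only [hY, Finset.mem_filter, Finset.mem_univ, true_and] at hx hy
    simp only [avg]
    congr 1
    refine Fintype.sum_equiv (Equiv.piCongrRight fun _ => Equiv.swap x y) _ _ fun S => ?_
    have hnear : ∀ z : X, near C (Equiv.swap x y z).1 = r ↔ near C z.1 = r := fun z => by
      rcases eq_or_ne z x with rfl | hzx
      · simp [hx, hy]
      · rcases eq_or_ne z y with rfl | hzy
        · simp [hx, hy]
        · rw [Equiv.swap_apply_of_ne_of_ne hzx hzy]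
    have hhits : hits near C (fun i => Equiv.swap x y (S i)) r = hits near C S r := by
      ext i; simp [hits, hnear]
    simp only [hw]
    change _ = ((hits near C (fun i => Equiv.swap x y (S i)) r).card : ℝ)⁻¹ *
      ((hits near C (fun i => Equiv.swap x y (S i)) r).filter
        fun i => Equiv.swap x y (S i) = y).card
    rw [hhits]
    congr 4
    ext i
    rw [Equiv.swap_apply_eq_iff, Equiv.swap_apply_right]
  have h3 : hitProb X m near C r = ∑ x ∈ Y, avg (w x) := by
    rw [← avg_sum, hitProb]
    congr 1
    ext S
    have := h1 S (fun _ => 1)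
    simp only [one_mul] at this
    rw [← this]
    split_ifs with h
    · have hc : ((hits near C S r).card : ℝ) ≠ 0 := by exact_mod_cast h.card_pos.ne'
      simp [hc]
    · rw [Finset.not_nonempty_iff_eq_empty.1 h]; simp
  have h4 : avg (fun S : Fin m → X =>
      ((hits near C S r).card : ℝ)⁻¹ * ∑ i ∈ hits near C S r, g (S i).1) =
        ∑ x ∈ Y, g x.1 * avg (w x) := by
    simp only [h1 _ g]
    rw [avg_sum]
    simp only [avg_const_mul]
  have hcard : (cell X (near C) r).card = Y.card := by
    have := sum_cell_eq (X := X) (near C) r fun _ => 1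
    simp only [Finset.sum_const, nsmul_eq_mul, mul_one] at this
    exact_mod_cast this
  rw [h4, h3, sum_cell_eq, hcard]
  rcases Y.eq_empty_or_nonempty with h | ⟨y, hy⟩
  · simp [h]
  · have hc : (Y.card : ℝ) ≠ 0 := by exact_mod_cast (Finset.card_pos.2 ⟨y, hy⟩).ne'
    rw [Finset.sum_congr rfl fun x hx => by rw [h2 x hx y hy],
      Finset.sum_congr (f := fun x => avg (w x)) rfl fun x hx => h2 x hx y hy, Finset.sum_const,
      nsmul_eq_mul, ← Finset.sum_mul]
    field_simp
    exact mul_comm _ _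

/-- The expected displacement points to the cluster mean, scaled by the update probability; testing
against a vector `v` keeps the averages real-valued. -/
theorem avg_inner_batchMean_sub (C : Fin k → Pt d) (r : Fin k) (v : Pt d) :
    avg (fun S : Fin m → X => inner ℝ v (batchMean near C S r - C r)) =
      hitProb X m near C r * (if (cell X (near C) r).Nonempty then
        inner ℝ v (mean (cell X (near C) r) - C r) else 0) := by
  have h1 : ∀ Y : Finset (Pt d), Y.Nonempty →
      (Y.card : ℝ)⁻¹ * ∑ x ∈ Y, inner ℝ v (x - C r) = inner ℝ v (mean Y - C r) := fun Y hY => by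
    have hc : (Y.card : ℝ) ≠ 0 := by exact_mod_cast hY.card_pos.ne'
    rw [← inner_sum, Finset.sum_sub_distrib, Finset.sum_const, ← Nat.cast_smul_eq_nsmul ℝ,
      ← real_inner_smul_right, smul_sub, smul_smul, inv_mul_cancel₀ hc, one_smul, mean]
  have h2 := avg_batch_average (X := X) (m := m) (near := near) C r
    fun x => inner ℝ v (x - C r)
  have h3 : ∀ S : Fin m → X, inner ℝ v (batchMean near C S r - C r) =
      ((hits near C S r).card : ℝ)⁻¹ * ∑ i ∈ hits near C S r, inner ℝ v ((S i).1 - C r) := by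
    intro S
    rw [batchMean]
    split_ifs with h
    · have hc : ((hits near C S r).card : ℝ) ≠ 0 := by exact_mod_cast h.card_pos.ne'
      rw [← inner_sum, Finset.sum_sub_distrib, Finset.sum_const, ← Nat.cast_smul_eq_nsmul ℝ,
        ← real_inner_smul_right, smul_sub, smul_smul, inv_mul_cancel₀ hc, one_smul]
    · rw [Finset.not_nonempty_iff_eq_empty.1 h]; simp
  simp only [h3, h2]
  congr 1
  split_ifs with h
  · exact h1 _ h
  · rw [Finset.not_nonempty_iff_eq_empty.1 h]; simp

/-- The mini-batch repeating one point of the cluster already updates its centroid. -/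
theorem inv_card_le_hitProb [NeZero m] {r : Fin k} (hr : (cell X (near C) r).Nonempty) :
    (Fintype.card (Fin m → X) : ℝ)⁻¹ ≤ hitProb X m near C r := by
  obtain ⟨x, hx⟩ := hr
  obtain ⟨hxX, hxr⟩ := mem_cell.1 hx
  have h : (1 : ℝ) ≤ ∑ S : Fin m → X, if (hits near C S r).Nonempty then (1 : ℝ) else 0 := by
    have h1 : (hits near C (fun _ : Fin m => (⟨x, hxX⟩ : X)) r).Nonempty :=
      ⟨0, by simp [hits, hxr]⟩
    refine le_trans (by rw [if_pos h1]) (Finset.single_le_sum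
      (f := fun S : Fin m → X => if (hits near C S r).Nonempty then (1 : ℝ) else 0)
      (fun S _ => by split_ifs <;> norm_num) (Finset.mem_univ fun _ => ⟨x, hxX⟩))
  rw [hitProb, avg]
  exact le_mul_of_one_le_right (by positivity) h

/-- With the assignment frozen, only the spread changes, and it is quadratic in the displacement. -/
theorem costWith_step_eq (a : Pt d → Fin k) (C : Fin k → Pt d) (S : Fin m → X) :
    costWith (step near η C S) (cell X a) = costWith C (cell X a) +
      ∑ r, ((cell X a r).card : ℝ) *
        (2 * η * inner ℝ (C r - mean (cell X a r)) (batchMean near C S r - C r) +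
          η ^ 2 * ‖batchMean near C S r - C r‖ ^ 2) := by
  rw [costWith_eq_level_add_spread, costWith_eq_level_add_spread, add_assoc]
  congr 1
  rw [spread, spread, ← Finset.sum_add_distrib]
  refine Finset.sum_congr rfl fun r _ => ?_
  have : step near η C S r - mean (cell X a r) =
      (C r - mean (cell X a r)) + η • (batchMean near C S r - C r) := by
    rw [← step_sub]; abel
  rw [this, norm_add_sq_real, inner_smul_right, norm_smul, mul_pow, Real.norm_eq_abs, sq_abs]
  ring

variable [Nonempty X]

theorem sum_card_cell (a : Pt d → Fin k) : ∑ r, ((cell X a r).card : ℝ) = X.card := by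
  have := Finset.card_eq_sum_card_fiberwise (s := X) (f := a) (t := Finset.univ) (by simp)
  rw [this]
  push_cast
  rfl

/-- The expected decrease of the cost in one iteration. -/
theorem avg_costWith_step_le (hX : ∀ x ∈ X, ‖x‖ ≤ R) (hC : ∀ r, ‖C r‖ ≤ R) (hη : 0 ≤ η) {p : ℝ}
    (hp : ∀ r, (cell X (near C) r).Nonempty → p ≤ hitProb X m near C r) :
    avg (fun S : Fin m → X => costWith (step near η C S) (cell X (near C))) ≤
      costWith C (cell X (near C)) - 2 * η * p * spread X (near C) C
        + 4 * X.card * R ^ 2 * η ^ 2 := by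
  simp only [costWith_step_eq]
  rw [avg_add, avg_const, avg_sum]
  have h : ∀ r, avg (fun S : Fin m → X => ((cell X (near C) r).card : ℝ) *
        (2 * η * inner ℝ (C r - mean (cell X (near C) r)) (batchMean near C S r - C r) +
          η ^ 2 * ‖batchMean near C S r - C r‖ ^ 2)) ≤
      -(2 * η * p) * (((cell X (near C) r).card : ℝ) * ‖C r - mean (cell X (near C) r)‖ ^ 2) +
        ((cell X (near C) r).card : ℝ) * (4 * R ^ 2 * η ^ 2) := by
    intro r
    rw [avg_const_mul, avg_add, avg_const_mul, avg_inner_batchMean_sub, avg_const_mul]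
    by_cases hr : (cell X (near C) r).Nonempty
    · rw [if_pos hr, ← neg_sub (C r) (mean _), inner_neg_right, real_inner_self_eq_norm_sq]
      have h1 : avg (fun S : Fin m → X => ‖batchMean near C S r - C r‖ ^ 2) ≤ (2 * R) ^ 2 :=
        avg_le_of_forall_le fun S => by
          gcongr; exact norm_batchMean_sub_le hX hC S r
      have h2 : 2 * η * (p * ‖C r - mean (cell X (near C) r)‖ ^ 2) ≤
          2 * η * (hitProb X m near C r * ‖C r - mean (cell X (near C) r)‖ ^ 2) := by
        gcongr; exact hp r hr
      have h3 := mul_le_mul_of_nonneg_left h1 (sq_nonneg η)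
      have h4 : (0 : ℝ) ≤ (cell X (near C) r).card := by positivity
      nlinarith
    · rw [Finset.not_nonempty_iff_eq_empty.1 hr]; simp
  have h' := Finset.sum_le_sum fun r (_ : r ∈ Finset.univ) => h r
  rw [Finset.sum_add_distrib, ← Finset.mul_sum, ← Finset.sum_mul, sum_card_cell] at h'
  rw [spread]
  linarith

end Step

/-! ### Stochastic k-means as a Markov chain -/

/-- The learning rate of iteration `t + 1`. -/
def rate (c' t_o : ℝ) (t : ℕ) : ℝ := c' / (((t + 1 : ℕ) : ℝ) + t_o)

/-! ### Size and summability of the learning rates. -/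

section Rate

variable {c' t_o : ℝ}

theorem rate_pos (hc : 0 < c') (ht : 0 < t_o) (t : ℕ) : 0 < rate c' t_o t := by
  unfold rate; positivity

theorem rate_antitone (hc : 0 < c') (ht : 0 < t_o) : Antitone (rate c' t_o) := fun s t hst => by
  unfold rate; gcongr

theorem rate_le_two_mul (hc : 0 < c') (ht : 0 < t_o) {t i : ℕ} (hi : i ≤ t + 1) :
    rate c' t_o t ≤ 2 * rate c' t_o (t + i) := by
  have hi' : (i : ℝ) ≤ t + 1 := by exact_mod_cast hi
  unfold rate
  rw [← mul_div_assoc, div_le_div_iff₀ (by positivity) (by positivity)]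
  push_cast
  nlinarith

/-- `c' ^ 2 / (t + t_o)` bounds the sum of the squares of the remaining learning rates. -/
theorem rate_sq_le (ht : 0 < t_o) (t : ℕ) :
    rate c' t_o t ^ 2 ≤ c' ^ 2 / (t + t_o) - c' ^ 2 / ((t + 1 : ℕ) + t_o) := by
  unfold rate
  have h1 : (0 : ℝ) < t + t_o := by positivity
  push_cast
  rw [div_pow, div_sub_div _ _ h1.ne' (by positivity), div_le_div_iff₀ (by positivity)
    (by positivity)]
  nlinarith [sq_nonneg (c' * ((t : ℝ) + 1 + t_o)), mul_nonneg (sq_nonneg c') h1.le,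
    mul_nonneg (mul_nonneg (sq_nonneg c') h1.le) h1.le]

theorem tendsto_div_add_atTop_zero (c t_o : ℝ) :
    Filter.Tendsto (fun t : ℕ => c / ((t : ℝ) + t_o)) Filter.atTop (nhds 0) :=
  Filter.Tendsto.const_div_atTop
    (Filter.tendsto_atTop_add_const_right _ _ tendsto_natCast_atTop_atTop) c

theorem tendsto_rate (c' t_o : ℝ) : Filter.Tendsto (rate c' t_o) Filter.atTop (nhds 0) :=
  (tendsto_div_add_atTop_zero c' t_o).comp (Filter.tendsto_add_atTop_nat 1)

theorem not_summable_rate (hc : 0 < c') (ht : 0 < t_o) : ¬ Summable (rate c' t_o) := by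
  intro h
  have h1 : Summable fun t : ℕ => 1 / ((t + 1 : ℕ) : ℝ) := by
    refine Summable.of_nonneg_of_le (fun t => by positivity) (fun t => ?_)
      (h.mul_left ((1 + t_o) / c'))
    unfold rate
    rw [div_mul_div_comm, div_le_div_iff₀ (by positivity) (by positivity)]
    push_cast
    nlinarith [mul_nonneg hc.le (Nat.cast_nonneg (α := ℝ) t),
      mul_nonneg (mul_nonneg hc.le ht.le) (Nat.cast_nonneg (α := ℝ) t)]
  exact Real.not_summable_one_div_natCast ((summable_nat_add_iff 1).1 h1)

end Rate

/-! ### The chain, the event of not settling, and the choice of constants. -/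

section Chain

variable {d k m : ℕ} {X : Finset (Pt d)}

/-- One iteration, as a map on pairs of a time and centroids. -/
def update (near : (Fin k → Pt d) → Pt d → Fin k) (c' t_o : ℝ) (x : ℕ × (Fin k → Pt d))
    (S : Fin m → X) : ℕ × (Fin k → Pt d) :=
  (x.1 + 1, step near (rate c' t_o x.1) x.2 S)

variable (near : (Fin k → Pt d) → Pt d → Fin k) (c' t_o : ℝ)

theorem path_update (C₀ : Fin k → Pt d) (ω : ℕ → Fin m → X) (t : ℕ) :
    path (update near c' t_o) (0, C₀) ω t = (t, centroids near c' t_o C₀ ω t) := by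
  induction t with
  | zero => rfl
  | succ t ih => rw [path, ih]; rfl

theorem path_update_fst (x : ℕ × (Fin k → Pt d)) (ω : ℕ → Fin m → X) (t : ℕ) :
    (path (update near c' t_o) x ω t).1 = x.1 + t := by
  induction t with
  | zero => rfl
  | succ t ih => rw [path, update, ih]; rfl

/-- The event that the clustering of the chain started at `x` does not become constant and
stationary. -/
def unsettled (x : ℕ × (Fin k → Pt d)) : Set (ℕ → Fin m → X) :=
  {ω | ¬ ∃ A : Finpartition X, IsStationary k A ∧
    ∃ T : ℕ, ∀ t ≥ T, clusteringOf X (near (path (update near c' t_o) x ω t).2) = A}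

/-- Settling is a tail property, so the first sample can be dropped; `comparison` requires exactly
this. -/
theorem mem_unsettled_iff (x : ℕ × (Fin k → Pt d)) (ω : ℕ → Fin m → X) :
    ω ∈ unsettled near c' t_o x ↔ tail ω ∈ unsettled near c' t_o (update near c' t_o x (ω 0)) := by
  refine not_congr (exists_congr fun A => and_congr_right fun _ => ?_)
  constructor
  · rintro ⟨T, hT⟩
    exact ⟨T, fun t ht => by rw [← path_succ]; exact hT _ (by omega)⟩
  · rintro ⟨T, hT⟩
    refine ⟨T + 1, fun t ht => ?_⟩
    obtain ⟨t, rfl⟩ := Nat.exists_eq_succ_of_ne_zero (by omega : t ≠ 0)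
    rw [Nat.succ_eq_add_one, path_succ]
    exact hT t (by omega)

variable [Nonempty X]

theorem measurableSet_unsettled (x : ℕ × (Fin k → Pt d)) :
    MeasurableSet (unsettled (X := X) (m := m) near c' t_o x) := by
  have : unsettled (X := X) (m := m) near c' t_o x =
      (⋃ A : Finpartition X, ⋃ _ : IsStationary k A, ⋃ T : ℕ, ⋂ t : ℕ, ⋂ _ : T ≤ t,
        {ω | path (update near c' t_o) x ω t ∈
          {y : ℕ × (Fin k → Pt d) | clusteringOf X (near y.2) = A}})ᶜ := by
    ext ω
    simp [unsettled]
  rw [this]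
  exact (MeasurableSet.iUnion fun A => MeasurableSet.iUnion fun _ => MeasurableSet.iUnion fun T =>
    MeasurableSet.iInter fun t => MeasurableSet.iInter fun _ =>
      measurableSet_path _ _ t x).compl

/-- The probability that the chain started at `x` does not settle. -/
def unsettledProb (X : Finset (Pt d)) [Nonempty X] (m : ℕ)
    (near : (Fin k → Pt d) → Pt d → Fin k) (c' t_o : ℝ) (x : ℕ × (Fin k → Pt d)) : ℝ :=
  (uniformLaw (Fin m → X)).real (unsettled near c' t_o x)

theorem unsettledProb_eq_avg (x : ℕ × (Fin k → Pt d)) :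
    unsettledProb X m near c' t_o x =
      avg fun S : Fin m → X => unsettledProb X m near c' t_o (update near c' t_o x S) :=
  uniformLaw_real_eq_avg
    (E' := fun S : Fin m → X => unsettled near c' t_o (update near c' t_o x S))
    (measurableSet_unsettled near c' t_o x) (mem_unsettled_iff near c' t_o x)

/-- The least possible probability of a given mini-batch. -/
def batchProb (X : Finset (Pt d)) (m : ℕ) : ℝ := (Fintype.card (Fin m → X) : ℝ)⁻¹

theorem batchProb_pos : 0 < batchProb X m := by
  have : 0 < Fintype.card (Fin m → X) := Fintype.card_pos
  unfold batchProb; positivity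

theorem batchProb_le_one : batchProb X m ≤ 1 :=
  inv_le_one_of_one_le₀ (by exact_mod_cast (Fintype.card_pos : 0 < Fintype.card (Fin m → X)))

/-- Late times and bounded centroids. -/
def region (k d T : ℕ) (R : ℝ) : Set (ℕ × (Fin k → Pt d)) := {x | T ≤ x.1 ∧ ∀ r, ‖x.2 r‖ ≤ R}

/-- A choice of constants for which the learning rates at times at least `T` are small compared
with `e`, and `e` is small compared with the gaps of `X`. -/
structure Regime (X : Finset (Pt d)) (m : ℕ) (near : (Fin k → Pt d) → Pt d → Fin k)
    (c' t_o R γ e : ℝ) (j T : ℕ) : Prop where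
  ne_zero : m ≠ 0
  voronoi : ∀ C, IsVoronoi X C (near C)
  noBoundary : NoBoundaryStationary X k
  gap : IsGap X k γ
  radius : ∀ x ∈ X, ‖x‖ ≤ R
  one_le : 1 ≤ R
  c_pos : 0 < c'
  t_pos : 0 < t_o
  e_pos : 0 < e
  e_le : 10 * e ≤ γ
  e_sq_le : 32 * e ^ 2 ≤ γ
  e_mul_le : 16 * e * R ≤ γ
  e_drift : 40 * X.card * R * e ≤ batchProb X m * γ
  lt_j : 128 * R ^ 2 < j * γ
  j_le : j ≤ T
  rate_half : (j + 1) * rate c' t_o T ≤ 1 / 2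
  rate_e : 2 * R * ((j + 1) * rate c' t_o T) ≤ e
  rate_e_sq : 8 * X.card * R ^ 2 * ((j + 1) * rate c' t_o T) ≤ e ^ 2
  rate_drift : 16 * X.card * R ^ 2 * rate c' t_o T ≤ batchProb X m * γ
  tail_le : 4 * X.card * R ^ 2 * (c' ^ 2 / (T + t_o)) ≤ e ^ 2 / 4

/-- The constants are chosen in the order `γ`, `e`, `j`, `T`: the gap comes from `X`, then `e` is
small against `γ`, then `j` large against `R ^ 2 / γ`, then `T` so late that `j + 1` steps move the
centroids by at most `e`. -/
theorem exists_regime {near : (Fin k → Pt d) → Pt d → Fin k} {c' t_o R : ℝ} (hm : m ≠ 0)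
    (hv : ∀ C, IsVoronoi X C (near C)) (hA0 : NoBoundaryStationary X k)
    (hR : ∀ x ∈ X, ‖x‖ ≤ R) (h1 : 1 ≤ R) (hc : 0 < c') (ht : 0 < t_o) (T₀ : ℕ) :
    ∃ γ e : ℝ, ∃ j T : ℕ, T₀ ≤ T ∧ Regime X m near c' t_o R γ e j T := by
  obtain ⟨γ, hγ⟩ := exists_isGap X k
  have hγ0 := hγ.pos
  have hp := batchProb_pos (X := X) (m := m)
  have hn : (0 : ℝ) < X.card := by
    obtain ⟨x⟩ := ‹Nonempty X›
    exact_mod_cast Finset.card_pos.2 ⟨x.1, x.2⟩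
  have hsmall : ∀ {f : ℕ → ℝ}, Filter.Tendsto f Filter.atTop (nhds 0) → ∀ c : ℝ, ∀ {b : ℝ},
      0 < b → ∀ᶠ t in Filter.atTop, c * f t ≤ b := fun hf c b hb => by
    have h := hf.const_mul c
    rw [mul_zero] at h
    exact (h.eventually_lt_const hb).mono fun _ h => h.le
  have hid : Filter.Tendsto (fun e : ℝ => e) (nhdsWithin 0 (Set.Ioi 0)) (nhds 0) :=
    tendsto_nhdsWithin_of_tendsto_nhds Filter.tendsto_id
  have hesmall : ∀ c : ℝ, ∀ {b : ℝ}, 0 < b → ∀ᶠ e in nhdsWithin (0 : ℝ) (Set.Ioi 0), c * e ≤ b :=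
    fun c b hb => by
      have h := hid.const_mul c
      rw [mul_zero] at h
      exact (h.eventually_lt_const hb).mono fun _ h => h.le
  obtain ⟨e, ⟨he1, he2, he3, he4⟩, he0⟩ := (((hesmall 10 hγ0).and ((hesmall 32 hγ0).and
    -- The summand `+ 1` and the bound by 1 also yield `e ≤ 1`, which converts bounds on `e` into
    -- bounds on `e ^ 2`.
    ((hesmall (16 * R) hγ0).and (hesmall (40 * X.card * R + 1)
      (show 0 < min 1 (batchProb X m * γ) by positivity))))).and self_mem_nhdsWithin).exists
  obtain ⟨j, hj⟩ := exists_nat_gt (128 * R ^ 2 / γ)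
  have he0 : 0 < e := he0
  have hr := tendsto_rate c' t_o
  obtain ⟨T, hT⟩ := ((Filter.eventually_ge_atTop (max T₀ j)).and
    ((hsmall hr (j + 1) (show (0 : ℝ) < 1 / 2 by norm_num)).and
    ((hsmall hr (2 * R * (j + 1)) he0).and
    ((hsmall hr (8 * X.card * R ^ 2 * (j + 1)) (show 0 < e ^ 2 by positivity)).and
    ((hsmall hr (16 * X.card * R ^ 2) (mul_pos hp hγ0)).and
    (hsmall (tendsto_div_add_atTop_zero (c' ^ 2) t_o) (4 * X.card * R ^ 2)
      (show 0 < e ^ 2 / 4 by positivity))))))).exists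
  obtain ⟨hT0, hT1, hT2, hT3, hT4, hT5⟩ := hT
  have hnR : 0 ≤ 40 * X.card * R * e := by positivity
  have he5 : e ≤ 1 := by
    have := he4.trans (min_le_left _ _)
    nlinarith
  refine ⟨γ, e, j, T, (le_max_left _ _).trans hT0, hm, hv, hA0, hγ, hR, h1, hc, ht, he0, he1, ?_,
    ?_, ?_, ?_, (le_max_right _ _).trans hT0, hT1, ?_, ?_, hT4, hT5⟩
  · nlinarith
  · linarith
  · have := he4.trans (min_le_right _ _)
    linarith
  · rwa [div_lt_iff₀ hγ0] at hj
  · linarith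
  · linarith

end Chain

/-! ### Increments of the cost within a regime. -/

section Regime

variable {d k m : ℕ} {X : Finset (Pt d)} [Nonempty X] {near : (Fin k → Pt d) → Pt d → Fin k}
  {c' t_o R γ e : ℝ} {j T : ℕ}

namespace Regime

variable (hr : Regime X m near c' t_o R γ e j T) {x : ℕ × (Fin k → Pt d)}
include hr

theorem card_pos : (1 : ℝ) ≤ X.card := by
  obtain ⟨x⟩ := ‹Nonempty X›
  exact_mod_cast Finset.card_pos.2 ⟨x.1, x.2⟩

theorem rate_pos (t : ℕ) : 0 < rate c' t_o t := KMeans.rate_pos hr.c_pos hr.t_pos t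

theorem rate_le (hx : x ∈ region k d T R) : rate c' t_o x.1 ≤ rate c' t_o T :=
  rate_antitone hr.c_pos hr.t_pos hx.1

theorem rate_le_one : rate c' t_o T ≤ 1 := by
  have h1 := hr.rate_half
  have h2 := hr.rate_pos T
  have h3 : (0 : ℝ) ≤ j := Nat.cast_nonneg j
  nlinarith

theorem update_mem (hx : x ∈ region k d T R) (S : Fin m → X) :
    update near c' t_o x S ∈ region k d T R :=
  ⟨hx.1.trans (Nat.le_succ _), fun r => norm_step_le hr.radius hx.2 (hr.rate_pos _).le
    ((hr.rate_le hx).trans hr.rate_le_one) S r⟩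

theorem path_mem (hx : x ∈ region k d T R) (ω : ℕ → Fin m → X) (i : ℕ) :
    path (update near c' t_o) x ω i ∈ region k d T R := by
  induction i with
  | zero => exact hx
  | succ i ih => exact hr.update_mem ih _

theorem norm_update_sub_le (hx : x ∈ region k d T R) (S : Fin m → X) (r : Fin k) :
    ‖(update near c' t_o x S).2 r - x.2 r‖ ≤ 2 * R * rate c' t_o x.1 :=
  norm_step_sub_le hr.radius hx.2 (hr.rate_pos _).le S r

theorem abs_costWith_update_sub_le (hx : x ∈ region k d T R) (S : Fin m → X) (a : Pt d → Fin k) :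
    |costWith (update near c' t_o x S).2 (cell X a) - costWith x.2 (cell X a)| ≤
      8 * X.card * R ^ 2 * rate c' t_o x.1 :=
  (abs_costWith_sub_le hr.radius hx.2 (hr.update_mem hx S).2
    (hr.norm_update_sub_le hx S) a).trans_eq (by ring)

theorem cost_update_le (x : ℕ × (Fin k → Pt d)) (S : Fin m → X) :
    cost X near (update near c' t_o x S).2 ≤
      costWith (update near c' t_o x S).2 (cell X (near x.2)) :=
  (hr.voronoi _).costWith_le _

/-- Reassigning to nearest centroids can only lower the cost, so each increment is bounded by that
of the frozen assignment. -/
theorem cost_path_le (hx : x ∈ region k d T R) (ω : ℕ → Fin m → X) (i : ℕ) :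
    cost X near (path (update near c' t_o) x ω i).2 ≤
      cost X near x.2 + 8 * X.card * R ^ 2 * (i * rate c' t_o x.1) := by
  induction i with
  | zero => simp [path]
  | succ i ih =>
    have h1 := hr.cost_update_le (path (update near c' t_o) x ω i) (ω i)
    have h2 := (abs_le.1 (hr.abs_costWith_update_sub_le (hr.path_mem hx ω i) (ω i)
      (near (path (update near c' t_o) x ω i).2))).2
    have h3 : rate c' t_o (path (update near c' t_o) x ω i).1 ≤ rate c' t_o x.1 :=
      rate_antitone hr.c_pos hr.t_pos (by rw [path_update_fst]; omega)
    have h4 : 8 * X.card * R ^ 2 * rate c' t_o (path (update near c' t_o) x ω i).1 ≤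
        8 * X.card * R ^ 2 * rate c' t_o x.1 := by gcongr
    simp only [cost] at *
    rw [path]
    push_cast
    linarith

theorem batchProb_le_hitProb (C : Fin k → Pt d) (r : Fin k) (h : (cell X (near C) r).Nonempty) :
    batchProb X m ≤ hitProb X m near C r := by
  have : NeZero m := ⟨hr.ne_zero⟩
  exact inv_card_le_hitProb h

theorem avg_costWith_update_le (hx : x ∈ region k d T R) :
    avg (fun S : Fin m → X => costWith (update near c' t_o x S).2 (cell X (near x.2))) ≤
      cost X near x.2 - 2 * rate c' t_o x.1 * batchProb X m * spread X (near x.2) x.2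
        + 4 * X.card * R ^ 2 * rate c' t_o x.1 ^ 2 :=
  avg_costWith_step_le hr.radius hx.2 (hr.rate_pos _).le (hr.batchProb_le_hitProb x.2)

theorem cost_eq (C : Fin k → Pt d) :
    cost X near C = level X (near C) + spread X (near C) C :=
  costWith_eq_level_add_spread _ _

end Regime

end Regime

/-! ### Escape from unstable positions -/

section Escape

variable {d k m : ℕ} {X : Finset (Pt d)} [Nonempty X] {near : (Fin k → Pt d) → Pt d → Fin k}
  {c' t_o R γ e : ℝ} {j T : ℕ}

theorem step_const (hm : m ≠ 0) {C : Fin k → Pt d} {x : Pt d} (hx : x ∈ X) (η : ℝ) :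
    step near η C (fun _ : Fin m => (⟨x, hx⟩ : X)) =
      Function.update C (near C x) ((1 - η) • C (near C x) + η • x) := by
  have hm' : (m : ℝ) ≠ 0 := by exact_mod_cast hm
  have : Nonempty (Fin m) := ⟨⟨0, Nat.pos_of_ne_zero hm⟩⟩
  ext1 r
  rcases eq_or_ne r (near C x) with rfl | h
  · have h1 : hits near C (fun _ : Fin m => (⟨x, hx⟩ : X)) (near C x) = Finset.univ := by
      ext i; simp [hits]
    rw [Function.update_self, step, batchMean, h1, if_pos Finset.univ_nonempty, Finset.sum_const,
      ← Nat.cast_smul_eq_nsmul ℝ, Finset.card_univ, Fintype.card_fin, smul_smul, smul_smul,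
      mul_assoc, inv_mul_cancel₀ hm', mul_one]
  · have h1 : hits near C (fun _ : Fin m => (⟨x, hx⟩ : X)) r = ∅ := by
      ext i; simp [hits, h.symm]
    rw [Function.update_of_ne h, step, batchMean, h1, if_neg Finset.not_nonempty_empty]
    module

theorem norm_mean_le (hR : 0 ≤ R) {Y : Finset (Pt d)} (hY : ∀ x ∈ Y, ‖x‖ ≤ R) : ‖mean Y‖ ≤ R := by
  rcases Y.eq_empty_or_nonempty with rfl | h
  · simpa [mean] using hR
  · have hc : (0 : ℝ) < Y.card := by exact_mod_cast h.card_pos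
    rw [mean, norm_smul, norm_inv, Real.norm_natCast, inv_mul_le_iff₀ hc]
    refine (norm_sum_le _ _).trans ((Finset.sum_le_sum hY).trans_eq ?_)
    simp

theorem inner_sub_sub_le {z y c M : Pt d} {ρ δ : ℝ} (hz : ‖z - M‖ ≤ ρ) (hy : ‖y - c‖ ≤ ρ)
    (hc : ‖c - M‖ ≤ δ) : inner ℝ (z - c) (y - c) ≤ inner ℝ (z - M) (y - M) + 2 * (ρ * δ) := by
  have h3 : inner ℝ (z - c) (y - c) = inner ℝ (z - M) (y - M) +
      (inner ℝ (M - c) (y - c) + inner ℝ (z - M) (M - c)) := by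
    have h4 : z - c = (z - M) + (M - c) := by abel
    have h5 : y - c = (y - M) + (M - c) := by abel
    rw [h4, h5]
    simp only [inner_add_left, inner_add_right]
    ring
  rw [norm_sub_rev] at hc
  have hδ : 0 ≤ δ := (norm_nonneg _).trans hc
  have hρ : 0 ≤ ρ := (norm_nonneg _).trans hz
  have h4 : inner ℝ (M - c) (y - c) ≤ δ * ρ :=
    (real_inner_le_norm _ _).trans (mul_le_mul hc hy (norm_nonneg _) hδ)
  have h5 : inner ℝ (z - M) (M - c) ≤ ρ * δ :=
    (real_inner_le_norm _ _).trans (mul_le_mul hz hc (norm_nonneg _) hρ)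
  rw [h3]
  linarith

/-- Moving `c` towards a point `y` on the other side takes it away from `z`. -/
theorem mul_le_of_norm_sub_add_smul_le {z y c : Pt d} {μ ρ δ β : ℝ} (hμ : 0 ≤ μ)
    (hz : ‖z - c‖ ≤ ρ) (hδ0 : 0 ≤ δ) (hδ : δ ≤ 2 * ρ) (hin : inner ℝ (z - c) (y - c) ≤ -β)
    (h : ‖z - (c + μ • (y - c))‖ ≤ ‖z - c‖ + δ) : 2 * μ * β ≤ 4 * ρ * δ := by
  have h5 : ‖z - (c + μ • (y - c))‖ ^ 2 = ‖z - c‖ ^ 2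
      - 2 * (μ * inner ℝ (z - c) (y - c)) + μ ^ 2 * ‖y - c‖ ^ 2 := by
    have : z - (c + μ • (y - c)) = (z - c) - μ • (y - c) := by abel
    rw [this, norm_sub_sq_real, inner_smul_right, norm_smul, mul_pow, Real.norm_eq_abs, sq_abs]
  have h6 : ‖z - (c + μ • (y - c))‖ ^ 2 ≤ (‖z - c‖ + δ) ^ 2 := by gcongr
  have h7 : 0 ≤ μ ^ 2 * ‖y - c‖ ^ 2 := by positivity
  have h8 := mul_le_mul_of_nonneg_left hin hμ
  have h9 : δ * (2 * ‖z - c‖ + δ) ≤ δ * (2 * ρ + 2 * ρ) := by gcongr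
  linarith

namespace Regime

variable (hr : Regime X m near c' t_o R γ e j T) {x : ℕ × (Fin k → Pt d)}
include hr

/-- Sampling only the point `y`, several times, moves only its centroid, towards `y`. -/
theorem path_const {y : Pt d} (hy : y ∈ X)
    (hne : y ≠ x.2 (near x.2 y)) {h : ℝ} (hh : h ≤ rate c' t_o T)
    (hlow : ∀ i < j, h ≤ 2 * rate c' t_o (x.1 + i)) (hupp : rate c' t_o x.1 ≤ h) {i : ℕ}
    (hi : i ≤ j) :
    ∃ μ : ℝ, i * h / 4 ≤ μ ∧ μ ≤ i * h ∧
      (path (update near c' t_o) x (fun _ => fun _ : Fin m => (⟨y, hy⟩ : X)) i).2 =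
        Function.update x.2 (near x.2 y)
          (x.2 (near x.2 y) + μ • (y - x.2 (near x.2 y))) ∧
      near (path (update near c' t_o) x (fun _ => fun _ : Fin m => (⟨y, hy⟩ : X)) i).2 y =
        near x.2 y := by
  set s := near x.2 y with hs
  set ω : ℕ → Fin m → X := fun _ => fun _ : Fin m => (⟨y, hy⟩ : X) with hω
  have hrate := hr.rate_pos x.1
  have hhalf : ∀ i ≤ j, i * h ≤ 1 / 2 := fun i hi => by
    have h1 := hr.rate_half
    have h2 : (i : ℝ) ≤ j + 1 := by
      have : (i : ℝ) ≤ j := by exact_mod_cast hi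
      linarith
    have h3 := mul_le_mul h2 hh (by linarith) (by positivity)
    linarith
  induction i with
  | zero => exact ⟨0, by simp, by simp, by simp [path], hs.symm⟩
  | succ i ih =>
    obtain ⟨μ, hμ1, hμ2, hC, hn⟩ := ih (by omega)
    set η := rate c' t_o (path (update near c' t_o) x ω i).1 with hη
    have hη1 : η = rate c' t_o (x.1 + i) := by rw [hη, path_update_fst]
    have hη2 : η ≤ h := by
      rw [hη1]
      exact (rate_antitone hr.c_pos hr.t_pos (Nat.le_add_right _ _)).trans hupp
    have hη3 := hlow i (by omega)
    rw [← hη1] at hη3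
    have hη0 : 0 < η := hr.rate_pos _
    have hμhalf := hμ2.trans (hhalf i (by omega))
    -- `μ` is the fraction of the way to `y` covered so far. As `μ ≤ 1/2` and the rate lies between
    -- `h / 2` and `h`, each step adds between `h / 4` and `h`.
    have hC' : (path (update near c' t_o) x ω (i + 1)).2 =
        Function.update x.2 s (x.2 s + (μ + η * (1 - μ)) • (y - x.2 s)) := by
      have : (path (update near c' t_o) x ω (i + 1)).2 =
          step near η (path (update near c' t_o) x ω i).2 (ω i) := rfl
      rw [this, hω, step_const hr.ne_zero hy, hn, hC, Function.update_idem, Function.update_self]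
      congr 1
      module
    have hh0 : 0 < h := hrate.trans_le hupp
    have hμ0 : 0 ≤ μ := le_trans (by positivity) hμ1
    have hμ' : 0 < μ + η * (1 - μ) := by nlinarith
    refine ⟨μ + η * (1 - μ), ?_, ?_, hC', ?_⟩
    · push_cast; nlinarith
    · push_cast; nlinarith
    -- Only the centroid of `y` has moved, and strictly closer to `y`; no other centroid can take
    -- `y` over.
    · by_contra hne'
      have h1 := hr.voronoi (path (update near c' t_o) x ω (i + 1)).2 y hy s
      rw [hC', Function.update_self, Function.update_of_ne (by rwa [hC'] at hne')] at h1
      have h2 := hr.voronoi x.2 y hy (near (path (update near c' t_o) x ω (i + 1)).2 y)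
      rw [hC'] at h2
      have h3 : y - (x.2 s + (μ + η * (1 - μ)) • (y - x.2 s)) =
          (1 - (μ + η * (1 - μ))) • (y - x.2 s) := by module
      have h4 : 0 < ‖y - x.2 s‖ := norm_pos_iff.2 (sub_ne_zero.2 hne)
      have h5 : μ + η * (1 - μ) ≤ 1 := by
        have : η ≤ 1 := hη2.trans (hh.trans hr.rate_le_one)
        nlinarith
      rw [h3, norm_smul, Real.norm_of_nonneg (by linarith)] at h1
      have h6 := h2.trans h1
      rw [← hs] at h6
      nlinarith

/-- A larger level would be at least `v + γ`, and the cost is never below the level. -/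
theorem level_le_of_cost_lt {v : ℝ} {C : Fin k → Pt d} (a : Pt d → Fin k) (hv : level X a = v)
    (h : cost X near C < v + γ) : level X (near C) ≤ v := by
  by_contra! hlt
  have h1 := hr.gap.level a (near C) (by rwa [hv])
  rw [hr.cost_eq] at h
  linarith [spread_nonneg (X := X) (near C) C]

/-- After a switch between two clusterings of the same level, some fixed finite sequence of samples
leads to a clustering of a lower level. -/
theorem exists_path_level_lt (hx : x ∈ region k d T R) (hsp : spread X (near x.2) x.2 ≤ e ^ 2)
    {S : Fin m → X}
    (hlev : level X (near (update near c' t_o x S).2) = level X (near x.2))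
    (hne : clusteringOf X (near (update near c' t_o x S).2) ≠ clusteringOf X (near x.2)) :
    ∃ ω : ℕ → Fin m → X,
      level X (near (path (update near c' t_o) (update near c' t_o x S) ω j).2) <
        level X (near x.2) := by
  set x' := update near c' t_o x S with hx'
  have hx'r : x' ∈ region k d T R := hr.update_mem hx S
  set v := level X (near x.2) with hv
  have he := hr.e_pos
  have hγ := hr.gap.pos
  have hR := hr.one_le
  have hn := hr.card_pos
  set h := rate c' t_o x.1 with hh
  have hh0 : 0 < h := hr.rate_pos _
  have hhT : h ≤ rate c' t_o T := hr.rate_le hx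
  have hj0 : (0 : ℝ) ≤ j := Nat.cast_nonneg j
  have hjh : (j + 1) * h ≤ (j + 1) * rate c' t_o T := by gcongr
  have hδ : ∀ r, ‖x'.2 r - x.2 r‖ ≤ 2 * R * h := hr.norm_update_sub_le hx S
  have hδe : 2 * R * ((j + 1) * h) ≤ e := le_trans (by gcongr) hr.rate_e
  have h1e : 2 * R * h ≤ e := by nlinarith [mul_nonneg hj0 hh0.le]
  have hesq : 8 * X.card * R ^ 2 * ((j + 1) * h) ≤ e ^ 2 := le_trans (by gcongr) hr.rate_e_sq
  have hcost0 : cost X near x.2 ≤ v + e ^ 2 := by rw [hr.cost_eq]; linarith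
  have hcost1 : cost X near x'.2 ≤ v + e ^ 2 + 8 * X.card * R ^ 2 * h := by
    have h1 := hr.cost_update_le x S
    have h2 := (abs_le.1 (hr.abs_costWith_update_sub_le hx S (near x.2))).2
    simp only [cost] at *
    linarith
  have hsp' : spread X (near x'.2) x'.2 ≤ (2 * e) ^ 2 := by
    have h1 := hr.cost_eq x'.2
    have h2 : (0 : ℝ) ≤ 8 * X.card * R ^ 2 * (j * h) := by positivity
    nlinarith
  obtain ⟨y, hy, hya, hym⟩ := exists_switch hr.noBoundary hr.gap he hr.e_le (hr.voronoi _)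
    (hr.voronoi _) hsp hsp' (fun r => (hδ r).trans h1e) hne
  set s := near x'.2 y with hs
  set M := mean (cell X (near x'.2) s) with hM
  have hsM : ‖x'.2 s - M‖ ≤ 2 * e :=
    norm_sub_mean_le_of_spread_le (by linarith) hsp' ⟨y, mem_cell_self _ hy⟩
  have hyM : γ ≤ ‖y - M‖ := by
    have := hr.gap.mean {y} (by simpa using hy) _ (cell_subset (near x'.2) s)
    rw [mean_singleton] at this
    exact this hym
  have hyne : y ≠ x'.2 s := by
    rintro hyeq
    rw [← hyeq] at hsM
    linarith [hr.e_le]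
  have hfst : x'.1 = x.1 + 1 := rfl
  have hjT : j ≤ x.1 := hr.j_le.trans hx.1
  obtain ⟨μ, hμ1, hμ2, hC, hn'⟩ := hr.path_const hy hyne hhT
    (fun i hi => by
      -- As `j ≤ T`, the rate at most halves over these steps.
      rw [hfst, add_assoc]
      exact rate_le_two_mul hr.c_pos hr.t_pos (by omega))
    (rate_antitone hr.c_pos hr.t_pos (by rw [hfst]; omega)) le_rfl
  refine ⟨fun _ => fun _ : Fin m => (⟨y, hy⟩ : X), ?_⟩
  set x'' := path (update near c' t_o) x' (fun _ => fun _ : Fin m => (⟨y, hy⟩ : X)) j with hx''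
  rw [← hs] at hC hn'
  have hμ0 : 0 < μ := by
    have : (0 : ℝ) < j := by
      by_contra hj
      have := hr.lt_j
      nlinarith [sq_nonneg R]
    exact lt_of_lt_of_le (by positivity) hμ1
  have hcost2 : cost X near x''.2 ≤ v + 2 * e ^ 2 := by
    have h1 := hr.cost_path_le hx'r (fun _ => fun _ : Fin m => (⟨y, hy⟩ : X)) j
    have h2 : rate c' t_o x'.1 ≤ h := rate_antitone hr.c_pos hr.t_pos (by rw [hfst]; omega)
    have h3 : 8 * X.card * R ^ 2 * (j * rate c' t_o x'.1) ≤ 8 * X.card * R ^ 2 * (j * h) := by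
      gcongr
    linarith
  have hle : level X (near x''.2) ≤ v := hr.level_le_of_cost_lt (near x.2) rfl (by
    have := hr.e_sq_le
    have : 0 < e ^ 2 := by positivity
    linarith)
  refine lt_of_le_of_ne hle fun heq => ?_
  have hsp'' : spread X (near x''.2) x''.2 ≤ (2 * e) ^ 2 := by
    have h1 := hr.cost_eq x''.2
    nlinarith
  have hy'' : y ∈ cell X (near x''.2) s := mem_cell.2 ⟨hy, hn'⟩
  have hnorm : ∀ z ∈ X, ∀ r, ‖z - x'.2 r‖ ≤ 2 * R := fun z hz r =>
    (norm_sub_le _ _).trans (by linarith [hr.radius z hz, hx'r.2 r])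
  have hMR : ∀ z ∈ X, ‖z - M‖ ≤ 2 * R := fun z hz => (norm_sub_le _ _).trans (by
    have := norm_mean_le (by linarith) fun x hx => hr.radius x (cell_subset (near x'.2) s hx)
    linarith [hr.radius z hz])
  -- At an unchanged level the spread is still small. The centroid `s` has moved by at most `e`, so
  -- the means of its two clusters are within `5 * e < γ` of each other.
  have hmean : mean (cell X (near x''.2) s) = M := by
    by_contra hne'
    have h1 := hr.gap.mean _ (cell_subset (near x''.2) s) _ (cell_subset (near x'.2) s) hne'
    have h2 := norm_sub_mean_le_of_spread_le (by linarith) hsp'' ⟨y, hy''⟩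
    have h3 : ‖x''.2 s - x'.2 s‖ ≤ e := by
      rw [hC, Function.update_self, add_sub_cancel_left, norm_smul, Real.norm_of_nonneg hμ0.le]
      calc μ * ‖y - x'.2 s‖ ≤ (j * h) * (2 * R) :=
            mul_le_mul hμ2 (hnorm y hy s) (norm_nonneg _) (by positivity)
        _ ≤ e := by nlinarith
    have h4 := norm_sub_le_norm_sub_add_norm_sub (mean (cell X (near x''.2) s)) (x''.2 s) M
    have h5 := norm_sub_le_norm_sub_add_norm_sub (x''.2 s) (x'.2 s) M
    rw [norm_sub_rev (mean (cell X (near x''.2) s)) (x''.2 s)] at h4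
    linarith [hr.e_le]
  -- no point on the other side of the mean stays
  have hside : ∀ z ∈ cell X (near x''.2) s, 0 ≤ inner ℝ (z - M) (y - M) := by
    intro z hz
    obtain ⟨hzX, hzs⟩ := mem_cell.1 hz
    by_contra! hneg
    have h1 := hr.gap.inner y hy z hzX _ (cell_subset (near x'.2) s) hneg
    have h2 : inner ℝ (z - x'.2 s) (y - x'.2 s) ≤ - (γ / 2) := by
      have h3 := inner_sub_sub_le (hMR z hzX) (hnorm y hy s) hsM
      have h4 := hr.e_mul_le
      change inner ℝ (z - M) (y - M) ≤ -γ at h1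
      linarith
    set r := near x.2 z with hrdef
    -- `s` was degenerate before the switch, so `z` had another centroid `r`. By continuity `r` is
    -- still almost as close to `z` as `s` is, while `s` now moves away from `z`.
    have hrs : r ≠ s := fun h => hya ⟨z, mem_cell.2 ⟨hzX, h⟩⟩
    have h3 : ‖z - x'.2 r‖ ≤ ‖z - x'.2 s‖ + 4 * R * h := by
      have h4 := hr.voronoi x.2 z hzX s
      have h5 := norm_sub_le_norm_sub_add_norm_sub z (x.2 r) (x'.2 r)
      have h6 := norm_sub_le_norm_sub_add_norm_sub z (x'.2 s) (x.2 s)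
      rw [norm_sub_rev (x.2 r) (x'.2 r)] at h5
      linarith [hδ r, hδ s]
    have h4 : ‖z - x''.2 s‖ ≤ ‖z - x'.2 r‖ := by
      have := hr.voronoi x''.2 z hzX r
      rw [hzs] at this
      rwa [hC, Function.update_of_ne hrs, ← hC] at this
    have h5 := h4.trans h3
    rw [hC, Function.update_self] at h5
    have h6 : 4 * R * h ≤ 2 * (2 * R) := by
      have : h ≤ 1 := hhT.trans hr.rate_le_one
      nlinarith
    have h7 := mul_le_of_norm_sub_add_smul_le hμ0.le (hnorm z hzX s) (by positivity) h6 h2 h5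
    -- `h7` reads `μ * γ ≤ 32 * R ^ 2 * h`; with `μ ≥ j * h / 4` this contradicts `128 * R ^ 2 < j *
    -- γ`.
    have h8 := mul_lt_mul_of_pos_right hr.lt_j hh0
    have h9 := mul_le_mul_of_nonneg_right hμ1 hγ.le
    linarith
  -- All terms are nonnegative and their sum vanishes, yet the term of `y` itself is positive.
  have hsum : ∑ z ∈ cell X (near x''.2) s, inner ℝ (z - M) (y - M) = 0 := by
    rw [← sum_inner, ← hmean, sum_sub_mean, inner_zero_left]
  have hpos : 0 < inner ℝ (y - M) (y - M) := by
    rw [real_inner_self_eq_norm_sq]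
    have : 0 < ‖y - M‖ := by linarith
    positivity
  have := Finset.single_le_sum hside hy''
  linarith

end Regime

end Escape

/-! ### Almost sure convergence of the clusterings -/

/-- For `|z| ≤ 1`, `exp z ≤ 1 + z + z ^ 2`: the negative mean absorbs the second moment. -/
theorem avg_exp_le_one {S : Type*} [Fintype S] [Nonempty S] {z : S → ℝ} {κ : ℝ} (hκ : κ ≤ 1)
    (hz : ∀ s, |z s| ≤ κ) (havg : avg z ≤ -κ ^ 2) : avg (fun s => Real.exp (z s)) ≤ 1 := by
  have h : ∀ s, Real.exp (z s) ≤ (1 + κ ^ 2) + z s := fun s => by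
    have h1 := (abs_le.1 (Real.abs_exp_sub_one_sub_id_le ((hz s).trans hκ))).2
    have h2 : z s ^ 2 ≤ κ ^ 2 := sq_le_sq' (by linarith [(abs_le.1 (hz s)).1]) (abs_le.1 (hz s)).2
    linarith
  refine (avg_mono h).trans ?_
  rw [avg_add, avg_const]
  linarith

/-- An exponential of a quantity with negative drift is superharmonic. -/
theorem avg_exp_mul_div_le {S : Type*} [Fintype S] [Nonempty S] {W g : S → ℝ}
    {w M β θ η η₁ : ℝ} (hη : 0 < η) (hle : η ≤ η₁) (hθ : 0 < θ) (hβ : 0 ≤ β)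
    (hθM : θ * M ≤ 1) (hθM2 : θ * M ^ 2 ≤ β) (hg : ∀ s, |g s| ≤ M * η) (havg : avg g ≤ -(β * η))
    (hW : ∀ s, W s ≤ w + g s) :
    avg (fun s => Real.exp (θ * W s / η₁)) ≤ Real.exp (θ * w / η₁) := by
  have hη₁ : 0 < η₁ := hη.trans_le hle
  set ρ := η / η₁ with hρ
  have hρ0 : 0 ≤ ρ := by positivity
  have hρ1 : ρ ≤ 1 := (div_le_one hη₁).2 hle
  have h1 : avg (fun s => Real.exp (θ / η₁ * g s)) ≤ 1 := by
    refine avg_exp_le_one (κ := θ * M * ρ) (mul_le_one₀ hθM hρ0 hρ1) (fun s => ?_) ?_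
    · rw [abs_mul, abs_of_pos (show 0 < θ / η₁ by positivity)]
      refine (mul_le_mul_of_nonneg_left (hg s) (by positivity)).trans_eq ?_
      rw [hρ]; ring
    · rw [avg_const_mul]
      refine (mul_le_mul_of_nonneg_left havg (by positivity)).trans ?_
      have h3 : θ / η₁ * -(β * η) = -(θ * ρ * β) := by rw [hρ]; ring
      have h4 : θ * M ^ 2 * ρ ≤ β * 1 := mul_le_mul hθM2 hρ1 hρ0 hβ
      have h5 := mul_le_mul_of_nonneg_left h4 (show 0 ≤ θ * ρ by positivity)
      rw [h3]
      linarith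
  calc avg (fun s => Real.exp (θ * W s / η₁))
      ≤ avg (fun s => Real.exp (θ * w / η₁) * Real.exp (θ / η₁ * g s)) := avg_mono fun s => by
        rw [← Real.exp_add, Real.exp_le_exp]
        have h2 := mul_le_mul_of_nonneg_left (hW s) (show 0 ≤ θ / η₁ by positivity)
        calc θ * W s / η₁ = θ / η₁ * W s := by ring
          _ ≤ _ := h2
          _ = _ := by ring
    _ ≤ Real.exp (θ * w / η₁) := by
        rw [avg_const_mul]
        exact mul_le_of_le_one_right (Real.exp_pos _).le h1

theorem one_sub_mul_mul_le {a b q H : ℝ} (hqH : 0 ≤ q * H) (h : b ≤ a) :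
    (1 - q * a) * H ≤ (1 - q * b) * H := by
  have := mul_le_mul_of_nonneg_right h hqH
  linarith

/-! ### Supermartingales and descent after a drop of the level. -/

section Settle

variable {d k m : ℕ} {X : Finset (Pt d)} [Nonempty X] {near : (Fin k → Pt d) → Pt d → Fin k}
  {c' t_o R γ e : ℝ} {j T : ℕ}

/-- The cost plus a bound for its total expected increase by noise. -/
def potential (X : Finset (Pt d)) (near : (Fin k → Pt d) → Pt d → Fin k) (c' t_o R : ℝ)
    (x : ℕ × (Fin k → Pt d)) : ℝ :=
  cost X near x.2 + 4 * X.card * R ^ 2 * (c' ^ 2 / (x.1 + t_o))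

/-- The least cost of an assignment of level at least `v`, truncated above. -/
def ceiling (X : Finset (Pt d)) (v w : ℝ) (C : Fin k → Pt d) : ℝ :=
  ⨅ a : {a : Pt d → Fin k // v ≤ level X a}, min w (costWith C (cell X a.1))

theorem costWith_nonneg (C : Fin k → Pt d) (a : Pt d → Fin k) : 0 ≤ costWith C (cell X a) := by
  unfold costWith; positivity

theorem ceiling_le {v : ℝ} (w : ℝ) (C : Fin k → Pt d) {a : Pt d → Fin k} (ha : v ≤ level X a) :
    ceiling X v w C ≤ min w (costWith C (cell X a)) :=
  ciInf_le (f := fun a : {a : Pt d → Fin k // v ≤ level X a} =>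
    min w (costWith C (cell X a.1))) ⟨min w 0, by
      rintro _ ⟨b, rfl⟩
      exact min_le_min_left w (costWith_nonneg C b.1)⟩ ⟨a, ha⟩

/-- `u` dominates the chance of a bad exit, where only the bound `H` is known; at good exits the
factor `1 - q` is gained. The comparison function is `(1 - q) * H + q * H * u`. -/
theorem unsettledProb_le_of_superharmonic {H q : ℝ} (hH : 0 ≤ H) (hq0 : 0 ≤ q) (hq1 : q ≤ 1)
    (D : Set (ℕ × (Fin k → Pt d))) (u : ℕ × (Fin k → Pt d) → ℝ) (hu0 : ∀ x ∈ D, 0 ≤ u x)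
    (hu : ∀ x ∈ D, avg (fun S : Fin m → X => u (update near c' t_o x S)) ≤ u x)
    (hout : ∀ x ∈ D, ∀ S : Fin m → X, update near c' t_o x S ∉ D →
      (unsettledProb X m near c' t_o (update near c' t_o x S) ≤ H ∧ 1 ≤ u (update near c' t_o x S)) ∨
      (unsettledProb X m near c' t_o (update near c' t_o x S) ≤ (1 - q) * H ∧
        0 ≤ u (update near c' t_o x S)))
    (hnull : ∀ x ∈ D, (uniformLaw (Fin m → X)) (unsettled near c' t_o x ∩
      {ω | ∀ n, path (update near c' t_o) x ω n ∈ D}) = 0)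
    {x : ℕ × (Fin k → Pt d)} (hx : x ∈ D) :
    unsettledProb X m near c' t_o x ≤ (1 - q * (1 - u x)) * H := by
  have hqH : 0 ≤ q * H := mul_nonneg hq0 hH
  have := comparison (update near c' t_o) (measurableSet_unsettled (X := X) (m := m) near c' t_o)
    (mem_unsettled_iff near c' t_o) D (fun x => (1 - q) * H + q * H * u x)
    (fun x hx => add_nonneg (mul_nonneg (sub_nonneg.2 hq1) hH) (mul_nonneg hqH (hu0 x hx)))
    (fun x hx => by
      rw [avg_add, avg_const, avg_const_mul]
      have := mul_le_mul_of_nonneg_left (hu x hx) hqH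
      linarith)
    (fun x hx S hS => by
      rcases hout x hx S hS with ⟨h1, h2⟩ | ⟨h1, h2⟩
      · have h3 := mul_le_mul_of_nonneg_left h2 hqH
        unfold unsettledProb at h1
        linarith
      · have h3 := mul_nonneg hqH h2
        unfold unsettledProb at h1
        linarith)
    hnull hx
  unfold unsettledProb
  linarith

namespace Regime

variable (hr : Regime X m near c' t_o R γ e j T) {x : ℕ × (Fin k → Pt d)}
include hr

theorem potential_nonneg (x : ℕ × (Fin k → Pt d)) : 0 ≤ potential X near c' t_o R x := by
  have := hr.t_pos
  have : 0 ≤ cost X near x.2 := costWith_nonneg _ _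
  unfold potential; positivity

theorem noise_le (hx : x ∈ region k d T R) :
    4 * X.card * R ^ 2 * (c' ^ 2 / (x.1 + t_o)) ≤ e ^ 2 / 4 := by
  refine le_trans ?_ hr.tail_le
  have h1 : (T : ℝ) ≤ x.1 := by exact_mod_cast hx.1
  have := hr.t_pos
  gcongr

/-- The second term of the potential telescopes and pays for the squared rate, leaving only the
drift. -/
theorem avg_potential_le (hx : x ∈ region k d T R) :
    avg (fun S : Fin m → X => costWith (update near c' t_o x S).2 (cell X (near x.2)) +
        4 * X.card * R ^ 2 * (c' ^ 2 / ((update near c' t_o x S).1 + t_o))) ≤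
      potential X near c' t_o R x - 2 * rate c' t_o x.1 * batchProb X m * spread X (near x.2) x.2 := by
  rw [avg_add]
  have h1 := hr.avg_costWith_update_le hx
  have h2 := mul_le_mul_of_nonneg_left (rate_sq_le (c' := c') hr.t_pos x.1)
    (show (0 : ℝ) ≤ 4 * X.card * R ^ 2 by positivity)
  have h3 : avg (fun S : Fin m → X =>
      4 * X.card * R ^ 2 * (c' ^ 2 / ((update near c' t_o x S).1 + t_o))) =
      4 * X.card * R ^ 2 * (c' ^ 2 / ((x.1 + 1 : ℕ) + t_o)) :=
    avg_const (S := Fin m → X) (4 * X.card * R ^ 2 * (c' ^ 2 / ((x.1 + 1 : ℕ) + t_o)))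
  rw [h3, potential]
  linarith

theorem measure_stays_eq_zero {D : Set (ℕ × (Fin k → Pt d))} (hD : D ⊆ region k d T R) {σ : ℝ}
    (hσ : 0 < σ) (hsp : ∀ x ∈ D, σ ≤ spread X (near x.2) x.2) (x : ℕ × (Fin k → Pt d)) :
    (uniformLaw (Fin m → X)) {ω | ∀ n, path (update near c' t_o) x ω n ∈ D} = 0 := by
  have hp := batchProb_pos (X := X) (m := m)
  refine measure_stays_forever_eq_zero (update near c' t_o) Prod.fst (fun _ _ => rfl) D
    (potential X near c' t_o R) hr.potential_nonneg
    (fun t => 2 * batchProb X m * σ * rate c' t_o t)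
    (fun t => by have := hr.rate_pos t; positivity) ?_ (fun x hx => ?_) x
  · rw [summable_mul_left_iff (by positivity)]
    exact not_summable_rate hr.c_pos hr.t_pos
  · refine le_trans (avg_mono fun S => ?_) ((hr.avg_potential_le (hD hx)).trans ?_)
    · exact add_le_add_left (hr.cost_update_le x S) _
    · have h1 := hr.rate_pos x.1
      have h2 := mul_le_mul_of_nonneg_left (hsp x hx)
        (show 0 ≤ 2 * rate c' t_o x.1 * batchProb X m by positivity)
      linarith

/-- Because of the truncation only assignments with cost near `v` matter. Their active centroids are
within `2 * e` of the means, where the gradient is small, so one step costs only order `e * rate`.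
-/
theorem ceiling_update_ge {v : ℝ} {a₀ : Pt d → Fin k} (ha₀ : level X a₀ = v)
    (hx : x ∈ region k d T R) (S : Fin m → X) :
    ceiling X v (v + 2 * e ^ 2) x.2 - 10 * X.card * R * e * rate c' t_o x.1 ≤
      ceiling X v (v + 2 * e ^ 2) (update near c' t_o x S).2 := by
  have : Nonempty {a : Pt d → Fin k // v ≤ level X a} := ⟨⟨a₀, ha₀.ge⟩⟩
  have he := hr.e_pos
  have hR := hr.one_le
  have hη := hr.rate_pos x.1
  set δ := 2 * R * rate c' t_o x.1 with hδ
  have hδ0 : 0 < δ := by positivity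
  have hδe : δ ≤ e := by
    refine le_trans ?_ hr.rate_e
    have h1 := hr.rate_le hx
    have h2 : (0 : ℝ) ≤ j := Nat.cast_nonneg j
    have h3 := hr.rate_pos T
    rw [hδ]
    gcongr
    nlinarith
  have hL : 10 * X.card * R * e * rate c' t_o x.1 = X.card * (δ * (5 * e)) := by rw [hδ]; ring
  refine le_ciInf fun a => ?_
  refine le_trans (sub_le_sub_right (ceiling_le _ _ a.2) _) ?_
  have hL0 : 0 ≤ 10 * X.card * R * e * rate c' t_o x.1 := by positivity
  refine le_min (by linarith [min_le_left (v + 2 * e ^ 2) (costWith x.2 (cell X a.1))]) ?_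
  by_contra! hlt
  set C' := (update near c' t_o x S).2 with hC'
  have h1 : costWith C' (cell X a.1) < v + 2 * e ^ 2 := by
    linarith [min_le_left (v + 2 * e ^ 2) (costWith x.2 (cell X a.1))]
  have h2 := min_le_right (v + 2 * e ^ 2) (costWith x.2 (cell X a.1))
  rw [costWith_eq_level_add_spread] at h1 hlt h2
  have h3 : spread X a.1 C' ≤ (2 * e) ^ 2 := by nlinarith [a.2]
  have h4 : spread X a.1 x.2 ≤ spread X a.1 C' + X.card * (δ * (5 * e)) := by
    rw [spread, spread, ← sum_card_cell a.1, Finset.sum_mul, ← Finset.sum_add_distrib]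
    refine Finset.sum_le_sum fun r _ => ?_
    rw [← mul_add]
    by_cases hne : (cell X a.1 r).Nonempty
    · refine mul_le_mul_of_nonneg_left ?_ (Nat.cast_nonneg _)
      have h5 := norm_sub_mean_le_of_spread_le (by linarith) h3 hne
      have h6 := norm_sub_le_norm_sub_add_norm_sub (x.2 r) (C' r) (mean (cell X a.1 r))
      have h7 : ‖x.2 r - C' r‖ ≤ δ := by
        rw [norm_sub_rev]
        exact hr.norm_update_sub_le hx S r
      have h8 : ‖x.2 r - mean (cell X a.1 r)‖ ^ 2 ≤ (‖C' r - mean (cell X a.1 r)‖ + δ) ^ 2 := by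
        gcongr; linarith
      nlinarith
    · rw [Finset.not_nonempty_iff_eq_empty.1 hne]; simp
  rw [costWith_eq_level_add_spread] at hlt
  linarith

theorem abs_shifted_increment_le (hx : x ∈ region k d T R) (S : Fin m → X) :
    |costWith (update near c' t_o x S).2 (cell X (near x.2)) - cost X near x.2
      + 10 * X.card * R * e * rate c' t_o x.1| ≤
      (8 * X.card * R ^ 2 + 10 * X.card * R * e) * rate c' t_o x.1 := by
  have h1 := hr.abs_costWith_update_sub_le hx S (near x.2)
  have h2 := hr.rate_pos x.1
  have h3 := hr.e_pos
  have h4 := hr.one_le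
  refine (abs_add_le _ _).trans ?_
  rw [abs_of_nonneg (show 0 ≤ 10 * X.card * R * e * rate c' t_o x.1 by positivity), add_mul]
  exact add_le_add_left h1 _

/-- The spread gives drift `-batchProb * γ` per unit of rate; the noise and the shift by the ceiling
each use up at most a quarter of it. -/
theorem avg_shifted_increment_le (hx : x ∈ region k d T R)
    (hs : γ / 2 ≤ spread X (near x.2) x.2) :
    avg (fun S : Fin m → X =>
      costWith (update near c' t_o x S).2 (cell X (near x.2)) - cost X near x.2
        + 10 * X.card * R * e * rate c' t_o x.1) ≤
      -(batchProb X m * γ / 2 * rate c' t_o x.1) := by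
  have hp := batchProb_pos (X := X) (m := m)
  have h3 := hr.avg_costWith_update_le hx
  have hη := hr.rate_pos x.1
  have h4 : avg (fun S : Fin m → X =>
      costWith (update near c' t_o x S).2 (cell X (near x.2)) - cost X near x.2
        + 10 * X.card * R * e * rate c' t_o x.1) = avg (fun S : Fin m → X =>
      costWith (update near c' t_o x S).2 (cell X (near x.2))) +
        (-cost X near x.2 + 10 * X.card * R * e * rate c' t_o x.1) := by
    rw [← avg_const (S := Fin m → X) (-cost X near x.2 + 10 * X.card * R * e * rate c' t_o x.1),
      ← avg_add]
    congr 1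
    ext S
    ring
  have h5 := mul_le_mul_of_nonneg_left hs (show 0 ≤ 2 * rate c' t_o x.1 * batchProb X m by
    positivity)
  have h6 : 16 * X.card * R ^ 2 * rate c' t_o x.1 ≤ batchProb X m * γ :=
    le_trans (by gcongr; exact hr.rate_le hx) hr.rate_drift
  have h7 := mul_le_mul_of_nonneg_right h6 hη.le
  have h8 := mul_le_mul_of_nonneg_right hr.e_drift hη.le
  rw [h4]
  linarith

/-- From a clustering of level below `v`, at a cost slightly above `v`, the cost falls below `c`
with probability bounded below. -/
theorem unsettledProb_le_of_level_lt : ∃ κ : ℝ, 0 < κ ∧ κ ≤ 1 ∧ ∀ H q c v : ℝ, 0 ≤ H → 0 ≤ q →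
    q ≤ 1 → (∀ y ∈ region k d T R, unsettledProb X m near c' t_o y ≤ H) →
    (∀ y ∈ region k d T R, cost X near y.2 ≤ c → unsettledProb X m near c' t_o y ≤ (1 - q) * H) →
    v ≤ c + γ / 4 → ∀ a₀ : Pt d → Fin k, level X a₀ = v → ∀ x ∈ region k d T R,
    level X (near x.2) < v → cost X near x.2 ≤ v + 2 * e ^ 2 →
    unsettledProb X m near c' t_o x ≤ (1 - κ * q) * H := by
  have he := hr.e_pos
  have hR := hr.one_le
  have hγ := hr.gap.pos
  have hp := batchProb_pos (X := X) (m := m)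
  have hp1 := batchProb_le_one (X := X) (m := m)
  have hn := hr.card_pos
  set L := 10 * X.card * R * e with hL
  set M := 8 * X.card * R ^ 2 + L with hM
  have hM0 : 0 < M := by positivity
  set β := batchProb X m * γ / 2 with hβ
  have hβ0 : 0 < β := by positivity
  set θ := min (1 / M) (β / M ^ 2) with hθ
  have hθ0 : 0 < θ := by positivity
  have hθM : θ * M ≤ 1 := by
    rw [← le_div_iff₀ hM0]; exact min_le_left _ _
  have hθM2 : θ * M ^ 2 ≤ β := by
    rw [← le_div_iff₀ (by positivity)]; exact min_le_right _ _
  have hexp : Real.exp (-(θ * β)) < 1 := by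
    rw [Real.exp_lt_one_iff]
    have : 0 < θ * β := by positivity
    linarith
  refine ⟨batchProb X m * (1 - Real.exp (-(θ * β))), mul_pos hp (by linarith), ?_, ?_⟩
  · exact mul_le_one₀ hp1 (by linarith) (by linarith [Real.exp_pos (-(θ * β))])
  intro H q c v hH hq0 hq1 hbd hlow hvc a₀ ha₀ x hx hlev hcost
  have hE := Real.exp_pos (-(θ * β))
  have hqH : 0 ≤ q * H := mul_nonneg hq0 hH
  by_cases hxc : cost X near x.2 ≤ c
  · have h1 : batchProb X m * (1 - Real.exp (-(θ * β))) ≤ 1 :=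
      mul_le_one₀ hp1 (by linarith) (by linarith)
    have h2 := one_sub_mul_mul_le hqH h1
    linarith [hlow x hx hxc]
  push Not at hxc
  -- While `W < 0`, the Voronoi assignment has level below `v`, hence at most `v - γ`. While the
  -- cost also exceeds `c`, the spread is at least `γ / 2` and `W` drifts down.
  set W : ℕ × (Fin k → Pt d) → ℝ :=
    fun y => cost X near y.2 - ceiling X v (v + 2 * e ^ 2) y.2 with hW
  set g : ℕ × (Fin k → Pt d) → (Fin m → X) → ℝ := fun y S =>
    costWith (update near c' t_o y S).2 (cell X (near y.2)) - cost X near y.2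
      + L * rate c' t_o y.1 with hg
  have hWg : ∀ y ∈ region k d T R, ∀ S : Fin m → X, W (update near c' t_o y S) ≤ W y + g y S := by
    intro y hy S
    have h1 := hr.ceiling_update_ge ha₀ hy S
    have h2 := hr.cost_update_le y S
    simp only [hW, hg, hL]
    linarith
  have hgabs : ∀ y ∈ region k d T R, ∀ S, |g y S| ≤ M * rate c' t_o y.1 :=
    fun y hy S => hr.abs_shifted_increment_le hy S
  have hdrift : ∀ y ∈ region k d T R, c < cost X near y.2 → level X (near y.2) < v →
      γ / 2 ≤ spread X (near y.2) y.2 ∧ avg (g y) ≤ -(β * rate c' t_o y.1) := by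
    intro y hy hyc hyl
    have h1 := hr.gap.level (near y.2) a₀ (by rwa [ha₀])
    have h2 := hr.cost_eq y.2
    have hs : γ / 2 ≤ spread X (near y.2) y.2 := by linarith
    exact ⟨hs, hr.avg_shifted_increment_le hy hs⟩
  have hx1 : W x ≤ 0 := by
    have : Nonempty {a : Pt d → Fin k // v ≤ level X a} := ⟨⟨a₀, ha₀.ge⟩⟩
    have : cost X near x.2 ≤ ceiling X v (v + 2 * e ^ 2) x.2 :=
      le_ciInf fun a => le_min hcost ((hr.voronoi _).costWith_le _)
    simp only [hW]; linarith
  set η₁ := rate c' t_o x.1 with hη₁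
  have hη₁0 : 0 < η₁ := hr.rate_pos _
  -- The drift of `W` is of order rate and its squared increments of order rate squared. An exponent
  -- of order `1 / η₁` therefore keeps `u` superharmonic, and makes a single drop of size `β * η₁`
  -- worth a factor independent of time.
  set u : ℕ × (Fin k → Pt d) → ℝ := fun y => Real.exp (θ * W y / η₁) with hu
  set D : Set (ℕ × (Fin k → Pt d)) :=
    {y | y ∈ region k d T R ∧ x.1 ≤ y.1 ∧ W y < 0 ∧ c < cost X near y.2} with hD
  have hDlev : ∀ y ∈ D, level X (near y.2) < v := by
    rintro y ⟨_, _, h1, _⟩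
    by_contra! h2
    have h3 := (ceiling_le (v + 2 * e ^ 2) y.2 h2).trans (min_le_right _ _)
    simp only [hW, cost] at h1
    linarith
  have hDbound : ∀ y ∈ D, unsettledProb X m near c' t_o y ≤ (1 - q * (1 - u y)) * H := by
    intro y hy
    refine unsettledProb_le_of_superharmonic hH hq0 hq1 D u (fun _ _ => (Real.exp_pos _).le) ?_ ?_
      ?_ hy
    · rintro z hz
      exact avg_exp_mul_div_le (hr.rate_pos z.1) (rate_antitone hr.c_pos hr.t_pos hz.2.1)
        hθ0 hβ0.le hθM hθM2 (hgabs z hz.1) (hdrift z hz.1 hz.2.2.2 (hDlev z hz)).2 (hWg z hz.1)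
    · rintro z hz S hzS
      have hzr := hr.update_mem hz.1 S
      by_cases hzc : cost X near (update near c' t_o z S).2 ≤ c
      · exact Or.inr ⟨hlow _ hzr hzc, (Real.exp_pos _).le⟩
      · push Not at hzc
        refine Or.inl ⟨hbd _ hzr, ?_⟩
        have h1 : 0 ≤ W (update near c' t_o z S) := by
          by_contra! h1
          exact hzS ⟨hzr, hz.2.1.trans (Nat.le_succ _), h1, hzc⟩
        exact Real.one_le_exp (by positivity)
    · rintro z hz
      refine measure_mono_null Set.inter_subset_right ?_
      exact hr.measure_stays_eq_zero (fun y hy => hy.1) (half_pos hγ)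
        (fun y hy => (hdrift y hy.1 hy.2.2.2 (hDlev y hy)).1) z
  -- `W x ≤ 0` alone gives no gain. Some mini-batch does at least as well as the average and brings
  -- `W` down to `-(β * η₁)`.
  obtain ⟨S, hS⟩ := exists_le_avg (g x)
  have hgS := hS.trans (hdrift x hx hxc hlev).2
  have hxS := hr.update_mem hx S
  have hWS : W (update near c' t_o x S) ≤ -(β * η₁) := by
    linarith [hWg x hx S]
  have hbS : unsettledProb X m near c' t_o (update near c' t_o x S) ≤
      (1 - q * (1 - Real.exp (-(θ * β)))) * H := by
    by_cases hxSc : cost X near (update near c' t_o x S).2 ≤ c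
    · have h1 := one_sub_mul_mul_le hqH (show 1 - Real.exp (-(θ * β)) ≤ 1 by linarith)
      linarith [hlow _ hxS hxSc]
    · push Not at hxSc
      have hmem : update near c' t_o x S ∈ D :=
        ⟨hxS, Nat.le_succ _, hWS.trans_lt (by have : 0 < β * η₁ := by positivity
                                              linarith), hxSc⟩
      refine (hDbound _ hmem).trans ?_
      have h1 : u (update near c' t_o x S) ≤ Real.exp (-(θ * β)) := by
        simp only [hu]
        rw [Real.exp_le_exp, div_le_iff₀ hη₁0]
        have := mul_le_mul_of_nonneg_left hWS hθ0.le
        linarith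
      exact one_sub_mul_mul_le hqH (by linarith)
  rw [unsettledProb_eq_avg]
  refine (avg_le_of_le_of_apply_le (fun S => hbd _ (hr.update_mem hx S)) S hbS).trans_eq ?_
  unfold batchProb
  ring

end Regime

end Settle

/-! ### Raising the cost threshold until the supremum vanishes. -/

section Settle

variable {d k m : ℕ} {X : Finset (Pt d)} [Nonempty X] {near : (Fin k → Pt d) → Pt d → Fin k}
  {c' t_o R γ e : ℝ} {j T : ℕ}

theorem unsettledProb_nonneg (x : ℕ × (Fin k → Pt d)) : 0 ≤ unsettledProb X m near c' t_o x :=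
  measureReal_nonneg

/-- The bounds `H` on the region and `(1 - q) * H` at costs at most `c`. -/
structure CostBound (X : Finset (Pt d)) [Nonempty X] (m : ℕ)
    (near : (Fin k → Pt d) → Pt d → Fin k) (c' t_o R : ℝ) (T : ℕ) (H q c : ℝ) : Prop where
  nonneg : 0 ≤ H
  q_nonneg : 0 ≤ q
  q_le : q ≤ 1
  bound : ∀ y ∈ region k d T R, unsettledProb X m near c' t_o y ≤ H
  low : ∀ y ∈ region k d T R, cost X near y.2 ≤ c → unsettledProb X m near c' t_o y ≤ (1 - q) * H

theorem CostBound.mul_nonneg {H q c : ℝ} (hb : CostBound X m near c' t_o R T H q c) :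
    0 ≤ q * H := _root_.mul_nonneg hb.q_nonneg hb.nonneg

namespace Regime

variable (hr : Regime X m near c' t_o R γ e j T) {x : ℕ × (Fin k → Pt d)}
include hr

/-- Each prescribed mini-batch has probability `batchProb`; off the prescribed path the bound `H` is
used. -/
theorem unsettledProb_le_of_path {H b : ℝ}
    (hbd : ∀ y ∈ region k d T R, unsettledProb X m near c' t_o y ≤ H) {ω : ℕ → Fin m → X} {i : ℕ}
    (hx : x ∈ region k d T R)
    (hb : unsettledProb X m near c' t_o (path (update near c' t_o) x ω i) ≤ b) :
    unsettledProb X m near c' t_o x ≤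
      (1 - batchProb X m ^ i) * H + batchProb X m ^ i * b := by
  induction i generalizing x ω with
  | zero => simpa [path] using hb
  | succ i ih =>
    rw [path_succ] at hb
    have h1 := ih (hr.update_mem hx (ω 0)) hb
    rw [unsettledProb_eq_avg]
    refine (avg_le_of_le_of_apply_le (fun S => hbd _ (hr.update_mem hx S)) (ω 0) h1).trans_eq ?_
    unfold batchProb
    ring

theorem rate_e_sq_le (hx : x ∈ region k d T R) : 8 * X.card * R ^ 2 * rate c' t_o x.1 ≤ e ^ 2 := by
  refine le_trans ?_ hr.rate_e_sq
  have h1 := hr.rate_le hx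
  have h2 : (0 : ℝ) ≤ j := Nat.cast_nonneg j
  have h3 := hr.rate_pos T
  gcongr
  nlinarith

/-- After a change of the clustering near a stationary point, the cost falls below `c` with
probability bounded below. -/
theorem unsettledProb_le_of_switch : ∃ κ : ℝ, 0 < κ ∧ κ ≤ 1 ∧ ∀ H q c : ℝ,
    CostBound X m near c' t_o R T H q c → ∀ x ∈ region k d T R,
    spread X (near x.2) x.2 ≤ e ^ 2 → level X (near x.2) ≤ c + γ / 4 → ∀ S : Fin m → X,
    clusteringOf X (near (update near c' t_o x S).2) ≠ clusteringOf X (near x.2) →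
    unsettledProb X m near c' t_o (update near c' t_o x S) ≤ (1 - κ * q) * H := by
  obtain ⟨κ, hκ0, hκ1, hκ⟩ := hr.unsettledProb_le_of_level_lt
  have hp := batchProb_pos (X := X) (m := m)
  have hp1 := batchProb_le_one (X := X) (m := m)
  have hpj : batchProb X m ^ j ≤ 1 := pow_le_one₀ hp.le hp1
  refine ⟨batchProb X m ^ j * κ, by positivity, mul_le_one₀ hpj hκ0.le hκ1, ?_⟩
  intro H q c hb x hx hsp hlc S hne
  set x' := update near c' t_o x S with hx'
  have hx'r := hr.update_mem hx S
  have he2 : 0 < e ^ 2 := by have := hr.e_pos; positivity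
  have hes := hr.e_sq_le
  have hn := hr.card_pos
  have hcost : cost X near x'.2 ≤ level X (near x.2) + e ^ 2 +
      8 * X.card * R ^ 2 * rate c' t_o x.1 := by
    have h1 := hr.cost_update_le x S
    have h2 := (abs_le.1 (hr.abs_costWith_update_sub_le hx S (near x.2))).2
    have h3 := hr.cost_eq x.2
    simp only [cost] at *
    linarith
  have h8 := hr.rate_e_sq_le hx
  have hle : level X (near x'.2) ≤ level X (near x.2) :=
    hr.level_le_of_cost_lt (near x.2) rfl (by linarith)
  have hlow := fun y hy h1 h2 => hκ H q c (level X (near x.2)) hb.nonneg hb.q_nonneg hb.q_le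
    hb.bound hb.low hlc (near x.2) rfl y hy h1 h2
  rcases hle.lt_or_eq with hlt | heq
  -- If the level drops at the switch, the descent starts at once; otherwise the escape path is
  -- followed first.
  · refine (hlow x' hx'r hlt (by linarith)).trans ?_
    have h1 : batchProb X m ^ j * κ ≤ κ := mul_le_of_le_one_left hκ0.le hpj
    linarith [one_sub_mul_mul_le hb.mul_nonneg h1]
  · obtain ⟨ω, hω⟩ := hr.exists_path_level_lt hx hsp heq hne
    have h1 := hr.cost_path_le hx'r ω j
    have h2 : rate c' t_o x'.1 ≤ rate c' t_o T := hr.rate_le hx'r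
    have h3 : rate c' t_o x.1 ≤ rate c' t_o T := hr.rate_le hx
    have h4 : 8 * X.card * R ^ 2 * (rate c' t_o x.1 + j * rate c' t_o x'.1) ≤ e ^ 2 := by
      refine le_trans ?_ hr.rate_e_sq
      have : rate c' t_o x.1 + j * rate c' t_o x'.1 ≤ (j + 1) * rate c' t_o T := by
        have := mul_le_mul_of_nonneg_left h2 (Nat.cast_nonneg (α := ℝ) j)
        linarith
      gcongr
    have h5 := hlow _ (hr.path_mem hx'r ω j) hω (by linarith)
    refine (hr.unsettledProb_le_of_path hb.bound hx'r h5).trans_eq ?_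
    ring

/-- Near a stationary point, the chain settles or the cost falls below `c`, with probability
bounded below. -/
theorem unsettledProb_le_of_spread_le : ∃ κ : ℝ, 0 < κ ∧ κ ≤ 1 ∧ ∀ H q c : ℝ,
    CostBound X m near c' t_o R T H q c → ∀ x ∈ region k d T R,
    spread X (near x.2) x.2 ≤ e ^ 2 / 4 → cost X near x.2 ≤ c + γ / 4 →
    unsettledProb X m near c' t_o x ≤ (1 - κ * q) * H := by
  obtain ⟨κ, hκ0, hκ1, hκ⟩ := hr.unsettledProb_le_of_switch
  refine ⟨κ / 2, by positivity, by linarith, ?_⟩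
  intro H q c hb x hx hsp hcost
  have he := hr.e_pos
  have he2 : 0 < e ^ 2 := by positivity
  have hR := hr.one_le
  have hp := batchProb_pos (X := X) (m := m)
  set v := level X (near x.2) with hv
  have hvc : v ≤ c + γ / 4 := by
    have := hr.cost_eq x.2
    linarith [spread_nonneg (X := X) (near x.2) x.2]
  have hnoise0 : ∀ y : ℕ × (Fin k → Pt d), 0 ≤ 4 * X.card * R ^ 2 * (c' ^ 2 / (y.1 + t_o)) :=
    fun y => by have := hr.t_pos; positivity
  set A := clusteringOf X (near x.2) with hA
  set u : ℕ × (Fin k → Pt d) → ℝ := fun y =>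
    (max (cost X near y.2 - v) 0 + 4 * X.card * R ^ 2 * (c' ^ 2 / (y.1 + t_o))) / e ^ 2 with hu
  -- The chain leaves `D` by a switch, which is a good exit, or by spread above `e ^ 2`, where `u ≥
  -- 1`. If it never leaves, `A` persists and the chain settles.
  set D : Set (ℕ × (Fin k → Pt d)) := {y | y ∈ region k d T R ∧ clusteringOf X (near y.2) = A ∧
    spread X (near y.2) y.2 ≤ e ^ 2} with hD
  have hu0 : ∀ y, 0 ≤ u y := fun y => by
    have := hnoise0 y
    have := le_max_right (cost X near y.2 - v) 0
    simp only [hu]; positivity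
  have hlevel : ∀ y : ℕ × (Fin k → Pt d), clusteringOf X (near y.2) = A → level X (near y.2) = v :=
    fun y hy => by rw [hv, level_eq_clusteringCost, level_eq_clusteringCost, hy]
  have hcostD : ∀ y : ℕ × (Fin k → Pt d), clusteringOf X (near y.2) = A →
      cost X near y.2 - v = spread X (near y.2) y.2 := fun y hy => by
    rw [hr.cost_eq, hlevel y hy]; ring
  have hxD : x ∈ D := ⟨hx, rfl, by linarith⟩
  have hstat : IsStationary k A := by
    refine isStationary_of_spread_le hr.gap he.le ?_ (hr.voronoi x.2)
      (hxD.2.2)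
    linarith [hr.e_le]
  have hmain : unsettledProb X m near c' t_o x ≤ (1 - (κ * q) * (1 - u x)) * H := by
    refine unsettledProb_le_of_superharmonic hb.nonneg (mul_nonneg hκ0.le hb.q_nonneg)
      (mul_le_one₀ hκ1 hb.q_nonneg hb.q_le) D u (fun y _ => hu0 y) ?_ ?_ ?_ hxD
    · rintro y ⟨hy, hyA, hysp⟩
      have h1 := hr.avg_potential_le hy
      have h2 : ∀ S : Fin m → X, u (update near c' t_o y S) ≤ (e ^ 2)⁻¹ *
          ((costWith (update near c' t_o y S).2 (cell X (near y.2)) +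
            4 * X.card * R ^ 2 * (c' ^ 2 / ((update near c' t_o y S).1 + t_o))) + -v) := by
        intro S
        have h3 : max (cost X near (update near c' t_o y S).2 - v) 0 ≤
            costWith (update near c' t_o y S).2 (cell X (near y.2)) - v := by
          refine max_le (sub_le_sub_right (hr.cost_update_le y S) _) ?_
          rw [costWith_eq_level_add_spread, hlevel y hyA]
          linarith [spread_nonneg (X := X) (near y.2) (update near c' t_o y S).2]
        simp only [hu]
        rw [div_eq_inv_mul]
        refine mul_le_mul_of_nonneg_left ?_ (by positivity)
        linarith
      refine (avg_mono h2).trans ?_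
      rw [avg_const_mul, avg_add, avg_const]
      simp only [hu]
      rw [div_eq_inv_mul]
      refine mul_le_mul_of_nonneg_left ?_ (by positivity)
      have h3 : 0 ≤ 2 * rate c' t_o y.1 * batchProb X m * spread X (near y.2) y.2 := by
        have := hr.rate_pos y.1
        have := spread_nonneg (X := X) (near y.2) y.2
        positivity
      have h4 := le_max_left (cost X near y.2 - v) 0
      unfold potential at h1
      linarith
    · rintro y ⟨hy, hyA, hysp⟩ S hS
      have hyr := hr.update_mem hy S
      by_cases hA' : clusteringOf X (near (update near c' t_o y S).2) = A
      · refine Or.inl ⟨hb.bound _ hyr, ?_⟩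
        have h1 : e ^ 2 < spread X (near (update near c' t_o y S).2) (update near c' t_o y S).2 := by
          by_contra! h
          exact hS ⟨hyr, hA', h⟩
        simp only [hu]
        rw [le_div_iff₀ he2, one_mul]
        have h2 := le_max_left (cost X near (update near c' t_o y S).2 - v) 0
        rw [hcostD _ hA'] at h2
        have h3 := hnoise0 (update near c' t_o y S)
        rw [hcostD _ hA']
        linarith
      · refine Or.inr ⟨hκ H q c hb y hy hysp ?_ S ?_, hu0 _⟩
        · rw [hlevel y hyA]; exact hvc
        · rw [hyA]; exact hA'
    · rintro y ⟨hy, hyA, hysp⟩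
      have : unsettled (X := X) (m := m) near c' t_o y ∩
          {ω | ∀ n, path (update near c' t_o) y ω n ∈ D} = ∅ := by
        rw [Set.eq_empty_iff_forall_notMem]
        rintro ω ⟨h1, h2⟩
        exact h1 ⟨A, hstat, 0, fun t _ => (h2 t).2.1⟩
      rw [this, measure_empty]
  -- The spread and the remaining noise contribute at most `e ^ 2 / 4` each.
  have hux : u x ≤ 1 / 2 := by
    simp only [hu]
    rw [div_le_iff₀ he2, hcostD x rfl, max_eq_left (spread_nonneg _ _)]
    linarith [hr.noise_le hx]
  refine hmain.trans ?_
  have h1 : κ / 2 ≤ κ * (1 - u x) := by nlinarith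
  have h2 := one_sub_mul_mul_le hb.mul_nonneg h1
  linarith

/-- A bound for costs at most `c` extends to slightly larger costs. -/
theorem costBound_step {H q c : ℝ} (hb : CostBound X m near c' t_o R T H q c) (hq : 0 < q) :
    ∃ q' : ℝ, 0 < q' ∧ CostBound X m near c' t_o R T H q' (c + γ / 8) := by
  obtain ⟨κ, hκ0, hκ1, hκ⟩ := hr.unsettledProb_le_of_spread_le
  have hγ := hr.gap.pos
  have he2 : 0 < e ^ 2 := by have := hr.e_pos; positivity
  have hes := hr.e_sq_le
  have hp := batchProb_pos (X := X) (m := m)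
  -- Costs are nonnegative: a negative threshold is vacuous, and at threshold zero the spread
  -- vanishes. Otherwise `M > 0` may be a denominator.
  rcases le_or_gt (c + γ / 8) 0 with hneg | hpos
  · rcases hneg.lt_or_eq with hneg | hzero
    · refine ⟨q, hq, hb.nonneg, hq.le, hb.q_le, hb.bound, fun y hy h => ?_⟩
      exact absurd (h.trans_lt hneg) (not_lt.2 (costWith_nonneg _ _))
    · refine ⟨κ * q, by positivity, hb.nonneg, by positivity, mul_le_one₀ hκ1 hq.le hb.q_le,
        hb.bound, fun y hy h => hκ H q c hb y hy ?_ (by linarith)⟩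
      rw [hzero] at h
      have h1 := hr.cost_eq y.2
      have h2 := level_nonneg (X := X) (near y.2)
      linarith
  set M := c + γ / 4 with hM
  have hM0 : 0 < M := by linarith
  set τ := γ / 16 / M with hτ
  have hτ0 : 0 < τ := by positivity
  have hτ1 : τ ≤ 1 := (div_le_one hM0).2 (by linarith)
  refine ⟨κ * τ * q, by positivity, hb.nonneg, by positivity, ?_, hb.bound, ?_⟩
  · exact mul_le_one₀ (mul_le_one₀ hκ1 hτ0.le hτ1) hq.le hb.q_le
  intro x hx hcx
  have hκτ : κ * τ ≤ κ := mul_le_of_le_one_right hκ0.le hτ1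
  by_cases hsp : spread X (near x.2) x.2 ≤ e ^ 2 / 4
  · have h1 := hκ H q c hb x hx hsp (by linarith)
    linarith [one_sub_mul_mul_le hb.mul_nonneg hκτ]
  push Not at hsp
  -- The drift forces an exit from `D`: either the spread becomes small below cost `M`, which is
  -- good, or the cost reaches `M`, which has probability at most `potential / M`.
  set D : Set (ℕ × (Fin k → Pt d)) :=
    {y | y ∈ region k d T R ∧ e ^ 2 / 4 < spread X (near y.2) y.2 ∧ cost X near y.2 < M} with hD
  set u : ℕ × (Fin k → Pt d) → ℝ := fun y => potential X near c' t_o R y / M with hu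
  have hu0 : ∀ y, 0 ≤ u y := fun y => div_nonneg (hr.potential_nonneg y) hM0.le
  have hmain : unsettledProb X m near c' t_o x ≤ (1 - (κ * q) * (1 - u x)) * H := by
    refine unsettledProb_le_of_superharmonic hb.nonneg (by positivity)
      (mul_le_one₀ hκ1 hq.le hb.q_le) D u (fun y _ => hu0 y) ?_ ?_ ?_ ⟨hx, hsp, by linarith⟩
    · rintro y ⟨hy, -, -⟩
      have h1 := hr.avg_potential_le hy
      have h3 : 0 ≤ 2 * rate c' t_o y.1 * batchProb X m * spread X (near y.2) y.2 := by
        have := hr.rate_pos y.1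
        have := spread_nonneg (X := X) (near y.2) y.2
        positivity
      have h2 : ∀ S : Fin m → X, u (update near c' t_o y S) ≤ M⁻¹ *
          (costWith (update near c' t_o y S).2 (cell X (near y.2)) +
            4 * X.card * R ^ 2 * (c' ^ 2 / ((update near c' t_o y S).1 + t_o))) := fun S => by
        simp only [hu]
        rw [div_eq_inv_mul]
        refine mul_le_mul_of_nonneg_left ?_ (by positivity)
        exact add_le_add_left (hr.cost_update_le y S) _
      refine (avg_mono h2).trans ?_
      rw [avg_const_mul]
      simp only [hu]
      rw [div_eq_inv_mul]
      exact mul_le_mul_of_nonneg_left (by linarith) (by positivity)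
    · rintro y ⟨hy, -, -⟩ S hS
      have hyr := hr.update_mem hy S
      by_cases hcM : cost X near (update near c' t_o y S).2 < M
      · refine Or.inr ⟨hκ H q c hb _ hyr ?_ hcM.le, hu0 _⟩
        by_contra! h
        exact hS ⟨hyr, h, hcM⟩
      · push Not at hcM
        refine Or.inl ⟨hb.bound _ hyr, ?_⟩
        simp only [hu]
        rw [le_div_iff₀ hM0, one_mul]
        have : 0 ≤ 4 * X.card * R ^ 2 * (c' ^ 2 / ((update near c' t_o y S).1 + t_o)) := by
          have := hr.t_pos; positivity
        unfold potential
        linarith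
    · intro y _
      refine measure_mono_null Set.inter_subset_right ?_
      exact hr.measure_stays_eq_zero (fun z hz => hz.1) (show 0 < e ^ 2 / 4 by positivity)
        (fun z hz => hz.2.1.le) y
  have hux : u x ≤ 1 - τ := by
    have h1 := hr.noise_le hx
    simp only [hu]
    rw [div_le_iff₀ hM0, sub_mul, hτ, div_mul_cancel₀ _ hM0.ne']
    unfold potential
    linarith
  refine hmain.trans ?_
  have h1 : κ * τ ≤ κ * (1 - u x) := mul_le_mul_of_nonneg_left (by linarith) hκ0.le
  have h2 := one_sub_mul_mul_le hb.mul_nonneg h1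
  linarith

theorem unsettledProb_eq_zero (hx : x ∈ region k d T R) : unsettledProb X m near c' t_o x = 0 := by
  set Q := unsettledProb X m near c' t_o '' region k d T R with hQ
  have hbdd : BddAbove Q := ⟨1, by rintro _ ⟨y, -, rfl⟩; exact measureReal_le_one⟩
  have hle : ∀ y ∈ region k d T R, unsettledProb X m near c' t_o y ≤ sSup Q :=
    fun y hy => le_csSup hbdd ⟨y, hy, rfl⟩
  have hH0 : 0 ≤ sSup Q := (unsettledProb_nonneg x).trans (hle x hx)
  have hγ := hr.gap.pos
  have hind : ∀ i : ℕ, ∃ q : ℝ, 0 < q ∧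
      CostBound X m near c' t_o R T (sSup Q) q (-1 + i * (γ / 8)) := by
    intro i
    induction i with
    | zero =>
      -- No cost is as low as `-1`, so even `q = 1` is allowed here.
      refine ⟨1, one_pos, hH0, zero_le_one, le_rfl, hle, fun y _ h => ?_⟩
      have : 0 ≤ cost X near y.2 := costWith_nonneg _ _
      simp only [Nat.cast_zero, zero_mul, add_zero] at h
      linarith
    | succ i ih =>
      obtain ⟨q, hq, hb⟩ := ih
      obtain ⟨q', hq', hb'⟩ := hr.costBound_step hb hq
      refine ⟨q', hq', ?_⟩
      convert hb' using 1
      push_cast; ring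
  -- After this many steps of size `γ / 8` the threshold exceeds every cost in the region.
  obtain ⟨i, hi⟩ := exists_nat_gt ((1 + X.card * (2 * R) ^ 2) / (γ / 8))
  rw [div_lt_iff₀ (by positivity)] at hi
  obtain ⟨q, hq, hb⟩ := hind i
  have hall : ∀ y ∈ region k d T R, unsettledProb X m near c' t_o y ≤ (1 - q) * sSup Q := by
    intro y hy
    refine hb.low y hy ?_
    have : cost X near y.2 ≤ X.card * (2 * R) ^ 2 := by
      rw [cost, costWith_cell, ← nsmul_eq_mul]
      refine Finset.sum_le_card_nsmul _ _ _ fun z hz => ?_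
      gcongr
      exact (norm_sub_le _ _).trans (by linarith [hr.radius z hz, hy.2 (near y.2 z)])
    linarith
  have hsup : sSup Q ≤ (1 - q) * sSup Q :=
    csSup_le ⟨_, x, hx, rfl⟩ (by rintro _ ⟨y, hy, rfl⟩; exact hall y hy)
  have : sSup Q ≤ 0 := by nlinarith
  exact le_antisymm ((hle x hx).trans this) (unsettledProb_nonneg x)

end Regime

theorem exists_norm_path_le (near : (Fin k → Pt d) → Pt d → Fin k) (c' t_o : ℝ) (n : ℕ)
    (x : ℕ × (Fin k → Pt d)) :
    ∃ R : ℝ, ∀ (ω : ℕ → Fin m → X) (r : Fin k), ‖(path (update near c' t_o) x ω n).2 r‖ ≤ R := by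
  induction n generalizing x with
  | zero => exact ⟨∑ r, ‖x.2 r‖, fun _ r => Finset.single_le_sum (f := fun r => ‖x.2 r‖)
      (fun _ _ => norm_nonneg _) (Finset.mem_univ r)⟩
  | succ n ih =>
    choose R hR using fun S : Fin m → X => ih (update near c' t_o x S)
    refine ⟨∑ S, |R S|, fun ω r => ?_⟩
    rw [path_succ]
    exact (hR (ω 0) (tail ω) r).trans ((le_abs_self _).trans (Finset.single_le_sum
      (f := fun S => |R S|) (fun _ _ => abs_nonneg _) (Finset.mem_univ (ω 0))))

/-- This carries the result from late times, where the regime holds, back to time 0. -/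
theorem unsettledProb_eq_zero_of_path (n : ℕ) (x : ℕ × (Fin k → Pt d))
    (h : ∀ ω : ℕ → Fin m → X,
      unsettledProb X m near c' t_o (path (update near c' t_o) x ω n) = 0) :
    unsettledProb X m near c' t_o x = 0 := by
  induction n generalizing x with
  | zero => exact h fun _ _ => Classical.arbitrary X
  | succ n ih =>
    rw [unsettledProb_eq_avg]
    have : ∀ S : Fin m → X, unsettledProb X m near c' t_o (update near c' t_o x S) = 0 :=
      fun S => ih _ fun ω => by
        have := h (consSample (S, ω))
        rwa [path_succ] at this
    simp only [this]
    exact avg_const _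

/-- Almost surely, the clusterings are eventually constant and stationary. -/
theorem unsettledProb_zero_eq_zero (hm : m ≠ 0) (hv : ∀ C, IsVoronoi X C (near C))
    (hA0 : NoBoundaryStationary X k) (hc : 0 < c') (ht : 0 < t_o) (C₀ : Fin k → Pt d) :
    unsettledProb X m near c' t_o (0, C₀) = 0 := by
  obtain ⟨T₀, hT₀⟩ := Filter.eventually_atTop.1
    ((tendsto_rate c' t_o).eventually_lt_const one_pos)
  obtain ⟨R₀, hR₀⟩ := exists_norm_path_le (m := m) (X := X) near c' t_o T₀ (0, C₀)
  set R := max R₀ (1 + ∑ x ∈ X, ‖x‖) with hR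
  have hX : ∀ x ∈ X, ‖x‖ ≤ R := fun x hx => by
    have := Finset.single_le_sum (f := fun x : Pt d => ‖x‖) (fun _ _ => norm_nonneg _) hx
    exact le_trans (by linarith) (le_max_right _ _)
  have h1 : 1 ≤ R := le_trans (by
    have : 0 ≤ ∑ x ∈ X, ‖x‖ := Finset.sum_nonneg fun _ _ => norm_nonneg _
    linarith) (le_max_right _ _)
  obtain ⟨γ, e, j, T, hT, hr⟩ := exists_regime (m := m) hm hv hA0 hX h1 hc ht T₀
  refine unsettledProb_eq_zero_of_path T _ fun ω => hr.unsettledProb_eq_zero ⟨?_, ?_⟩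
  · rw [path_update_fst]; omega
  · have : ∀ n, T₀ ≤ n → ∀ r, ‖(path (update near c' t_o) (0, C₀) ω n).2 r‖ ≤ R := by
      intro n hn
      induction n, hn using Nat.le_induction with
      | base => exact fun r => (hR₀ ω r).trans (le_max_left _ _)
      | succ n hn ih =>
        refine norm_step_le hX ih (rate_pos hc ht _).le (hT₀ _ ?_).le _
        rw [path_update_fst]; omega
    exact this T hT

end Settle

/-! ### Rate of convergence -/

section Integral

variable {S σ : Type*} [Fintype S] [Nonempty S] [MeasurableSpace S] [MeasurableSingletonClass S]

theorem integral_uniformLaw_eq_avg {f : (ℕ → S) → ℝ} (hf : Measurable f) {B : ℝ}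
    (hB : ∀ ω, |f ω| ≤ B) :
    ∫ ω, f ω ∂uniformLaw S = avg fun s => ∫ ω, f (consSample (s, ω)) ∂uniformLaw S := by
  have hm : Measurable fun p : S × (ℕ → S) => f (consSample p) := hf.comp measurable_consSample
  have hint : Integrable (fun p : S × (ℕ → S) => f (consSample p))
      (((PMF.uniformOfFintype S).toMeasure).prod (uniformLaw S)) :=
    Integrable.of_bound hm.aestronglyMeasurable B (Filter.Eventually.of_forall fun p => hB _)
  conv_lhs => rw [← uniformLaw_eq_map_consSample]
  rw [integral_map measurable_consSample.aemeasurable hf.aestronglyMeasurable, integral_prod _ hint,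
    integral_fintype Integrable.of_finite, avg, Finset.mul_sum]
  refine Finset.sum_congr rfl fun s _ => ?_
  rw [Measure.real, PMF.toMeasure_apply_singleton _ _ (measurableSet_singleton s)]
  simp

variable (F : σ → S → σ)

theorem measurable_path_comp (g : σ → ℝ) (x : σ) (n : ℕ) :
    Measurable fun ω => g (path F x ω n) :=
  fun s _ => measurableSet_path F (g ⁻¹' s) n x

theorem exists_abs_path_le (g : σ → ℝ) (x : σ) (n : ℕ) :
    ∃ B : ℝ, ∀ ω, |g (path F x ω n)| ≤ B := by
  induction n generalizing x with
  | zero => exact ⟨|g x|, fun _ => le_rfl⟩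
  | succ n ih =>
    choose B hB using fun s => ih (F x s)
    refine ⟨∑ s, |B s|, fun ω => ?_⟩
    rw [path_succ]
    exact (hB (ω 0) (tail ω)).trans ((le_abs_self _).trans (Finset.single_le_sum
      (f := fun s => |B s|) (fun _ _ => abs_nonneg _) (Finset.mem_univ (ω 0))))

/-- The expectation of `g` at time `n` on the event that the chain has stayed in `D`. -/
def stayIntegral (D : Set σ) (g : σ → ℝ) (n : ℕ) (x : σ) : ℝ :=
  ∫ ω, (stays F D x (n + 1)).indicator (fun ω => g (path F x ω n)) ω ∂uniformLaw S

theorem measurable_stays_indicator (D : Set σ) (g : σ → ℝ) (n : ℕ) (x : σ) :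
    Measurable ((stays F D x (n + 1)).indicator fun ω => g (path F x ω n)) :=
  (measurable_path_comp F g x n).indicator (measurableSet_stays F D x _)

theorem exists_abs_indicator_le (E : Set (ℕ → S)) (g : σ → ℝ) (n : ℕ) (x : σ) :
    ∃ B : ℝ, ∀ ω, |E.indicator (fun ω => g (path F x ω n)) ω| ≤ B := by
  obtain ⟨B, hB⟩ := exists_abs_path_le F g x n
  refine ⟨|B|, fun ω => ?_⟩
  by_cases h : ω ∈ E
  · rw [Set.indicator_of_mem h]
    exact (hB ω).trans (le_abs_self B)
  · rw [Set.indicator_of_notMem h, abs_zero]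
    exact abs_nonneg B

theorem stayIntegral_zero (D : Set σ) (g : σ → ℝ) (x : σ) :
    stayIntegral F D g 0 x = if x ∈ D then g x else 0 := by
  have : (stays F D x (0 + 1)).indicator (fun ω => g (path F x ω 0)) =
      fun _ => if x ∈ D then g x else 0 := by
    ext ω
    simp [Set.indicator, stays, path]
  rw [stayIntegral, this]
  simp

theorem stayIntegral_succ (D : Set σ) (g : σ → ℝ) (n : ℕ) (x : σ) :
    stayIntegral F D g (n + 1) x =
      if x ∈ D then avg fun s => stayIntegral F D g n (F x s) else 0 := by
  split_ifs with hx
  · obtain ⟨B, hB⟩ := exists_abs_indicator_le F (stays F D x (n + 1 + 1)) g (n + 1) x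
    rw [stayIntegral, integral_uniformLaw_eq_avg (measurable_stays_indicator F D g (n + 1) x) hB]
    congr 1
    ext s
    rw [stayIntegral]
    congr 1
    ext ω
    have h := mem_stays_succ F hx (n + 1) (consSample (s, ω))
    change _ ↔ ω ∈ stays F D (F x s) (n + 1) at h
    simp only [Set.indicator, h, path_succ]
    rfl
  · have : stays F D x (n + 1 + 1) = ∅ := by
      ext ω
      simp only [stays, Set.mem_ofPred_eq, Set.mem_empty_iff_false, iff_false]
      exact fun h => hx (h 0 (by omega))
    simp [stayIntegral, this]

/-- Persistence forever is not determined at time `n`. It is enlarged to persistence up to time `n`,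
which is, and nonnegativity of `g` gives the inequality. -/
theorem setIntegral_le_stayIntegral {D : Set σ} {g : σ → ℝ} {n : ℕ} {x : σ} {E : Set (ℕ → S)}
    (hE : MeasurableSet E) (hED : E ⊆ stays F D x (n + 1))
    (h : ∀ ω, path F x ω n ∈ D → 0 ≤ g (path F x ω n)) :
    ∫ ω in E, g (path F x ω n) ∂uniformLaw S ≤ stayIntegral F D g n x := by
  have hint : ∀ {E : Set (ℕ → S)}, MeasurableSet E →
      Integrable (E.indicator fun ω => g (path F x ω n)) (uniformLaw S) := fun {E} hE => by
    obtain ⟨B, hB⟩ := exists_abs_indicator_le F E g n x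
    exact Integrable.of_bound
      ((measurable_path_comp F g x n).indicator hE).aestronglyMeasurable B
      (Filter.Eventually.of_forall hB)
  rw [← integral_indicator hE]
  refine integral_mono (hint hE) (hint (measurableSet_stays F D x _)) fun ω => ?_
  by_cases hω : ω ∈ E
  · rw [Set.indicator_of_mem hω, Set.indicator_of_mem (hED hω)]
  · rw [Set.indicator_of_notMem hω]
    exact Set.indicator_apply_nonneg fun hω' : ω ∈ stays F D x (n + 1) =>
      h ω (hω' n (Nat.lt_succ_self n))

end Integral

/-- A recursion with contraction `1 - (1 + g) / (t + 1)` and noise `1 / t ^ 2` decays like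
`1 / t`. -/
theorem exists_le_div_of_recursion {a : ℕ → ℝ} {t_o g M : ℝ} {T : ℕ} (ht : 0 < t_o) (hg : 0 < g)
    (hM : 0 ≤ M) (hT : g ≤ T)
    (h : ∀ t ≥ T, a (t + 1) ≤
      (1 - (1 + g) / (((t + 1 : ℕ) : ℝ) + t_o)) * a t + M / (((t + 1 : ℕ) : ℝ) + t_o) ^ 2) :
    ∃ L : ℝ, 0 ≤ L ∧ ∀ t ≥ T, a t ≤ L / (t + t_o) := by
  refine ⟨max (M / g) (|a T| * (T + t_o)), le_max_of_le_left (by positivity), fun t htT => ?_⟩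
  set L := max (M / g) (|a T| * (T + t_o)) with hL
  have hL0 : 0 ≤ L := le_max_of_le_left (by positivity)
  induction t, htT using Nat.le_induction with
  | base =>
    have hpos : (0 : ℝ) < T + t_o := by positivity
    rw [le_div_iff₀ hpos]
    exact (mul_le_mul_of_nonneg_right (le_abs_self _) hpos.le).trans (le_max_right _ _)
  | succ t htT ih =>
    have htT' : (T : ℝ) ≤ t := by exact_mod_cast htT
    have hu : (0 : ℝ) < t + t_o := by positivity
    have hML : M ≤ L * g := by
      rw [← div_le_iff₀ hg]; exact le_max_left _ _
    have h1 := h t htT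
    have hcast : ((t + 1 : ℕ) : ℝ) + t_o = (t + t_o) + 1 := by push_cast; ring
    rw [hcast] at h1 ⊢
    set u : ℝ := t + t_o with hu'
    have hgu : g ≤ u := by linarith
    -- The induction hypothesis may be multiplied only by a nonnegative factor, which is why `T ≥
    -- g`.
    have h2 : 0 ≤ 1 - (1 + g) / (u + 1) := by
      rw [sub_nonneg, div_le_one (by positivity)]; linarith
    refine h1.trans ((add_le_add_left (mul_le_mul_of_nonneg_left ih h2) _).trans ?_)
    have h3 : (1 - (1 + g) / (u + 1)) * (L / u) + M / (u + 1) ^ 2 =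
        L / (u + 1) - (L * g * (u + 1) - M * u) / (u * (u + 1) ^ 2) := by
      field_simp
      ring
    rw [h3]
    have h4 : 0 ≤ (L * g * (u + 1) - M * u) / (u * (u + 1) ^ 2) := by
      apply div_nonneg _ (by positivity)
      nlinarith [mul_le_mul_of_nonneg_right hML hu.le, mul_nonneg hL0 hg.le]
    linarith

/-! ### Contraction of the excess cost while a clustering persists. -/

section Rate

variable {d k m : ℕ} {X : Finset (Pt d)} [Nonempty X] {near : (Fin k → Pt d) → Pt d → Fin k}
  {c' t_o R p : ℝ}

theorem updateProb_eq_hitProb (C : Fin k → Pt d) (r : Fin k) :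
    updateProb X m near C r = hitProb X m near C r := by
  rw [updateProb, batchLaw, Measure.real,
    PMF.toMeasure_uniformOfFintype_apply _ (Set.toFinite _).measurableSet, hitProb, avg, Finset.sum_boole, Fintype.card_subtype]
  simp [div_eq_inv_mul]

/-- The expected excess cost on the event that the clustering `A` persists contracts. -/
theorem stayIntegral_succ_le (hv : ∀ C, IsVoronoi X C (near C)) (hX : ∀ x ∈ X, ‖x‖ ≤ R)
    (hc : 0 < c') (ht : 0 < t_o) (A : Finpartition X) (T : ℕ)
    (n : ℕ) (x : ℕ × (Fin k → Pt d)) (hn : T ≤ x.1 + n)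
    (hinv : ∀ (ω : ℕ → Fin m → X) (i : ℕ),
      (∀ r, ‖(path (update near c' t_o) x ω i).2 r‖ ≤ R) ∧
      ∀ r, (cell X (near (path (update near c' t_o) x ω i).2) r).Nonempty →
        p ≤ hitProb X m near (path (update near c' t_o) x ω i).2 r) :
    stayIntegral (update (X := X) (m := m) near c' t_o) {y | y.1 < T ∨ clusteringOf X (near y.2) = A}
        (fun y => cost X near y.2 - clusteringCost A) (n + 1) x ≤
      (1 - 2 * rate c' t_o (x.1 + n) * p) *
        stayIntegral (update (X := X) (m := m) near c' t_o) {y | y.1 < T ∨ clusteringOf X (near y.2) = A}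
          (fun y => cost X near y.2 - clusteringCost A) n x +
      4 * X.card * R ^ 2 * rate c' t_o (x.1 + n) ^ 2 := by
  have hK : ∀ t, 0 ≤ 4 * X.card * R ^ 2 * rate c' t_o t ^ 2 := fun t => by positivity
  obtain ⟨D, hD⟩ : ∃ D, D = {y : ℕ × (Fin k → Pt d) | y.1 < T ∨ clusteringOf X (near y.2) = A} :=
    ⟨_, rfl⟩
  rw [← hD]
  classical
  induction n generalizing x with
  | zero =>
    rw [stayIntegral_succ]
    simp only [stayIntegral_zero]
    split_ifs with hx
    · have hA : clusteringOf X (near x.2) = A := by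
        rw [hD] at hx
        rcases hx with h | h
        · omega
        · exact h
      have hlev : level X (near x.2) = clusteringCost A := by rw [level_eq_clusteringCost, hA]
      obtain ⟨h1, h2⟩ := hinv (fun _ _ => Classical.arbitrary X) 0
      have h3 := avg_costWith_step_le (m := m) hX h1 (rate_pos hc ht x.1).le h2
      -- Trajectories that leave `D` contribute 0, which is dominated by the frozen excess cost
      -- because a spread is nonnegative.
      have h4 : ∀ S : Fin m → X, (if update near c' t_o x S ∈ D then
          cost X near (update near c' t_o x S).2 - clusteringCost A else 0) ≤
          costWith (step near (rate c' t_o x.1) x.2 S) (cell X (near x.2)) +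
            -clusteringCost A := by
        intro S
        split_ifs
        · have := (hv (update near c' t_o x S).2).costWith_le (near x.2)
          exact add_le_add_left this _
        · rw [costWith_eq_level_add_spread, hlev]
          linarith [spread_nonneg (X := X) (near x.2) (step near (rate c' t_o x.1) x.2 S)]
      refine (avg_mono h4).trans ?_
      rw [avg_add, avg_const]
      simp only [path] at h3
      have h5 : cost X near x.2 = costWith x.2 (cell X (near x.2)) := rfl
      have h6 := costWith_eq_level_add_spread (X := X) (near x.2) x.2
      rw [add_zero, h5]
      have h7 : costWith x.2 (cell X (near x.2)) - clusteringCost A = spread X (near x.2) x.2 := by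
        linarith
      rw [h7]
      linarith
    · have := hK (x.1 + 0)
      linarith
  | succ n ih =>
    rw [stayIntegral_succ, stayIntegral_succ]
    split_ifs with hx
    · have h1 : ∀ S : Fin m → X, (update near c' t_o x S).1 + n = x.1 + (n + 1) := fun S => by
        simp only [update]; omega
      have h2 := avg_mono fun S : Fin m → X => ih (update near c' t_o x S) (by rw [h1]; exact hn)
        (fun ω i => by
          have := hinv (consSample (S, ω)) (i + 1)
          rwa [path_succ] at this)
      simp only [h1] at h2
      refine h2.trans_eq ?_
      rw [avg_add, avg_const, avg_const_mul]
    · have := hK (x.1 + (n + 1))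
      linarith

/-- The event that the clustering `A` persists from time `T` on. -/
def settledFrom (X : Finset (Pt d)) (m : ℕ) (near : (Fin k → Pt d) → Pt d → Fin k) (c' t_o : ℝ)
    (C₀ : Fin k → Pt d) (T : ℕ) (A : Finpartition X) : Set (ℕ → Fin m → X) :=
  {ω | ∀ t ≥ T, clusteringOf X (near (centroids near c' t_o C₀ ω t)) = A}

theorem measurableSet_settledFrom (C₀ : Fin k → Pt d) (T : ℕ) (A : Finpartition X) :
    MeasurableSet (settledFrom X m near c' t_o C₀ T A) := by
  have : settledFrom X m near c' t_o C₀ T A = ⋂ t : ℕ, ⋂ _ : T ≤ t,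
      {ω | path (update near c' t_o) (0, C₀) ω t ∈
        {y : ℕ × (Fin k → Pt d) | clusteringOf X (near y.2) = A}} := by
    ext ω
    simp [settledFrom, path_update]
  rw [this]
  exact MeasurableSet.iInter fun t => MeasurableSet.iInter fun _ => measurableSet_path _ _ t _

/-- Before the rates fall below 1 only finitely many states are reachable; afterwards convexity
keeps the centroids in the ball. -/
theorem exists_norm_centroids_le (hc : 0 < c') (ht : 0 < t_o) (C₀ : Fin k → Pt d) :
    ∃ R : ℝ, (∀ x ∈ X, ‖x‖ ≤ R) ∧ ∀ (ω : ℕ → Fin m → X) (t : ℕ) (r : Fin k),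
      ‖(path (update near c' t_o) (0, C₀) ω t).2 r‖ ≤ R := by
  obtain ⟨T₀, hT₀⟩ := Filter.eventually_atTop.1
    ((tendsto_rate c' t_o).eventually_lt_const one_pos)
  choose B hB using fun n => exists_norm_path_le (m := m) (X := X) near c' t_o n (0, C₀)
  set R := ∑ n ∈ Finset.range (T₀ + 1), |B n| + ∑ x ∈ X, ‖x‖ with hR
  have h1 : 0 ≤ ∑ x ∈ X, ‖x‖ := Finset.sum_nonneg fun _ _ => norm_nonneg _
  have h2 : 0 ≤ ∑ n ∈ Finset.range (T₀ + 1), |B n| := Finset.sum_nonneg fun _ _ => abs_nonneg _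
  have hX : ∀ x ∈ X, ‖x‖ ≤ R := fun x hx => by
    have := Finset.single_le_sum (f := fun x : Pt d => ‖x‖) (fun _ _ => norm_nonneg _) hx
    linarith
  refine ⟨R, hX, fun ω t => ?_⟩
  rcases le_or_gt t T₀ with h | h
  · intro r
    have h3 := Finset.single_le_sum (f := fun n => |B n|) (fun _ _ => abs_nonneg _)
      (Finset.mem_range.2 (Nat.lt_succ_of_le h))
    linarith [hB t ω r, le_abs_self (B t)]
  · induction t, h.le using Nat.le_induction with
    | base => omega
    | succ t htT ih =>
      have ih' : ∀ r, ‖(path (update near c' t_o) (0, C₀) ω t).2 r‖ ≤ R := by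
        rcases htT.lt_or_eq with h' | h'
        · exact ih h'
        · intro r
          have h3 := Finset.single_le_sum (f := fun n => |B n|) (fun _ _ => abs_nonneg _)
            (Finset.mem_range.2 (show t < T₀ + 1 by omega))
          linarith [hB t ω r, le_abs_self (B t)]
      refine norm_step_le hX ih' (rate_pos hc ht _).le (hT₀ _ ?_).le _
      rw [path_update_fst]; omega

/-- The update probabilities take finitely many values, so a strict lower bound is uniform. -/
theorem exists_uniform_hitProb (hc : 0 < c') : ∃ g : ℝ, 0 < g ∧ ∀ (C : Fin k → Pt d) (r : Fin k),
    1 < 2 * c' * hitProb X m near C r → (1 + g) / (2 * c') ≤ hitProb X m near C r := by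
  obtain ⟨g, hg, h⟩ := exists_gap fun i : Fin (Fintype.card (Fin m → X) + 1) =>
    2 * c' * ((Fintype.card (Fin m → X) : ℝ)⁻¹ * (i : ℕ)) - 1
  refine ⟨g, hg, fun C r hlt => ?_⟩
  have hval : hitProb X m near C r = (Fintype.card (Fin m → X) : ℝ)⁻¹ *
      ((Finset.univ.filter fun S : Fin m → X => (hits near C S r).Nonempty).card : ℕ) := by
    rw [hitProb, avg, Finset.sum_boole]
  have := h ⟨_, Nat.lt_succ_of_le (Finset.card_le_univ
    (Finset.univ.filter fun S : Fin m → X => (hits near C S r).Nonempty))⟩ (by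
      simp only
      rw [← hval]; linarith)
  simp only at this
  rw [← hval] at this
  rw [div_le_iff₀ (by positivity)]
  linarith

theorem pMinPlus_le_hitProb (hm : m ≠ 0) {C : Fin k → Pt d} {r : Fin k}
    (hr : (cell X (near C) r).Nonempty) : pMinPlus X m near C ≤ hitProb X m near C r := by
  have : NeZero m := ⟨hm⟩
  refine csInf_le ⟨0, fun q hq => hq.1.le⟩ ⟨?_, r, (updateProb_eq_hitProb C r).symm⟩
  exact lt_of_lt_of_le batchProb_pos (inv_card_le_hitProb hr)

theorem pMinPlus_nonneg (C : Fin k → Pt d) : 0 ≤ pMinPlus X m near C :=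
  Real.sInf_nonneg fun _ hq => hq.1.le

/-- On the event that a clustering persists from a late time on, the expected excess cost decays
like `1 / t`. -/
theorem exists_abs_integral_cond_le (hv : ∀ C, IsVoronoi X C (near C)) (hc : 0 < c') (ht : 0 < t_o)
    (C₀ : Fin k → Pt d) {g : ℝ} (hg : 0 < g)
    (hhit : ∀ (ω : ℕ → Fin m → X) (t : ℕ) (r : Fin k),
      (cell X (near (centroids near c' t_o C₀ ω t)) r).Nonempty →
      (1 + g) / (2 * c') ≤ hitProb X m near (centroids near c' t_o C₀ ω t) r)
    {T : ℕ} (hT : g ≤ T) (A : Finpartition X) :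
    ∃ K : ℝ, ∀ t : ℕ, 1 ≤ t →
      |∫ ω, (cost X near (centroids near c' t_o C₀ ω t) - clusteringCost A)
        ∂(ProbabilityTheory.cond (uniformLaw (Fin m → X)) (settledFrom X m near c' t_o C₀ T A))| ≤
      K / t := by
  obtain ⟨R, hX, hR⟩ := exists_norm_centroids_le (X := X) (m := m) (near := near) hc ht C₀
  set F := update (X := X) (m := m) near c' t_o with hF
  set D : Set (ℕ × (Fin k → Pt d)) := {y | y.1 < T ∨ clusteringOf X (near y.2) = A} with hD
  set ψ : ℕ × (Fin k → Pt d) → ℝ := fun y => cost X near y.2 - clusteringCost A with hψ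
  set a : ℕ → ℝ := fun t => stayIntegral F D ψ t (0, C₀) with ha
  set E := settledFrom X m near c' t_o C₀ T A with hE
  have hrec : ∀ t ≥ T, a (t + 1) ≤ (1 - (1 + g) / (((t + 1 : ℕ) : ℝ) + t_o)) * a t +
      (4 * X.card * R ^ 2 * c' ^ 2) / (((t + 1 : ℕ) : ℝ) + t_o) ^ 2 := by
    intro t htT
    have := stayIntegral_succ_le (m := m) (p := (1 + g) / (2 * c')) hv hX hc ht A T t (0, C₀)
      (by simpa using htT) (fun ω i => ⟨hR ω i, fun r hr => by
        rw [path_update] at hr ⊢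
        exact hhit ω i r hr⟩)
    simp only [zero_add] at this
    refine this.trans_eq ?_
    have h1 : (0 : ℝ) < ((t + 1 : ℕ) : ℝ) + t_o := by positivity
    simp only [rate]
    congr 1
    -- With `p = (1 + g) / (2 * c')`, the contraction `2 * rate * p` equals `(1 + g) / (t + 1 +
    -- t_o)`.
    · congr 2
      field_simp
    · rw [div_pow, mul_div_assoc]
  obtain ⟨L, hL0, hL⟩ := exists_le_div_of_recursion ht hg (by positivity) hT hrec
  have hψ0 : ∀ t ≥ T, ∀ ω, path F (0, C₀) ω t ∈ D → 0 ≤ ψ (path F (0, C₀) ω t) := by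
    intro t htT ω hω
    have hA : clusteringOf X (near (path F (0, C₀) ω t).2) = A := by
      rcases hω with h | h
      · rw [path_update_fst] at h; omega
      · exact h
    simp only [hψ, cost]
    rw [costWith_eq_level_add_spread, level_eq_clusteringCost, hA]
    linarith [spread_nonneg (X := X) (near (path F (0, C₀) ω t).2) (path F (0, C₀) ω t).2]
  have hEm : MeasurableSet E := measurableSet_settledFrom C₀ T A
  have hED : ∀ t, E ⊆ stays F D (0, C₀) t := by
    intro t ω hω n _
    rw [hF, path_update]
    rcases lt_or_ge n T with h | h
    · exact Or.inl h
    · exact Or.inr (hω n h)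
  set I : ℕ → ℝ := fun t => ∫ ω, (cost X near (centroids near c' t_o C₀ ω t) - clusteringCost A)
    ∂(ProbabilityTheory.cond (uniformLaw (Fin m → X)) E) with hI
  -- If `E` is null, the inverse is infinite and `w` is 0, so the estimates below also cover this
  -- case.
  set w := ((uniformLaw (Fin m → X)) E)⁻¹.toReal with hw
  have hw0 : 0 ≤ w := ENNReal.toReal_nonneg
  have hlate : ∀ t ≥ T, |I t| ≤ w * L / (t + t_o) := by
    intro t htT
    have h1 : I t = w * ∫ ω in E, ψ (path F (0, C₀) ω t) ∂uniformLaw (Fin m → X) := by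
      simp only [hI, hψ, hF, path_update, ProbabilityTheory.cond]
      rw [integral_smul_measure, smul_eq_mul]
    have h2 : 0 ≤ ∫ ω in E, ψ (path F (0, C₀) ω t) ∂uniformLaw (Fin m → X) :=
      setIntegral_nonneg hEm fun ω hω =>
        hψ0 t htT ω (hED (t + 1) hω t (Nat.lt_succ_self t))
    have h3 := (setIntegral_le_stayIntegral F hEm (hED (t + 1)) (hψ0 t htT)).trans (hL t htT)
    rw [h1, abs_of_nonneg (mul_nonneg hw0 h2), mul_div_assoc]
    exact mul_le_mul_of_nonneg_left h3 hw0
  -- The finitely many times before `T` are absorbed into the constant.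
  refine ⟨w * L + ∑ t ∈ Finset.range T, t * |I t|, fun t ht1 => ?_⟩
  have ht0 : (0 : ℝ) < t := by exact_mod_cast ht1
  have hsum : 0 ≤ ∑ t ∈ Finset.range T, (t : ℝ) * |I t| :=
    Finset.sum_nonneg fun _ _ => by positivity
  change |I t| ≤ _
  rw [le_div_iff₀ ht0]
  rcases lt_or_ge t T with h | h
  · have := Finset.single_le_sum (f := fun t : ℕ => (t : ℝ) * |I t|) (fun _ _ => by positivity)
      (Finset.mem_range.2 h)
    have h0 : 0 ≤ w * L := by positivity
    linarith
  · have h1 := hlate t h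
    rw [le_div_iff₀ (by positivity)] at h1
    have h2 : 0 ≤ |I t| * t_o := by positivity
    linarith

/-- The events that a stationary clustering persists exhaust the probability. -/
theorem tendsto_iUnion_settledFrom (hm : m ≠ 0) (hv : ∀ C, IsVoronoi X C (near C))
    (hA0 : NoBoundaryStationary X k) (hc : 0 < c') (ht : 0 < t_o) (C₀ : Fin k → Pt d) :
    Filter.Tendsto (fun T => (uniformLaw (Fin m → X)).real
      (⋃ A : {A : Finpartition X // IsStationary k A}, settledFrom X m near c' t_o C₀ T A.1))
      Filter.atTop (nhds 1) := by
  set U : ℕ → Set (ℕ → Fin m → X) := fun T =>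
    ⋃ A : {A : Finpartition X // IsStationary k A}, settledFrom X m near c' t_o C₀ T A.1 with hU
  have hmono : Monotone U := fun S T hST =>
    Set.iUnion_mono fun A ω hω t ht => hω t (hST.trans ht)
  have huniv : ⋃ T, U T = (unsettled near c' t_o (0, C₀))ᶜ := by
    ext ω
    simp only [hU, Set.mem_iUnion, unsettled, path_update, settledFrom]
    rw [Set.mem_compl_iff, Set.mem_ofPred_eq, not_not]
    constructor
    · rintro ⟨T, ⟨A, hA⟩, h⟩
      exact ⟨A, hA, T, h⟩
    · rintro ⟨A, hA, T, h⟩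
      exact ⟨T, ⟨A, hA⟩, h⟩
  have h0 := unsettledProb_zero_eq_zero (X := X) hm hv hA0 hc ht C₀
  have h1 : (uniformLaw (Fin m → X)).real (⋃ T, U T) = 1 := by
    rw [huniv, probReal_compl_eq_one_sub (measurableSet_unsettled near c' t_o _)]
    unfold unsettledProb at h0
    rw [h0, sub_zero]
  rw [← h1]
  exact (ENNReal.tendsto_toReal (measure_ne_top _ _)).comp
    (tendsto_measure_iUnion_atTop hmono)

end Rate

end

end KMeans

/-! ### The main theorem. -/

theorem mainTheorem1 {d : ℕ} (X : Finset (KMeans.Pt d)) [Nonempty X] (k : ℕ) (hk : 1 ≤ k)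
    (hA0 : KMeans.NoBoundaryStationary X k)
    (rmin : ℝ) (hrmin : 0 < rmin)
    (hstable : ∀ A : Finpartition X, KMeans.IsStationary k A → KMeans.IsStable k A rmin 0)
    (B : ℝ) :
    ∃ K₀ : ℝ, 0 < K₀ ∧
      ∀ (m : ℕ), 1 ≤ m →
      ∀ near : (Fin k → KMeans.Pt d) → KMeans.Pt d → Fin k,
        (∀ C, KMeans.IsVoronoi X C (near C)) →
      ∀ (C₀ : Fin k → KMeans.Pt d) (c' t_o δ : ℝ), 0 < c' → 0 < t_o → 0 < δ → δ < 1 →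
      KMeans.BoundedMoments X m near c' t_o C₀ B →
      (∀ (ω : ℕ → Fin m → X) (t : ℕ),
        1 < c' * (2 * KMeans.pMinPlus X m near (KMeans.centroids near c' t_o C₀ ω t) *
          (1 - √(1 - rmin * KMeans.optCost X k /
            (2 * KMeans.cost X near (KMeans.centroids near c' t_o C₀ ω (t + 1))))))) →
      K₀ * (c' ^ 2 / (KMeans.rho X k m ^ 2 * (2 * c' - 1)) * Real.log (1 / δ))
          ^ (2 / (2 * c' - 1)) ≤ t_o →
      1 - δ ≤ (KMeans.sampleLaw X m).real
        {ω | ∃ A : Finpartition X, KMeans.IsStationary k A ∧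
          ω ∈ KMeans.eventuallyAt m near c' t_o C₀ A} ∧
      ∃ G_o : Finpartition X → Set (ℕ → Fin m → X),
        (∀ A, KMeans.IsStationary k A →
          MeasurableSet (G_o A) ∧ G_o A ⊆ KMeans.eventuallyAt m near c' t_o C₀ A) ∧
        1 - δ ≤ (KMeans.sampleLaw X m).real
          (⋃ A : {A : Finpartition X // KMeans.IsStationary k A}, G_o A.1) ∧
        ∀ A, KMeans.IsStationary k A → ∃ K : ℝ, ∀ t : ℕ, 1 ≤ t →
          |∫ ω, (KMeans.cost X near (KMeans.centroids near c' t_o C₀ ω t)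
              - KMeans.clusteringCost A) ∂(ProbabilityTheory.cond (KMeans.sampleLaw X m) (G_o A))|
            ≤ K / t := by
  -- Settling has probability one, so `K₀ = 1` serves; `δ` enters only through the choice of `T`.
  refine ⟨1, one_pos, fun m hm near hv C₀ c' t_o δ hc ht hδ _ _ hrate _ => ?_⟩
  have hm0 : m ≠ 0 := by omega
  have hlim := KMeans.tendsto_iUnion_settledFrom hm0 hv hA0 hc ht C₀
  obtain ⟨g, hg, hgap⟩ := KMeans.exists_uniform_hitProb (X := X) (m := m) (near := near) hc
  obtain ⟨T, hT1, hT2⟩ := ((hlim.eventually_const_lt (sub_lt_self 1 hδ)).and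
    (tendsto_natCast_atTop_atTop.eventually_ge_atTop g)).exists
  have hhit : ∀ (ω : ℕ → Fin m → X) (t : ℕ) (r : Fin k),
      (KMeans.cell X (near (KMeans.centroids near c' t_o C₀ ω t)) r).Nonempty →
      (1 + g) / (2 * c') ≤ KMeans.hitProb X m near (KMeans.centroids near c' t_o C₀ ω t) r := by
    intro ω t r hr
    -- The factor with the square root is at most 1, so the condition on `c'` implies `1 < 2 * c' *
    -- p` for the update probability `p` of every nonempty cluster.
    refine hgap _ _ ((hrate ω t).trans_le ?_)
    have h1 := KMeans.pMinPlus_le_hitProb hm0 hr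
    have h2 := KMeans.pMinPlus_nonneg (X := X) (m := m) (near := near)
      (KMeans.centroids near c' t_o C₀ ω t)
    have h3 := mul_le_of_le_one_right h2 (sub_le_self 1 (Real.sqrt_nonneg
      (1 - rmin * KMeans.optCost X k /
        (2 * KMeans.cost X near (KMeans.centroids near c' t_o C₀ ω (t + 1))))))
    have h4 := mul_le_mul_of_nonneg_left (h3.trans h1) (show 0 ≤ 2 * c' by positivity)
    linarith
  have hsub : ∀ A, KMeans.settledFrom X m near c' t_o C₀ T A ⊆
      KMeans.eventuallyAt m near c' t_o C₀ A := fun A ω hω => ⟨T, hω⟩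
  -- `sampleLaw` agrees with `uniformLaw` by unfolding. The same `T` serves for all stationary
  -- clusterings.
  refine ⟨hT1.le.trans (MeasureTheory.measureReal_mono ?_),
    KMeans.settledFrom X m near c' t_o C₀ T, fun A _ =>
      ⟨KMeans.measurableSet_settledFrom C₀ T A, hsub A⟩, hT1.le, fun A _ =>
      KMeans.exists_abs_integral_cond_le hv hc ht C₀ hg hhit hT2 A⟩
  intro ω hω
  obtain ⟨A, hA⟩ := Set.mem_iUnion.1 hω
  exact ⟨A.1, A.2, hsub A.1 hA⟩
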